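/- Let $E$ be an imaginary quadratic field whose ring of integers $R$ is a principal ideal domain, fix an embedding $E\hookrightarrow\mathbb{C}$, and let $r\ge 0$. Let $\mathrm{GL}_r(R)$ act on the real vector space $\mathrm{Herm}_r(\mathbb{C})$ of Hermitian $r\times r$ matrices by change of basis, $X\cdot A={}^tXA\overline{X}$. For a positive definite $A\in\mathrm{Herm}_r(\mathbb{C})$ let $M(A)\subset R^r\setminus\{0\}$ be the set of minimal vectors, i.e. of the nonzero $v\in R^r$ at which ${}^tvA\overline{v}$ attains its minimum over $R^r\setminus\{0\}$; let $M'(A)\subset M(A)$ consist of one vector out of each class $\{\lambda v:\lambda\in R^\times\}$, and let $\sigma(A)=\mathbb{R}_{\ge0}\langle vv^*: v\in M(A)\rangle$. A *Hermitian perfect cone* is a cone $\sigma(A)$ with $A$ positive definite, or the zero cone. A Hermitian perfect cone $\sigma$ is *alternating* if every automorphism of its linear span $\mathbb{R}\langle\sigma\rangle$ induced by an element of $\mathrm{GL}_r(R)$ stabilizing $\sigma$ is orientation-preserving. Choose a set $\Gamma_r$ with one representative of each $\mathrm{GL}_r(R)$-orbit of alternating Hermitian perfect cones, and an orientation $\omega_\sigma$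 of $\mathbb{R}\langle\sigma\rangle$ for every alternating $\sigma$, compatibly with the $\mathrm{GL}_r(R)$-action. The *Hermitian perfect cone complex* $P^{(r)}_\bullet$ has $P^{(r)}_n=\mathbb{Q}\langle e_\sigma:\sigma\in\Gamma_r,\ \dim\sigma=n\rangle$ and $\partial e_\sigma=\sum_{\tau}\delta(\omega_\tau,\omega_\sigma|_\tau)\,e_{\tau'}$, where $\tau$ runs over the alternating facets of $\sigma$, $\tau'\in\Gamma_r$ is the representative of the orbit of $\tau$, and $\delta$ is $1$ if $\omega_\tau$ is the orientation induced by $\omega_\sigma$ and $-1$ otherwise. A vector $v$ in a finite set $S\subset R^r$ is an *$R^r$-coloop* of $S$ if there is an $R$-basis $v,w_2,\dots,w_r$ of $R^r$ such that $S\setminus\{v\}$ lies in the $R$-span of $w_2,\dots,w_r$; the cone $\sigma(A)$ *has a coloop* if some $v\in M'(A)$ is an $R^r$-coloop of $M'(A)$. The *rank* of a cone is the maximal rank of a matrix in it. Let $I^{(r)}_n\subset P^{(r)}_n$ be the span of the $e_\sigma$ for which $\sigma$ either has rank $r$ and a coloop, or has rank at most $r-1$. **Theorem.** $(P^{(r)}_\bullet,\partial)$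 is a chain complex, $I^{(r)}_\bullet$ is a subcomplex of it (the *inflation subcomplex*), and the chain complex $I^{(r)}_\bullet$ is acyclic: all of its homology groups vanish. -/

import Mathlib

open scoped NumberField ComplexOrder

namespace HermitianPerfectCone

/-! ### Coloops -/

section Coloops

variable {R : Type*} [CommRing R] {r : ℕ}

/-- `v` is an `R^r`-coloop of `S`: it belongs to `S` and to an `R`-basis of `R^r` whose other
members span a submodule containing every `w ∈ S` different from `v`. -/
def IsColoop (S : Set (Fin r → R)) (v : Fin r → R) : Prop :=
  v ∈ S ∧ ∃ (b : Module.Basis (Fin r) R (Fin r → R)) (i : Fin r), b i = v ∧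
    ∀ w ∈ S, w ≠ v → w ∈ Submodule.span R (b '' {j | j ≠ i})

/-- `M'` consists of one chosen vector out of each class `{λ v | λ ∈ Rˣ}`, `v ∈ M`. -/
def IsUnitTransversal (M' M : Set (Fin r → R)) : Prop :=
  M' ⊆ M ∧ ∀ v ∈ M, ∃! s, s ∈ M' ∧ ∃ u : Rˣ, s = u • v

end Coloops

section Cones

/-! `E` is the field, `φ` a fixed complex embedding, and `R = 𝓞 E`. All cones below lie in the
real vector space `Herm_r(ℂ)` of Hermitian matrices, which is viewed inside the real vector space
of all complex `r × r` matrices; spans, dimensions and faces of a cone do not see the difference. -/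

variable {E : Type*} [Field E] (φ : E →+* ℂ) {r : ℕ}

/-- The inclusion `R^r → ℂ^r` given by the embedding `φ`. -/
noncomputable def toComplex (v : Fin r → 𝓞 E) : Fin r → ℂ := fun i => φ (v i : E)

/-- The value at `v ∈ R^r` of the Hermitian form with matrix `A`, that is `ᵗv A v̄`
(a real number if `A` is Hermitian). -/
noncomputable def formValue (A : Matrix (Fin r) (Fin r) ℂ) (v : Fin r → 𝓞 E) : ℝ :=
  (toComplex φ v ⬝ᵥ A.mulVec (star (toComplex φ v))).re

/-- The set `M(A)` of minimal vectors. -/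
def minVectors (A : Matrix (Fin r) (Fin r) ℂ) : Set (Fin r → 𝓞 E) :=
  {v | v ≠ 0 ∧ ∀ w : Fin r → 𝓞 E, w ≠ 0 → formValue φ A v ≤ formValue φ A w}

/-- The Hermitian matrix `v v*`. -/
noncomputable def rankOne (v : Fin r → 𝓞 E) : Matrix (Fin r) (Fin r) ℂ :=
  Matrix.vecMulVec (toComplex φ v) (star (toComplex φ v))

/-- The cone `σ(A) = ℝ≥0⟨v v* | v ∈ M(A)⟩`. -/
noncomputable def perfectCone (A : Matrix (Fin r) (Fin r) ℂ) :
    PointedCone ℝ (Matrix (Fin r) (Fin r) ℂ) :=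
  PointedCone.hull ℝ (rankOne φ '' minVectors φ A)

/-- The cones of the Hermitian perfect cone decomposition: the `σ(A)` with `A` positive definite,
and the zero cone. (The zero cone is a face of all the others, so it belongs to the fan; for
`r ≥ 1` it is the only face of a `σ(A)` which is not itself of the form `σ(B)`.) -/
def IsHermitianPerfectCone (σ : PointedCone ℝ (Matrix (Fin r) (Fin r) ℂ)) : Prop :=
  σ = ⊥ ∨ ∃ A : Matrix (Fin r) (Fin r) ℂ, A.PosDef ∧ σ = perfectCone φ A

/-- A Hermitian perfect cone `σ = σ(A)` has a coloop if some member of `M'(A)` is an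
`R^r`-coloop of `M'(A)`. -/
def HasColoop (σ : PointedCone ℝ (Matrix (Fin r) (Fin r) ℂ)) : Prop :=
  ∃ A : Matrix (Fin r) (Fin r) ℂ, A.PosDef ∧ σ = perfectCone φ A ∧
    ∃ M' : Set (Fin r → 𝓞 E), IsUnitTransversal M' (minVectors φ A) ∧ ∃ v, IsColoop M' v

/-- The rank of a cone: the maximal rank of a matrix in it. -/
noncomputable def coneRank (σ : PointedCone ℝ (Matrix (Fin r) (Fin r) ℂ)) : ℕ :=
  sSup {k | ∃ X ∈ σ, X.rank = k}

/-- The `ℝ`-linear span of a cone. -/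
noncomputable def linSpan (σ : PointedCone ℝ (Matrix (Fin r) (Fin r) ℂ)) :
    Submodule ℝ (Matrix (Fin r) (Fin r) ℂ) :=
  Submodule.span ℝ (σ : Set (Matrix (Fin r) (Fin r) ℂ))

/-! ### The action of `GL_r(R)` -/

/-- `GL_r(R) → GL_r(ℂ)`, given by the embedding `φ`. -/
noncomputable def glToComplex (g : GL (Fin r) (𝓞 E)) : GL (Fin r) ℂ :=
  Units.map ((φ.comp (algebraMap (𝓞 E) E)).mapMatrix (m := Fin r)).toMonoidHom g

/-- The change of basis action `A ↦ g A g*`, so that `v v* ↦ (gv)(gv)*`. (Written in terms of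
`X = ᵗg` it reads `A ↦ ᵗX A X̄`.) -/
noncomputable def act (g : GL (Fin r) (𝓞 E)) :
    Matrix (Fin r) (Fin r) ℂ ≃ₗ[ℝ] Matrix (Fin r) (Fin r) ℂ where
  toFun A := (glToComplex φ g).val * A * (glToComplex φ g).val.conjTranspose
  invFun A := (glToComplex φ g)⁻¹.val * A * (glToComplex φ g)⁻¹.val.conjTranspose
  map_add' A B := by rw [mul_add, add_mul]
  map_smul' c A := by simp
  left_inv A := by
    have h : (glToComplex φ g)⁻¹.val * (glToComplex φ g).val = 1 := Units.inv_mul _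
    calc _ = ((glToComplex φ g)⁻¹.val * (glToComplex φ g).val) * A *
          ((glToComplex φ g)⁻¹.val * (glToComplex φ g).val).conjTranspose := by
            simp only [Matrix.conjTranspose_mul, mul_assoc]
      _ = A := by rw [h]; simp
  right_inv A := by
    have h : (glToComplex φ g).val * (glToComplex φ g)⁻¹.val = 1 := Units.mul_inv _
    calc _ = ((glToComplex φ g).val * (glToComplex φ g)⁻¹.val) * A *
          ((glToComplex φ g).val * (glToComplex φ g)⁻¹.val).conjTranspose := by
            simp only [Matrix.conjTranspose_mul, mul_assoc]
      _ = A := by rw [h]; simp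

/-- The cone `g · σ`. -/
noncomputable def moveCone (g : GL (Fin r) (𝓞 E)) (σ : PointedCone ℝ (Matrix (Fin r) (Fin r) ℂ)) :
    PointedCone ℝ (Matrix (Fin r) (Fin r) ℂ) :=
  σ.map (act φ g : Matrix (Fin r) (Fin r) ℂ →ₗ[ℝ] Matrix (Fin r) (Fin r) ℂ)

theorem map_linSpan {g : GL (Fin r) (𝓞 E)} {σ τ : PointedCone ℝ (Matrix (Fin r) (Fin r) ℂ)}
    (h : moveCone φ g σ = τ) :
    (linSpan σ).map (act φ g : Matrix (Fin r) (Fin r) ℂ →ₗ[ℝ] Matrix (Fin r) (Fin r) ℂ) =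
      linSpan τ := by
  subst h
  rw [linSpan, linSpan, Submodule.map_span]
  rfl

/-- If `g · σ = τ`, the isomorphism `ℝ⟨σ⟩ ≅ ℝ⟨τ⟩` induced by `g`. -/
noncomputable def spanEquiv {g : GL (Fin r) (𝓞 E)} {σ τ : PointedCone ℝ (Matrix (Fin r) (Fin r) ℂ)}
    (h : moveCone φ g σ = τ) : linSpan σ ≃ₗ[ℝ] linSpan τ :=
  (act φ g).ofSubmodules (linSpan σ) (linSpan τ) (map_linSpan φ h)

/-- `σ` is alternating: every automorphism of its span induced by an element of `GL_r(R)`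
which maps `σ` onto itself preserves orientations. -/
def IsAlternating (σ : PointedCone ℝ (Matrix (Fin r) (Fin r) ℂ)) : Prop :=
  ∀ (g : GL (Fin r) (𝓞 E)) (h : moveCone φ g σ = σ),
    0 < LinearMap.det (spanEquiv φ h : linSpan σ →ₗ[ℝ] linSpan σ)

/-- The alternating Hermitian perfect cones of dimension `n`. -/
def AltCone (r n : ℕ) : Type :=
  {σ : PointedCone ℝ (Matrix (Fin r) (Fin r) ℂ) //
    IsHermitianPerfectCone φ σ ∧ IsAlternating φ σ ∧ Module.finrank ℝ (linSpan σ) = n}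

variable {φ} {n : ℕ}

/-- Two cones in the same `GL_r(R)`-orbit. -/
def SameOrbit (σ τ : AltCone φ r n) : Prop :=
  ∃ g : GL (Fin r) (𝓞 E), moveCone φ g σ.1 = τ.1

/-! ### Orientations -/

/-- The orientation `oσ` of `ℝ⟨σ⟩` induces the orientation `oτ` of `ℝ⟨τ⟩`, by the convention
"outward vector first": for a volume form `f` representing `oσ` and a vector `u ∈ ℝ⟨σ⟩` that
points out of `σ` along `τ`, the form `f(u, -, …, -)` restricted to `ℝ⟨τ⟩` represents `oτ`. -/
def Induces {τ σ : PointedCone ℝ (Matrix (Fin r) (Fin r) ℂ)}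
    (oτ : Orientation ℝ (linSpan τ) (Fin n))
    (oσ : Orientation ℝ (linSpan σ) (Fin (n + 1))) : Prop :=
  ∃ (hle : linSpan τ ≤ linSpan σ) (u : linSpan σ)
    (f : (linSpan σ) [⋀^Fin (n + 1)]→ₗ[ℝ] ℝ) (hf : f ≠ 0)
    (hg : (f.curryLeft u).compLinearMap (Submodule.inclusion hle) ≠ 0),
    -(u : Matrix (Fin r) (Fin r) ℂ) ∈ σ ∧ (u : Matrix (Fin r) (Fin r) ℂ) ∉ linSpan τ ∧
    rayOfNeZero ℝ f hf = oσ ∧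
    rayOfNeZero ℝ ((f.curryLeft u).compLinearMap (Submodule.inclusion hle)) hg = oτ

variable (φ r) in
/-- The choices that enter the Hermitian perfect cone complex: one representative out of each
`GL_r(R)`-orbit of alternating cones, and an orientation of each alternating cone, such that the
isomorphisms induced by `GL_r(R)` match the orientations of the cones in an orbit. -/
structure ConeChoices where
  reps : ∀ n, Set (AltCone φ r n)
  existsUnique_rep : ∀ (n : ℕ) (σ : AltCone φ r n), ∃! τ, τ ∈ reps n ∧ SameOrbit σ τ
  orient : ∀ (n : ℕ) (σ : AltCone φ r n), Orientation ℝ (linSpan σ.1) (Fin n)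
  orient_compatible : ∀ (n : ℕ) (σ τ : AltCone φ r n) (g : GL (Fin r) (𝓞 E))
    (h : moveCone φ g σ.1 = τ.1),
    Orientation.map (Fin n) (spanEquiv φ h) (orient n σ) = orient n τ

namespace ConeChoices

variable (c : ConeChoices φ r)

/-- The chosen representative of the orbit of `τ`. -/
noncomputable def rep (τ : AltCone φ r n) : c.reps n :=
  ⟨(c.existsUnique_rep n τ).choose, (c.existsUnique_rep n τ).choose_spec.1.1⟩

open Classical in
/-- The sign `δ(ω_τ, ω_σ|_τ)`. -/
noncomputable def sign (τ : AltCone φ r n) (σ : AltCone φ r (n + 1)) : ℚ :=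
  if Induces (c.orient n τ) (c.orient (n + 1) σ) then 1 else -1

/-- The alternating facets (faces of codimension one) of `σ`. There are only finitely many. -/
def altFacets (σ : AltCone φ r (n + 1)) : Set (AltCone φ r n) :=
  {τ | τ.1.IsFaceOf σ.1}

/-- The space `P_n` with basis `e_σ`, for `σ` a chosen representative of dimension `n`. -/
abbrev Chains (n : ℕ) : Type := c.reps n →₀ ℚ

/-- The differential `∂ : P_{n+1} → P_n`. -/
noncomputable def boundary (n : ℕ) : c.Chains (n + 1) →ₗ[ℚ] c.Chains n :=
  Finsupp.linearCombination ℚ fun σ : c.reps (n + 1) =>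
    ∑ᶠ τ ∈ altFacets σ.1, c.sign τ σ.1 • (Finsupp.single (c.rep τ) 1 : c.Chains n)

/-- The degree `n` part `I_n` of the inflation subcomplex, spanned by the `e_σ` for which `σ`
has rank `r` and a coloop, or has rank at most `r - 1`. -/
noncomputable def inflation (n : ℕ) : Submodule ℚ (c.Chains n) :=
  Submodule.span ℚ {x | ∃ σ : c.reps n,
    ((coneRank σ.1.1 = r ∧ HasColoop φ σ.1.1) ∨ coneRank σ.1.1 < r) ∧ x = Finsupp.single σ 1}

/-- The inflation subcomplex, given that the boundary maps form a complex and that they preserve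
the subspaces `I_n`. -/
noncomputable def inflationComplex
    (hd : ∀ n, c.boundary n ∘ₗ c.boundary (n + 1) = 0)
    (hI : ∀ n, ∀ x ∈ c.inflation (n + 1), c.boundary n x ∈ c.inflation n) :
    ChainComplex (ModuleCat ℚ) ℕ :=
  ChainComplex.of (fun n => ModuleCat.of ℚ (c.inflation n))
    (fun n => ModuleCat.ofHom ((c.boundary n).restrict (hI n)))
    (fun n => by
      refine ModuleCat.hom_ext (LinearMap.ext fun x => ?_)
      exact Subtype.ext (LinearMap.congr_fun (hd n) x.1))

end ConeChoices

end Cones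

end HermitianPerfectCone

namespace HermitianPerfectCone

/-! ### Finitely generated cones and their faces -/

section Polyhedral

open Module

variable {V : Type*} [AddCommGroup V] [Module ℝ V]

/-! The basis of the inflation complex splits into the cones with a coloop (of any rank) and the
cones of rank below `r` without one. Removing the coloop vector ("deflation") matches the coloop
orbits of dimension `n + 1` with the coloop-free orbits of rank `< r` and dimension `n`. Every facet
of a coloop cone other than its deflation still contains the coloop vector, so it has a coloop too.
Hence, modulo coloop cones, the boundary of a coloop cone is plus or minus its deflation, and the
complex cancels in pairs: a cycle is first changed by a boundary until it is supported on coloop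
cones, and the boundary map is injective on chains with that support.

The matching must respect "alternating". If a cone had two essentially different coloops, a
reflection over `R` would exchange them and fix all the other vectors; it acts on the span with
determinant `-1`, so an alternating cone has only one coloop up to units (`IsConeColoop.unique`),
and its deflation has none. Stabilizers of a cone and of its deflation induce the same determinants
(`IsConeColoop.det_eq`), because any two vectors complementary to a given set are conjugate under an
automorphism fixing that set (`exists_equiv_fixing`, `exists_gl_extending`). Conversely, a cone of
rank `< r` is killed by a unimodular functional over the principal ideal domain `R`
(`exists_functional_of_coneRank_lt`), and adding one orthogonal direction of the same minimum to its
form inflates it (`exists_inflation`).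

That `∂² = 0` rests on polyhedral geometry: faces of perfect cones are perfect cones, and a face of
codimension two lies in exactly two facets, whose contributions cancel (`exists_two_facets`,
`orientationSign_diamond`). Facets that are not alternating may be put back into the sum because
their own boundary sums vanish (`facetSum_eq_zero`).

Cones are handled through their primitive vectors (`coneVectors`), which for `σ(A)` are exactly the
minimal vectors of `A` and determine the cone. -/

theorem mem_span_cone_iff {C : PointedCone ℝ V} {x : V} :
    x ∈ Submodule.span ℝ (C : Set V) ↔ ∃ a ∈ C, ∃ b ∈ C, x = a - b := by
  constructor
  · intro hx
    induction hx using Submodule.span_induction with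
    | mem x h => exact ⟨x, h, 0, C.zero_mem, by simp⟩
    | zero => exact ⟨0, C.zero_mem, 0, C.zero_mem, by simp⟩
    | add x y _ _ hx hy =>
      obtain ⟨a, ha, b, hb, rfl⟩ := hx
      obtain ⟨a', ha', b', hb', rfl⟩ := hy
      exact ⟨a + a', C.add_mem ha ha', b + b', C.add_mem hb hb', by abel⟩
    | smul c x _ hx =>
      obtain ⟨a, ha, b, hb, rfl⟩ := hx
      rcases le_total 0 c with hc | hc
      · exact ⟨c • a, C.smul_mem hc ha, c • b, C.smul_mem hc hb, smul_sub _ _ _⟩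
      · refine ⟨(-c) • b, C.smul_mem (by linarith) hb, (-c) • a, C.smul_mem (by linarith) ha, ?_⟩
        rw [smul_sub, neg_smul, neg_smul]; abel
  · rintro ⟨a, ha, b, hb, rfl⟩
    exact Submodule.sub_mem _ (Submodule.subset_span ha) (Submodule.subset_span hb)

/-- If `x = a - b` with `a` and `b` in the face, then `x + b` lies in the face, and so does its
summand `x`. -/
theorem mem_face_of_mem_span {C F : PointedCone ℝ V} (hF : F.IsFaceOf C) {x : V} (hx : x ∈ C)
    (h : x ∈ Submodule.span ℝ (F : Set V)) : x ∈ F := by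
  obtain ⟨a, ha, b, hb, rfl⟩ := mem_span_cone_iff.1 h
  exact hF.mem_of_add_mem_left hx (hF.le hb) (by simpa using ha)

/-- When a nonnegative combination lies in a face, each generator with positive coefficient does. So
a face is determined by the generators it contains. -/
theorem face_eq_hull {G : Set V} {F : PointedCone ℝ V}
    (hF : F.IsFaceOf (PointedCone.hull ℝ G)) : F = PointedCone.hull ℝ (G ∩ F) := by
  refine le_antisymm (fun x hx => ?_) (Submodule.span_le.2 fun x hx => hx.2)
  obtain ⟨c, hc, h0, rfl⟩ := PointedCone.mem_hull_set.1 (hF.le hx)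
  rw [Finsupp.sum] at hx ⊢
  refine Submodule.sum_mem _ fun g hg => PointedCone.smul_mem _ (h0 g) ?_
  refine PointedCone.subset_hull ⟨hc hg, ?_⟩
  have hpos : 0 < c g := lt_of_le_of_ne (h0 g) (Ne.symm (Finsupp.mem_support_iff.1 hg))
  classical
  rw [← Finset.add_sum_erase _ _ hg] at hx
  refine hF.mem_of_smul_add_mem (PointedCone.subset_hull (hc hg)) ?_ hpos hx
  exact Submodule.sum_mem _ fun g' hg' => PointedCone.smul_mem _ (h0 g')
    (PointedCone.subset_hull (hc (Finset.mem_of_mem_erase hg')))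

theorem finite_faces {G : Set V} (hG : G.Finite) :
    {F : PointedCone ℝ V | F.IsFaceOf (PointedCone.hull ℝ G)}.Finite := by
  refine Set.Finite.subset (hG.finite_subsets.image fun S => PointedCone.hull ℝ S) ?_
  intro F hF
  exact ⟨G ∩ F, Set.inter_subset_left, (face_eq_hull hF).symm⟩

theorem le_of_generators_le {G : Set V} {ℓ : V →ₗ[ℝ] ℝ} (h : ∀ g ∈ G, 0 ≤ ℓ g) :
    ∀ x ∈ PointedCone.hull ℝ G, 0 ≤ ℓ x := by
  intro x hx
  obtain ⟨c, hc, h0, rfl⟩ := PointedCone.mem_hull_set.1 hx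
  rw [Finsupp.sum, map_sum]
  refine Finset.sum_nonneg fun g hg => ?_
  rw [map_smul]
  exact mul_nonneg (h0 g) (h g (hc hg))

/-- The face of a cone cut out by a functional. -/
def zeroFace (C : PointedCone ℝ V) (ℓ : V →ₗ[ℝ] ℝ) : PointedCone ℝ V :=
  C ⊓ PointedCone.ofSubmodule (LinearMap.ker ℓ)

theorem mem_zeroFace {C : PointedCone ℝ V} {ℓ : V →ₗ[ℝ] ℝ} {x : V} :
    x ∈ zeroFace C ℓ ↔ x ∈ C ∧ ℓ x = 0 := Iff.rfl

theorem zeroFace_isFaceOf {C : PointedCone ℝ V} {ℓ : V →ₗ[ℝ] ℝ} (h : ∀ x ∈ C, 0 ≤ ℓ x) :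
    (zeroFace C ℓ).IsFaceOf C := by
  refine PointedCone.IsFaceOf.of_mem_of_add_mem_left inf_le_left fun {x y} hx hy hxy => ⟨hx, ?_⟩
  have h1 : ℓ (x + y) = 0 := (mem_zeroFace.1 hxy).2
  rw [map_add] at h1
  have := h x hx
  have := h y hy
  exact (by linarith : ℓ x = 0)

variable [FiniteDimensional ℝ V]

/-- Gordan's alternative: a finite set without a nontrivial nonnegative relation lies in an open
half space. -/
theorem exists_pos_functional (S : Finset V)
    (hS : ∀ c : V → ℝ, (∀ v, 0 ≤ c v) → ∑ v ∈ S, c v • v = 0 → ∀ v ∈ S, c v = 0) :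
    ∃ ℓ : V →ₗ[ℝ] ℝ, ∀ v ∈ S, 0 < ℓ v := by
  -- `V` carries no topology, so Hahn–Banach is applied in coordinates: `0` is strictly separated
  -- from the compact convex hull of `S`.
  let e : V ≃ₗ[ℝ] (Fin (finrank ℝ V) → ℝ) := (finBasis ℝ V).equivFun
  have hfin : (e '' (S : Set V)).Finite := S.finite_toSet.image e
  have hnot : (0 : Fin (finrank ℝ V) → ℝ) ∉ convexHull ℝ (e '' (S : Set V)) := by
    intro h0
    have h1 : e 0 ∈ e '' convexHull ℝ (S : Set V) := by
      rw [map_zero]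
      have := e.toLinearMap.image_convexHull (S : Set V)
      erw [this]
      exact h0
    obtain ⟨x, hx, hxe⟩ := h1
    rw [e.injective hxe] at hx
    rw [Finset.convexHull_eq] at hx
    obtain ⟨w, hw0, hw1, hw⟩ := hx
    rw [Finset.centerMass_eq_of_sum_1 _ _ hw1] at hw
    classical
    have := hS (fun v => if v ∈ S then w v else 0)
      (fun v => by by_cases hv : v ∈ S <;> simp [hv, hw0]) (by
        rw [← hw]
        exact Finset.sum_congr rfl fun v hv => by simp [hv])
    have h2 : ∑ y ∈ S, w y = 0 := Finset.sum_eq_zero fun v hv => by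
      have := this v hv
      simpa [hv] using this
    rw [h2] at hw1
    exact zero_ne_one hw1
  obtain ⟨f, hf⟩ := geometric_hahn_banach_point_closed (convex_convexHull ℝ _)
    (hfin.isCompact_convexHull (𝕜 := ℝ)).isClosed hnot
  obtain ⟨u, hu, hf⟩ := hf
  refine ⟨f.toLinearMap ∘ₗ e.toLinearMap, fun v hv => ?_⟩
  rw [map_zero] at hu
  exact hu.trans (hf _ (subset_convexHull ℝ _ ⟨v, hv, rfl⟩))

/-- Faces of finitely generated cones are exposed. -/
theorem exists_exposing {G : Set V} (hG : G.Finite) {F : PointedCone ℝ V}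
    (hF : F.IsFaceOf (PointedCone.hull ℝ G)) :
    ∃ ℓ : V →ₗ[ℝ] ℝ, ∀ x ∈ PointedCone.hull ℝ G, 0 ≤ ℓ x ∧ (ℓ x = 0 ↔ x ∈ F) := by
  classical
  set W := Submodule.span ℝ (F : Set V) with hW
  -- Gordan's alternative modulo the span of `F`: a nonnegative relation among the images of the
  -- generators outside `F` lifts to an element of the cone in the span of `F`, hence in `F`, and
  -- this would force one of those generators into `F`.
  have key : ∃ ℓ : V ⧸ W →ₗ[ℝ] ℝ, ∀ g ∈ G, g ∉ F → 0 < ℓ (W.mkQ g) := by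
    refine (exists_pos_functional ((hG.toFinset.filter (· ∉ F)).image W.mkQ) ?_).imp
      fun ℓ hℓ g hg hgF => hℓ _ (Finset.mem_image_of_mem _ (by simp [hg, hgF]))
    intro c hc hsum v hv
    obtain ⟨g, hg, rfl⟩ := Finset.mem_image.1 hv
    by_contra hne
    have hpos : 0 < c (W.mkQ g) := lt_of_le_of_ne (hc _) (Ne.symm hne)
    choose! s hs using fun q (hq : q ∈ (hG.toFinset.filter (· ∉ F)).image W.mkQ) =>
      Finset.mem_image.1 hq
    have hmem : ∑ q ∈ (hG.toFinset.filter (· ∉ F)).image W.mkQ, c q • s q ∈ W := by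
      rw [← Submodule.Quotient.mk_eq_zero, ← Submodule.mkQ_apply, map_sum, ← hsum]
      exact Finset.sum_congr rfl fun q hq => by rw [map_smul, (hs q hq).2]
    have hC : ∀ q ∈ (hG.toFinset.filter (· ∉ F)).image W.mkQ,
        s q ∈ PointedCone.hull ℝ G := fun q hq => PointedCone.subset_hull
      (hG.mem_toFinset.1 (Finset.mem_filter.1 (hs q hq).1).1)
    have hmemF := mem_face_of_mem_span hF
      (Submodule.sum_mem _ fun q hq => PointedCone.smul_mem _ (hc q) (hC q hq)) hmem
    rw [← Finset.add_sum_erase _ _ hv] at hmemF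
    have := hF.mem_of_smul_add_mem (hC _ hv) (Submodule.sum_mem _ fun q hq =>
      PointedCone.smul_mem _ (hc q) (hC q (Finset.mem_of_mem_erase hq))) hpos hmemF
    exact (Finset.mem_filter.1 (hs _ hv).1).2 this
  obtain ⟨ℓ, hℓ⟩ := key
  have hz : ∀ x ∈ F, (ℓ ∘ₗ W.mkQ) x = 0 := fun x hx => by
    have : W.mkQ x = 0 := (Submodule.Quotient.mk_eq_zero W).2 (Submodule.subset_span hx)
    rw [LinearMap.comp_apply, this, map_zero]
  have hnn : ∀ g ∈ G, 0 ≤ (ℓ ∘ₗ W.mkQ) g := fun g hg => by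
    by_cases hgF : g ∈ F
    · exact (hz g hgF).ge
    · exact (hℓ g hg hgF).le
  refine ⟨ℓ ∘ₗ W.mkQ, fun x hx => ⟨le_of_generators_le hnn x hx, fun h => ?_, hz x⟩⟩
  obtain ⟨c, hc, h0, rfl⟩ := PointedCone.mem_hull_set.1 hx
  rw [Finsupp.sum] at h ⊢
  rw [map_sum, Finset.sum_eq_zero_iff_of_nonneg] at h
  · refine Submodule.sum_mem _ fun g hg => PointedCone.smul_mem _ (h0 g) ?_
    by_contra hgF
    have h1 := h g hg
    rw [map_smul, smul_eq_mul, mul_eq_zero] at h1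
    rcases h1 with h1 | h1
    · exact Finsupp.mem_support_iff.1 hg h1
    · exact (hℓ g (hc hg) hgF).ne' h1
  · intro g hg
    rw [map_smul]
    exact mul_nonneg (h0 g) (hnn g (hc hg))

theorem face_eq_of_finrank_eq {C F F' : PointedCone ℝ V} (hF : F.IsFaceOf C)
    (hF' : F'.IsFaceOf C) (hle : F ≤ F') (h : finrank ℝ (Submodule.span ℝ (F : Set V)) =
      finrank ℝ (Submodule.span ℝ (F' : Set V))) : F = F' := by
  refine le_antisymm hle fun x hx => mem_face_of_mem_span hF (hF'.le hx) ?_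
  rw [Submodule.eq_of_le_of_finrank_eq (Submodule.span_mono hle) h]
  exact Submodule.subset_span hx

theorem finrank_inf_ker_add_one {T : Submodule ℝ V} {f : V →ₗ[ℝ] ℝ} {x : V} (hx : x ∈ T)
    (hf : f x ≠ 0) : finrank ℝ (T ⊓ LinearMap.ker f : Submodule ℝ V) + 1 = finrank ℝ T := by
  have h := Module.Dual.finrank_ker_add_one_of_ne_zero (K := ℝ) (f := f.domRestrict T)
    (fun h => hf (LinearMap.congr_fun h ⟨x, hx⟩))
  rw [← h]
  congr 1
  have : (T ⊓ LinearMap.ker f : Submodule ℝ V) =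
      (LinearMap.ker (f.domRestrict T)).map T.subtype := by
    ext y
    simp [and_comm]
  rw [this]
  exact (Submodule.equivMapOfInjective _ T.injective_subtype _).finrank_eq.symm

theorem eq_inf_ker_of_exposing {G : Set V} {F : PointedCone ℝ V} {n : ℕ}
    (hF : F ≤ PointedCone.hull ℝ G)
    (hn : finrank ℝ (Submodule.span ℝ (PointedCone.hull ℝ G : Set V)) = n + 1)
    (hm : finrank ℝ (Submodule.span ℝ (F : Set V)) = n) {ℓ : V →ₗ[ℝ] ℝ}
    (hℓ : ∀ x ∈ F, ℓ x = 0) {y : V} (hy : y ∈ PointedCone.hull ℝ G) (hly : ℓ y ≠ 0) :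
    Submodule.span ℝ (F : Set V) =
      Submodule.span ℝ (PointedCone.hull ℝ G : Set V) ⊓ LinearMap.ker ℓ := by
  refine Submodule.eq_of_le_of_finrank_eq (le_inf (Submodule.span_mono hF)
    (Submodule.span_le.2 hℓ)) ?_
  have := finrank_inf_ker_add_one (Submodule.subset_span hy) hly
  omega

/-- A face of codimension two lies in exactly two facets. -/
theorem exists_two_facets {G : Set V} (hG : G.Finite) {F : PointedCone ℝ V} {n : ℕ}
    (hF : F.IsFaceOf (PointedCone.hull ℝ G))
    (hn : finrank ℝ (Submodule.span ℝ (PointedCone.hull ℝ G : Set V)) = n + 2)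
    (hm : finrank ℝ (Submodule.span ℝ (F : Set V)) = n) :
    ∃ T₁ T₂ : PointedCone ℝ V, T₁.IsFaceOf (PointedCone.hull ℝ G) ∧
      T₂.IsFaceOf (PointedCone.hull ℝ G) ∧ F ≤ T₁ ∧ F ≤ T₂ ∧
      finrank ℝ (Submodule.span ℝ (T₁ : Set V)) = n + 1 ∧
      finrank ℝ (Submodule.span ℝ (T₂ : Set V)) = n + 1 ∧
      (∃ g ∈ T₁, g ∉ Submodule.span ℝ (T₂ : Set V)) ∧
      (∃ g ∈ T₂, g ∉ Submodule.span ℝ (T₁ : Set V)) ∧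
      ∀ T : PointedCone ℝ V, T.IsFaceOf (PointedCone.hull ℝ G) → F ≤ T →
        finrank ℝ (Submodule.span ℝ (T : Set V)) = n + 1 → T = T₁ ∨ T = T₂ := by
  classical
  set C := PointedCone.hull ℝ G with hC
  set S := Submodule.span ℝ (C : Set V) with hS
  set W := Submodule.span ℝ (F : Set V) with hW
  obtain ⟨ℓ, hℓ⟩ := exists_exposing hG hF
  have hWS : W ≤ S := Submodule.span_mono hF.le
  have hFC : ∃ y ∈ C, y ∉ F := by
    by_contra! h
    have : F = C := le_antisymm hF.le h
    have h2 : W = S := by rw [hW, hS, this]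
    rw [h2] at hm
    omega
  obtain ⟨y, hy, hyF⟩ := hFC
  have hly : ℓ y ≠ 0 := fun h => hyF ((hℓ y hy).2.1 h)
  have hK := finrank_inf_ker_add_one (T := S) (Submodule.subset_span hy) hly
  have hx : ∃ x ∈ S ⊓ LinearMap.ker ℓ, x ∉ W := by
    by_contra! h
    have := Submodule.finrank_mono (R := ℝ) (show S ⊓ LinearMap.ker ℓ ≤ W from h)
    omega
  obtain ⟨x, ⟨hxS, hxℓ⟩, hxW⟩ := hx
  obtain ⟨m, hmx, hmW⟩ := Submodule.exists_dual_map_eq_bot_of_notMem hxW inferInstance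
  have hmW' : ∀ w ∈ W, m w = 0 := fun w hw => by
    have : m w ∈ W.map m := ⟨w, hw, rfl⟩
    rw [hmW] at this
    simpa using this
  have hℓW : ∀ w ∈ W, ℓ w = 0 := fun w hw => by
    have : W ≤ LinearMap.ker ℓ := Submodule.span_le.2 fun z hz => ((hℓ z (hF.le hz)).2).2 hz
    exact this hw
  -- The pair `(ℓ, m)` identifies `S / W` with a plane. There the cone lies in `ℓ ≥ 0` and meets `ℓ
  -- = 0` only in the origin, so its two extreme rays are those of smallest and largest slope `m /
  -- ℓ`; they give the two facets.
  have hWeq : W = S ⊓ LinearMap.ker ℓ ⊓ LinearMap.ker m := by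
    refine Submodule.eq_of_le_of_finrank_eq (le_inf (le_inf hWS hℓW) hmW') ?_
    have := finrank_inf_ker_add_one (T := S ⊓ LinearMap.ker ℓ) ⟨hxS, hxℓ⟩ hmx
    omega
  have hmemW : ∀ z ∈ S, ℓ z = 0 → m z = 0 → z ∈ W := fun z h1 h2 h3 => by
    rw [hWeq]; exact ⟨⟨h1, h2⟩, h3⟩
  -- generators outside `F`, ordered by slope
  set G' := hG.toFinset.filter (· ∉ F) with hG'
  have hG'ne : G'.Nonempty := by
    by_contra h
    rw [Finset.not_nonempty_iff_eq_empty, Finset.filter_eq_empty_iff] at h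
    refine hyF ((Submodule.span_le.2 fun g hg => ?_ : C ≤ F) hy)
    simpa using h (hG.mem_toFinset.2 hg)
  have hGC : ∀ g ∈ G, g ∈ C := fun g hg => PointedCone.subset_hull hg
  have hG'mem : ∀ {g}, g ∈ G' ↔ g ∈ G ∧ g ∉ F := by simp [hG']
  have hpos : ∀ g ∈ G', 0 < ℓ g := fun g hg => by
    obtain ⟨h1, h2⟩ := hG'mem.1 hg
    exact lt_of_le_of_ne (hℓ g (hGC g h1)).1 fun h => h2 ((hℓ g (hGC g h1)).2.1 h.symm)
  obtain ⟨g₁, hg₁, hmin⟩ := G'.exists_min_image (fun g => m g / ℓ g) hG'ne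
  obtain ⟨g₂, hg₂, hmax⟩ := G'.exists_max_image (fun g => m g / ℓ g) hG'ne
  set a := m g₁ / ℓ g₁ with ha
  set b := m g₂ / ℓ g₂ with hb
  have ha1 : m g₁ = a * ℓ g₁ := by rw [ha, div_mul_cancel₀ _ (hpos _ hg₁).ne']
  have hb2 : m g₂ = b * ℓ g₂ := by rw [hb, div_mul_cancel₀ _ (hpos _ hg₂).ne']
  set p : V →ₗ[ℝ] ℝ := m - a • ℓ with hp
  set q : V →ₗ[ℝ] ℝ := b • ℓ - m with hq
  have hpa : ∀ z, p z = m z - a * ℓ z := fun z => rfl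
  have hqa : ∀ z, q z = b * ℓ z - m z := fun z => rfl
  have hpG : ∀ g ∈ G, 0 ≤ p g := fun g hg => by
    by_cases hgF : g ∈ F
    · rw [hpa, hmW' g (Submodule.subset_span hgF), hℓW g (Submodule.subset_span hgF)]; simp
    · have := (le_div_iff₀ (hpos g (hG'mem.2 ⟨hg, hgF⟩))).1 (hmin g (hG'mem.2 ⟨hg, hgF⟩))
      rw [hpa]; linarith
  have hqG : ∀ g ∈ G, 0 ≤ q g := fun g hg => by
    by_cases hgF : g ∈ F
    · rw [hqa, hmW' g (Submodule.subset_span hgF), hℓW g (Submodule.subset_span hgF)]; simp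
    · have := (div_le_iff₀ (hpos g (hG'mem.2 ⟨hg, hgF⟩))).1 (hmax g (hG'mem.2 ⟨hg, hgF⟩))
      rw [hqa]; linarith
  have hpC := le_of_generators_le hpG
  have hqC := le_of_generators_le hqG
  -- With equal slopes `m - a • ℓ` would vanish on all of `S`; but `ℓ x = 0` and `m x ≠ 0`.
  have hab : a < b := by
    refine lt_of_le_of_ne (hmin g₂ hg₂) fun hab => hmx ?_
    have h0 : ∀ z ∈ S, p z = 0 := by
      have : S ≤ LinearMap.ker p := Submodule.span_le.2 fun z hz => by
        have h1 := hpC z hz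
        have h2 := hqC z hz
        rw [hpa] at h1
        rw [hqa, ← hab] at h2
        exact (show p z = 0 by rw [hpa]; linarith)
      exact fun z hz => this hz
    have := h0 x hxS
    rw [hpa, show ℓ x = 0 from hxℓ] at this
    linarith
  have hg₁C : g₁ ∈ C := hGC _ (hG'mem.1 hg₁).1
  have hg₂C : g₂ ∈ C := hGC _ (hG'mem.1 hg₂).1
  have hg₁T : g₁ ∈ zeroFace C p := ⟨hg₁C, (show p g₁ = 0 by rw [hpa, ha1, sub_self])⟩
  have hg₂T : g₂ ∈ zeroFace C q := ⟨hg₂C, (show q g₂ = 0 by rw [hqa, hb2, sub_self])⟩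
  have hFp : F ≤ zeroFace C p := fun z hz => ⟨hF.le hz, (show p z = 0 by
    rw [hpa, hmW' z (Submodule.subset_span hz), hℓW z (Submodule.subset_span hz)]; simp)⟩
  have hFq : F ≤ zeroFace C q := fun z hz => ⟨hF.le hz, (show q z = 0 by
    rw [hqa, hmW' z (Submodule.subset_span hz), hℓW z (Submodule.subset_span hz)]; simp)⟩
  have hpg₂ : 0 < p g₂ := by
    rw [hpa, hb2]; nlinarith [mul_pos (sub_pos.2 hab) (hpos _ hg₂)]
  have hqg₁ : 0 < q g₁ := by
    rw [hqa, ha1]; nlinarith [mul_pos (sub_pos.2 hab) (hpos _ hg₁)]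
  have hdim : ∀ (k : V →ₗ[ℝ] ℝ) (g : V), g ∈ zeroFace C k → g ∉ F → F ≤ zeroFace C k →
      (∃ z ∈ C, k z ≠ 0) → finrank ℝ (Submodule.span ℝ (zeroFace C k : Set V)) = n + 1 := by
    rintro k g hg hgF hFk ⟨z, hz, hkz⟩
    refine le_antisymm ?_ ?_
    · have h1 := finrank_inf_ker_add_one (T := S) (Submodule.subset_span hz) hkz
      have h2 : Submodule.span ℝ (zeroFace C k : Set V) ≤ S ⊓ LinearMap.ker k :=
        Submodule.span_le.2 fun v hv => ⟨Submodule.subset_span hv.1, hv.2⟩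
      have := Submodule.finrank_mono (R := ℝ) h2
      omega
    · rw [← hm, Nat.succ_le_iff]
      refine Submodule.finrank_lt_finrank_of_lt
        (lt_of_le_of_ne (Submodule.span_mono hFk) fun h => hgF ?_)
      refine mem_face_of_mem_span hF hg.1 ?_
      rw [← hW, h]
      exact Submodule.subset_span hg
  have hd₁ := hdim p g₁ hg₁T (hG'mem.1 hg₁).2 hFp ⟨g₂, hg₂C, hpg₂.ne'⟩
  have hd₂ := hdim q g₂ hg₂T (hG'mem.1 hg₂).2 hFq ⟨g₁, hg₁C, hqg₁.ne'⟩
  have hspanker : ∀ k : V →ₗ[ℝ] ℝ, Submodule.span ℝ (zeroFace C k : Set V) ≤ LinearMap.ker k :=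
    fun k => Submodule.span_le.2 fun v hv => hv.2
  have hT₁ := zeroFace_isFaceOf hpC
  have hT₂ := zeroFace_isFaceOf hqC
  have hng₁ : g₁ ∉ Submodule.span ℝ (zeroFace C q : Set V) := fun h =>
    hqg₁.ne' (hspanker q h)
  have hng₂ : g₂ ∉ Submodule.span ℝ (zeroFace C p : Set V) := fun h =>
    hpg₂.ne' (hspanker p h)
  refine ⟨zeroFace C p, zeroFace C q, hT₁, hT₂, hFp, hFq, hd₁, hd₂, ⟨g₁, hg₁T, hng₁⟩,
    ⟨g₂, hg₂T, hng₂⟩, fun T hT hFT hdT => ?_⟩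
  -- a facet containing a generator on one of the two extreme rays is the corresponding facet
  have hkey : ∀ (k : V →ₗ[ℝ] ℝ), (∀ z, k z = 0 → ℓ z = 0 → m z = 0) →
      (zeroFace C k).IsFaceOf C →
      finrank ℝ (Submodule.span ℝ (zeroFace C k : Set V)) = n + 1 → ∀ g ∈ T, k g = 0 →
      0 < ℓ g → T = zeroFace C k := by
    intro k hk hface hd g hg hkg hlg
    refine (face_eq_of_finrank_eq hface hT (fun z hz => ?_) (hd.trans hdT.symm)).symm
    refine mem_face_of_mem_span hT hz.1 ?_
    have hw : z - (ℓ z / ℓ g) • g ∈ W := by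
      have e1 : ℓ (z - (ℓ z / ℓ g) • g) = 0 := by
        rw [map_sub, map_smul, smul_eq_mul, div_mul_cancel₀ _ hlg.ne', sub_self]
      refine hmemW _ (S.sub_mem (Submodule.subset_span hz.1)
        (S.smul_mem _ (Submodule.subset_span (hT.le hg)))) e1 (hk _ ?_ e1)
      rw [map_sub, map_smul, hkg, show k z = 0 from hz.2]; simp
    have : z = (z - (ℓ z / ℓ g) • g) + (ℓ z / ℓ g) • g := by abel
    rw [this]
    exact Submodule.add_mem _ (Submodule.span_mono hFT hw)
      (Submodule.smul_mem _ _ (Submodule.subset_span hg))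
  have hk₁ := hkey p (fun z h1 h2 => by rw [hpa, h2] at h1; linarith) hT₁ hd₁
  have hk₂ := hkey q (fun z h1 h2 => by rw [hqa, h2] at h1; linarith) hT₂ hd₂
  have hex : ∃ g ∈ G', g ∈ T := by
    by_contra! h
    have : T ≤ F := by
      rw [face_eq_hull hT]
      refine Submodule.span_le.2 fun g hg => ?_
      by_contra hgF
      exact h g (hG'mem.2 ⟨hg.1, hgF⟩) hg.2
    have h2 : Submodule.span ℝ (T : Set V) ≤ W := Submodule.span_mono this
    have := Submodule.finrank_mono (R := ℝ) h2
    omega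
  obtain ⟨g, hgG', hgT⟩ := hex
  have hgC := hT.le hgT
  rcases (hpC g hgC).eq_or_lt with h1 | h1
  · exact Or.inl (hk₁ g hgT h1.symm (hpos g hgG'))
  rcases (hqC g hgC).eq_or_lt with h2 | h2
  · exact Or.inr (hk₂ g hgT h2.symm (hpos g hgG'))
  exfalso
  -- A generator of intermediate slope is, modulo `W`, a positive combination of `g₁` and `g₂`.
  -- After an element of `F` is added on each side, the face property puts both into `T`, and `T`
  -- would be both facets at once.
  have hw : g - ((q g / q g₁) • g₁ + (p g / p g₂) • g₂) ∈ W := by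
    have hqg2 : q g₂ = 0 := hg₂T.2
    have hpg1 : p g₁ = 0 := hg₁T.2
    have e1 : p (g - ((q g / q g₁) • g₁ + (p g / p g₂) • g₂)) = 0 := by
      simp only [map_sub, map_add, map_smul, smul_eq_mul, hpg1, div_mul_cancel₀ _ hpg₂.ne']
      ring
    have e2 : q (g - ((q g / q g₁) • g₁ + (p g / p g₂) • g₂)) = 0 := by
      simp only [map_sub, map_add, map_smul, smul_eq_mul, hqg2, div_mul_cancel₀ _ hqg₁.ne']
      ring
    have e3 := e1
    rw [hpa] at e1
    rw [hqa] at e2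
    have e4 : (b - a) * ℓ (g - ((q g / q g₁) • g₁ + (p g / p g₂) • g₂)) = 0 := by linarith
    have e5 := (mul_eq_zero.1 e4).resolve_left (sub_pos.2 hab).ne'
    refine hmemW _ (S.sub_mem (Submodule.subset_span hgC) (S.add_mem
      (S.smul_mem _ (Submodule.subset_span hg₁C))
      (S.smul_mem _ (Submodule.subset_span hg₂C)))) e5 ?_
    rw [e5] at e1
    linarith
  obtain ⟨u, hu, v, hv, huv⟩ := mem_span_cone_iff.1 hw
  have hα := div_pos h2 hqg₁
  have hβ := div_pos h1 hpg₂
  have hsum : (q g / q g₁) • g₁ + ((p g / p g₂) • g₂ + u) = g + v := by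
    have := sub_eq_sub_iff_add_eq_add.1 huv
    rw [this]; abel
  have hT1 : g₁ ∈ T := hT.mem_of_smul_add_mem hg₁C
    (C.add_mem (C.smul_mem hβ.le hg₂C) (hF.le hu)) hα
    (by rw [hsum]; exact T.add_mem hgT (hFT hv))
  have hT2 : g₂ ∈ T := hT.mem_of_smul_add_mem hg₂C
    (C.add_mem (C.smul_mem hα.le hg₁C) (hF.le hu)) hβ
    (by rw [add_left_comm, hsum]; exact T.add_mem hgT (hFT hv))
  have := hk₁ g₁ hT1 hg₁T.2 (hpos _ hg₁)
  refine hng₂ (Submodule.subset_span ?_)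
  rw [← this]
  exact hT2

end Polyhedral

/-! ### Induced orientations -/

section Forms

open Module

variable {P S : Type*} [AddCommGroup P] [Module ℝ P] [AddCommGroup S] [Module ℝ S] {n : ℕ}

theorem exists_form_of_orientation (o : Orientation ℝ P (Fin n)) :
    ∃ (g : P [⋀^Fin n]→ₗ[ℝ] ℝ) (hg : g ≠ 0), rayOfNeZero ℝ g hg = o := by
  induction o using Module.Ray.ind with
  | h v hv => exact ⟨v, hv, rfl⟩

variable [FiniteDimensional ℝ P]

/-- The `n + 1` arguments of `f` all come from an `n`-dimensional space. Hence changing an outward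
vector along the facet does not change the restricted form. -/
theorem curryLeft_comp_eq_zero (hP : finrank ℝ P = n) (i : P →ₗ[ℝ] S)
    (f : S [⋀^Fin (n + 1)]→ₗ[ℝ] ℝ) (w : P) : (f.curryLeft (i w)).compLinearMap i = 0 := by
  ext t
  change f (Matrix.vecCons (i w) (i ∘ t)) = 0
  refine f.map_linearDependent _ fun h => ?_
  have h1 : Matrix.vecCons (i w) (i ∘ t) = i ∘ Matrix.vecCons w t := by
    ext j
    refine Fin.cases ?_ (fun j => ?_) j <;> simp
  rw [h1] at h
  have := (LinearIndependent.of_comp i h).fintype_card_le_finrank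
  rw [hP, Fintype.card_fin] at this
  omega

/-- A vector outside the image, put in front of the image of a basis of `P`, gives a basis of `S`.
-/
theorem curryLeft_comp_ne_zero (hP : finrank ℝ P = n) (hS : finrank ℝ S = n + 1) {i : P →ₗ[ℝ] S}
    (hi : Function.Injective i) {f : S [⋀^Fin (n + 1)]→ₗ[ℝ] ℝ} (hf : f ≠ 0) {u : S}
    (hu : u ∉ LinearMap.range i) : (f.curryLeft u).compLinearMap i ≠ 0 := by
  intro h
  let t := finBasisOfFinrankEq ℝ P hP
  have hli : LinearIndependent ℝ (Fin.cons u (i ∘ t) : Fin (n + 1) → S) := by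
    rw [linearIndependent_finCons]
    refine ⟨t.linearIndependent.map' i (LinearMap.ker_eq_bot.2 hi), fun h => hu ?_⟩
    rw [Set.range_comp, ← LinearMap.map_span, t.span_eq, Submodule.map_top] at h
    exact h
  let b := basisOfLinearIndependentOfCardEqFinrank hli (by simp [hS])
  have hb := (f.map_basis_ne_zero_iff b).2 hf
  rw [coe_basisOfLinearIndependentOfCardEqFinrank] at hb
  exact hb (congrArg (fun k => k t) h)

theorem exists_eq_smul_form (hP : finrank ℝ P = n) {g : P [⋀^Fin n]→ₗ[ℝ] ℝ} (hg : g ≠ 0)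
    (g' : P [⋀^Fin n]→ₗ[ℝ] ℝ) : ∃ c : ℝ, g' = c • g := by
  let t := finBasisOfFinrankEq ℝ P hP
  have hb := (g.map_basis_ne_zero_iff t).2 hg
  refine ⟨g' t / g t, ?_⟩
  have h : (g' t / g t) • g = (g' t / g t) • (g t • t.det) := congrArg _ (g.eq_smul_basis_det t)
  rw [h, smul_smul, div_mul_cancel₀ _ hb]
  exact g'.eq_smul_basis_det t

theorem nonempty_orientation (hP : finrank ℝ P = n) : Nonempty (Orientation ℝ P (Fin n)) :=
  ⟨(finBasisOfFinrankEq ℝ P hP).orientation⟩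

end Forms

/-! ### Incidence signs of facets -/

section Signs

open Module

variable {r n : ℕ} {τ σ ρ : PointedCone ℝ (Matrix (Fin r) (Fin r) ℂ)}

open Classical in
/-- `1` if `oσ` induces `oτ`, and `-1` otherwise. -/
noncomputable def orientationSign (oτ : Orientation ℝ (linSpan τ) (Fin n))
    (oσ : Orientation ℝ (linSpan σ) (Fin (n + 1))) : ℚ :=
  if Induces oτ oσ then 1 else -1

/-- The functional makes "outward" measurable: a vector `u` of the span with `-u` in `σ` and outside
the span of `τ` has `ℓ u < 0`. -/
theorem exists_facet_functional (hσ : σ.FG) (hF : τ.IsFaceOf σ)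
    (hn : finrank ℝ (linSpan σ) = n + 1) (hm : finrank ℝ (linSpan τ) = n) :
    ∃ ℓ : Matrix (Fin r) (Fin r) ℂ →ₗ[ℝ] ℝ, (∀ x ∈ σ, 0 ≤ ℓ x) ∧
      (∀ x ∈ linSpan σ, ℓ x = 0 ↔ x ∈ linSpan τ) ∧ ∃ y ∈ σ, y ∉ linSpan τ := by
  obtain ⟨G, rfl⟩ := hσ
  obtain ⟨ℓ, hℓ⟩ := exists_exposing G.finite_toSet hF
  have hy : ∃ y ∈ PointedCone.hull ℝ (G : Set (Matrix (Fin r) (Fin r) ℂ)), y ∉ τ := by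
    by_contra! h
    have : τ = _ := le_antisymm hF.le h
    rw [← this] at hn
    omega
  obtain ⟨y, hy, hyτ⟩ := hy
  have hker := eq_inf_ker_of_exposing hF.le hn hm (ℓ := ℓ)
    (fun x hx => (hℓ x (hF.le hx)).2.2 hx) hy (fun h => hyτ ((hℓ y hy).2.1 h))
  refine ⟨ℓ, fun x hx => (hℓ x hx).1, fun x hx => ?_, y, hy, fun h =>
    hyτ (mem_face_of_mem_span hF hy h)⟩
  rw [linSpan, hker]
  exact ⟨fun h => ⟨hx, h⟩, fun h => h.2⟩

theorem linSpan_mono (h : τ ≤ σ) : linSpan τ ≤ linSpan σ := Submodule.span_mono h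

/-- `Induces` allows any outward vector and any volume form. Two choices are related by `f' = a • f`
and `u' = b • u` plus a vector along the facet, with `a, b > 0`, so the restricted form changes by
the positive factor `a * b` and the sign can be read off a single choice. -/
theorem orientationSign_eq (hσ : σ.FG) (hF : τ.IsFaceOf σ)
    (hn : finrank ℝ (linSpan σ) = n + 1) (hm : finrank ℝ (linSpan τ) = n)
    {u : linSpan σ} (hu : -(u : Matrix (Fin r) (Fin r) ℂ) ∈ σ)
    (hu' : (u : Matrix (Fin r) (Fin r) ℂ) ∉ linSpan τ)
    {f : (linSpan σ) [⋀^Fin (n + 1)]→ₗ[ℝ] ℝ} (hf : f ≠ 0)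
    {g : (linSpan τ) [⋀^Fin n]→ₗ[ℝ] ℝ} (hg : g ≠ 0) {c : ℝ}
    (hle : linSpan τ ≤ linSpan σ)
    (h : (f.curryLeft u).compLinearMap (Submodule.inclusion hle) = c • g) :
    c ≠ 0 ∧ orientationSign (rayOfNeZero ℝ g hg) (rayOfNeZero ℝ f hf) = if 0 < c then 1 else -1 := by
  have hinj : Function.Injective (Submodule.inclusion hle) := Submodule.inclusion_injective hle
  have hrange : ∀ v : linSpan σ, v ∈ LinearMap.range (Submodule.inclusion hle) ↔
      (v : Matrix (Fin r) (Fin r) ℂ) ∈ linSpan τ := fun v => by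
    rw [Submodule.range_inclusion]; rfl
  have hne := curryLeft_comp_ne_zero hm hn hinj hf (u := u) (by rwa [hrange])
  have hc : c ≠ 0 := by
    rintro rfl
    rw [zero_smul] at h
    exact hne h
  refine ⟨hc, ?_⟩
  have key : Induces (rayOfNeZero ℝ g hg) (rayOfNeZero ℝ f hf) ↔ 0 < c := by
    constructor
    · rintro ⟨hle', u', f', hf', hg', hu1, hu2, hr1, hr2⟩
      obtain ⟨ℓ, hℓ, hℓτ, -⟩ := exists_facet_functional hσ hF hn hm
      obtain ⟨a, ha⟩ := exists_eq_smul_form hn hf f'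
      have ha0 : 0 < a := by
        have ha0 : a ≠ 0 := by rintro rfl; rw [zero_smul] at ha; exact hf' ha
        rw [ray_eq_iff, ha] at hr1
        exact (sameRay_smul_left_iff_of_ne hf ha0).1 hr1
      have hneg : ∀ v : linSpan σ, -(v : Matrix (Fin r) (Fin r) ℂ) ∈ σ →
          (v : Matrix (Fin r) (Fin r) ℂ) ∉ linSpan τ → ℓ v < 0 := fun v hv hv' => by
        have h1 := hℓ _ hv
        rw [map_neg] at h1
        exact lt_of_le_of_ne (by linarith) fun h => hv' ((hℓτ _ v.2).1 h)
      have hl := hneg u hu hu'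
      have hl' := hneg u' hu1 hu2
      set b := ℓ u' / ℓ u with hb
      have hb0 : 0 < b := div_pos_of_neg_of_neg hl' hl
      have hw : ((u' - b • u : linSpan σ) : Matrix (Fin r) (Fin r) ℂ) ∈ linSpan τ := by
        rw [← hℓτ _ (u' - b • u).2]
        simp only [Submodule.coe_sub, Submodule.coe_smul, map_sub, map_smul, smul_eq_mul]
        rw [hb, div_mul_cancel₀ _ hl.ne, sub_self]
      have hu'eq : u' = b • u + Submodule.inclusion hle ⟨_, hw⟩ := by
        ext1; simp
      have hval : (f'.curryLeft u').compLinearMap (Submodule.inclusion hle) = (a * b * c) • g := by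
        rw [hu'eq, map_add, map_smul, AlternatingMap.add_compLinearMap,
          curryLeft_comp_eq_zero hm, add_zero, ha, AlternatingMap.curryLeft_smul]
        rw [mul_smul, mul_smul, ← h]
        ext t
        simp only [AlternatingMap.compLinearMap_apply, AlternatingMap.smul_apply,
          LinearMap.smul_apply, smul_eq_mul]
        ring
      rw [ray_eq_iff, hval] at hr2
      have := (sameRay_smul_left_iff_of_ne hg (mul_ne_zero (mul_ne_zero ha0.ne' hb0.ne') hc)).1 hr2
      exact (pos_iff_pos_of_mul_pos this).1 (mul_pos ha0 hb0)
    · intro hc0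
      refine ⟨hle, u, f, hf, hne, hu, hu', rfl, ?_⟩
      rw [ray_eq_iff, h]
      exact (sameRay_smul_left_iff_of_ne hg hc).2 hc0
  rw [orientationSign]
  simp only [key]

theorem exists_sign_data (hσ : σ.FG) (hF : τ.IsFaceOf σ)
    (hn : finrank ℝ (linSpan σ) = n + 1) (hm : finrank ℝ (linSpan τ) = n)
    (oτ : Orientation ℝ (linSpan τ) (Fin n)) (oσ : Orientation ℝ (linSpan σ) (Fin (n + 1))) :
    ∃ (u : linSpan σ) (f : (linSpan σ) [⋀^Fin (n + 1)]→ₗ[ℝ] ℝ) (hf : f ≠ 0)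
      (g : (linSpan τ) [⋀^Fin n]→ₗ[ℝ] ℝ) (hg : g ≠ 0) (c : ℝ),
      -(u : Matrix (Fin r) (Fin r) ℂ) ∈ σ ∧ (u : Matrix (Fin r) (Fin r) ℂ) ∉ linSpan τ ∧
      (f.curryLeft u).compLinearMap (Submodule.inclusion (linSpan_mono hF.le)) = c • g ∧
      rayOfNeZero ℝ f hf = oσ ∧ rayOfNeZero ℝ g hg = oτ := by
  obtain ⟨ℓ, hℓ, hℓτ, y, hy, hyτ⟩ := exists_facet_functional hσ hF hn hm
  obtain ⟨f, hf, rfl⟩ := exists_form_of_orientation oσ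
  obtain ⟨g, hg, rfl⟩ := exists_form_of_orientation oτ
  let u : linSpan σ := -⟨y, Submodule.subset_span hy⟩
  obtain ⟨c, hc⟩ := exists_eq_smul_form hm hg
    ((f.curryLeft u).compLinearMap (Submodule.inclusion (linSpan_mono hF.le)))
  refine ⟨u, f, hf, g, hg, c, ?_, ?_, hc, rfl, rfl⟩
  · simpa [u] using hy
  · simpa [u] using hyτ

theorem ite_pos_neg {c : ℝ} (hc : c ≠ 0) :
    (if 0 < -c then (1 : ℚ) else -1) = -(if 0 < c then 1 else -1) := by
  rcases lt_or_gt_of_ne hc with h | h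
  · rw [if_pos (by linarith), if_neg (by linarith), neg_neg]
  · rw [if_neg (by linarith), if_pos h]

theorem ite_pos_mul {c d : ℝ} (hc : c ≠ 0) (hd : d ≠ 0) :
    (if 0 < c * d then (1 : ℚ) else -1) = (if 0 < c then 1 else -1) * if 0 < d then 1 else -1 := by
  rcases lt_or_gt_of_ne hc with h | h <;> rcases lt_or_gt_of_ne hd with h' | h'
  · rw [if_pos (mul_pos_of_neg_of_neg h h'), if_neg h.not_gt, if_neg h'.not_gt]; norm_num
  · rw [if_neg (mul_neg_of_neg_of_pos h h').not_gt, if_neg h.not_gt, if_pos h']; norm_num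
  · rw [if_neg (mul_neg_of_pos_of_neg h h').not_gt, if_pos h, if_neg h'.not_gt]; norm_num
  · rw [if_pos (mul_pos h h'), if_pos h, if_pos h']; norm_num

theorem orientationSign_neg_right (hσ : σ.FG) (hF : τ.IsFaceOf σ)
    (hn : finrank ℝ (linSpan σ) = n + 1) (hm : finrank ℝ (linSpan τ) = n)
    (oτ : Orientation ℝ (linSpan τ) (Fin n)) (oσ : Orientation ℝ (linSpan σ) (Fin (n + 1))) :
    orientationSign oτ (-oσ) = -orientationSign oτ oσ := by
  obtain ⟨u, f, hf, g, hg, c, hu, hu', h, rfl, rfl⟩ := exists_sign_data hσ hF hn hm oτ oσ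
  obtain ⟨hc, h1⟩ := orientationSign_eq hσ hF hn hm hu hu' hf hg _ h
  obtain ⟨-, h2⟩ := orientationSign_eq hσ hF hn hm hu hu' (neg_ne_zero.2 hf) hg (c := -c)
    (linSpan_mono hF.le) (by
      ext t
      have h2 := congrArg (fun k => k t) h
      simpa using h2)
  rw [neg_rayOfNeZero, h1, h2, ite_pos_neg hc]

theorem orientationSign_ne_zero (oτ : Orientation ℝ (linSpan τ) (Fin n))
    (oσ : Orientation ℝ (linSpan σ) (Fin (n + 1))) : orientationSign oτ oσ ≠ 0 := by
  rw [orientationSign]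
  split_ifs <;> norm_num

/-- Signs are invariant under isomorphisms. -/
theorem orientationSign_map (hσ : σ.FG) (hF : τ.IsFaceOf σ)
    (hn : finrank ℝ (linSpan σ) = n + 1) (hm : finrank ℝ (linSpan τ) = n)
    {τ' σ' : PointedCone ℝ (Matrix (Fin r) (Fin r) ℂ)} (hσ' : σ'.FG) (hF' : τ'.IsFaceOf σ')
    (eσ : linSpan σ ≃ₗ[ℝ] linSpan σ') (eτ : linSpan τ ≃ₗ[ℝ] linSpan τ')
    (hcompat : ∀ x : linSpan τ,
      eσ (Submodule.inclusion (linSpan_mono hF.le) x) =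
        Submodule.inclusion (linSpan_mono hF'.le) (eτ x))
    (hcone : ∀ x : linSpan σ, (x : Matrix (Fin r) (Fin r) ℂ) ∈ σ →
      (eσ x : Matrix (Fin r) (Fin r) ℂ) ∈ σ')
    (oτ : Orientation ℝ (linSpan τ) (Fin n)) (oσ : Orientation ℝ (linSpan σ) (Fin (n + 1))) :
    orientationSign (Orientation.map (Fin n) eτ oτ) (Orientation.map (Fin (n + 1)) eσ oσ) =
      orientationSign oτ oσ := by
  obtain ⟨u, f, hf, g, hg, c, hu, hu', h, rfl, rfl⟩ := exists_sign_data hσ hF hn hm oτ oσ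
  obtain ⟨hc, h1⟩ := orientationSign_eq hσ hF hn hm hu hu' hf hg _ h
  have hn' : finrank ℝ (linSpan σ') = n + 1 := by rw [← hn]; exact eσ.finrank_eq.symm
  have hm' : finrank ℝ (linSpan τ') = n := by rw [← hm]; exact eτ.finrank_eq.symm
  have hsymm : ∀ x : linSpan τ', eσ.symm (Submodule.inclusion (linSpan_mono hF'.le) x) =
      Submodule.inclusion (linSpan_mono hF.le) (eτ.symm x) := fun x => by
    rw [LinearEquiv.symm_apply_eq, hcompat, LinearEquiv.apply_symm_apply]
  rw [Orientation.map_apply, Orientation.map_apply, h1]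
  -- Transporting the outward vector and both forms leaves the factor `c` unchanged.
  refine (orientationSign_eq hσ' hF' hn' hm' (u := eσ u) ?_ ?_ _ _ (linSpan_mono hF'.le) ?_).2
  · have := hcone (-u) (by simpa using hu)
    simpa using this
  · intro hmem
    apply hu'
    have h2 := hsymm ⟨_, hmem⟩
    have h3 : Submodule.inclusion (linSpan_mono hF'.le) ⟨_, hmem⟩ = eσ u := rfl
    rw [h3, LinearEquiv.symm_apply_apply] at h2
    rw [h2]
    exact (eτ.symm _).2
  · ext t
    have h2 := congrArg (fun k => k (eτ.symm ∘ t)) h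
    simp only [AlternatingMap.compLinearMap_apply, AlternatingMap.smul_apply,
      AlternatingMap.curryLeft_apply_apply, Function.comp_apply] at h2 ⊢
    refine Eq.trans (congrArg f ?_) h2
    ext1 j
    refine Fin.cases ?_ (fun j => ?_) j
    · simp
    · simp [hsymm]

/-- The two facets through a face of codimension two contribute opposite signs. -/
theorem orientationSign_diamond (hσ : σ.FG) {τ₁ τ₂ : PointedCone ℝ (Matrix (Fin r) (Fin r) ℂ)}
    (h₁ : τ₁.IsFaceOf σ) (h₂ : τ₂.IsFaceOf σ) (hτ₁ : τ₁.FG) (hτ₂ : τ₂.FG)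
    (hρ₁ : ρ.IsFaceOf τ₁) (hρ₂ : ρ.IsFaceOf τ₂)
    (hn : finrank ℝ (linSpan σ) = n + 2) (hd₁ : finrank ℝ (linSpan τ₁) = n + 1)
    (hd₂ : finrank ℝ (linSpan τ₂) = n + 1) (hm : finrank ℝ (linSpan ρ) = n)
    (hg₁ : ∃ g ∈ τ₁, g ∉ linSpan τ₂) (hg₂ : ∃ g ∈ τ₂, g ∉ linSpan τ₁)
    (oρ : Orientation ℝ (linSpan ρ) (Fin n)) (o₁ : Orientation ℝ (linSpan τ₁) (Fin (n + 1)))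
    (o₂ : Orientation ℝ (linSpan τ₂) (Fin (n + 1)))
    (oσ : Orientation ℝ (linSpan σ) (Fin (n + 2))) :
    orientationSign oρ o₁ * orientationSign o₁ oσ =
      -(orientationSign oρ o₂ * orientationSign o₂ oσ) := by
  obtain ⟨f, hf, rfl⟩ := exists_form_of_orientation oσ
  obtain ⟨f₁, hf₁, rfl⟩ := exists_form_of_orientation o₁
  obtain ⟨f₂, hf₂, rfl⟩ := exists_form_of_orientation o₂
  obtain ⟨k, hk, rfl⟩ := exists_form_of_orientation oρ
  obtain ⟨g₁, hg₁, hgn₁⟩ := hg₁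
  obtain ⟨g₂, hg₂, hgn₂⟩ := hg₂
  -- The vector `-g₁` points out of `τ₁` along `ρ` and out of `σ` along `τ₂`, and symmetrically for
  -- `-g₂`. So the two products are the signs of `f (v₂, v₁, …)` and `f (v₁, v₂, …)` relative to `k`
  -- on `ρ`, and these differ by a transposition.
  let u₁ : linSpan τ₁ := -⟨g₁, Submodule.subset_span hg₁⟩
  let u₂ : linSpan τ₂ := -⟨g₂, Submodule.subset_span hg₂⟩
  have hle₁ := linSpan_mono h₁.le
  have hle₂ := linSpan_mono h₂.le
  have hr₁ := linSpan_mono hρ₁.le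
  have hr₂ := linSpan_mono hρ₂.le
  let v₁ : linSpan σ := Submodule.inclusion hle₁ u₁
  let v₂ : linSpan σ := Submodule.inclusion hle₂ u₂
  obtain ⟨c₁, hc₁⟩ := exists_eq_smul_form hd₁ hf₁
    ((f.curryLeft v₂).compLinearMap (Submodule.inclusion hle₁))
  obtain ⟨c₂, hc₂⟩ := exists_eq_smul_form hd₂ hf₂
    ((f.curryLeft v₁).compLinearMap (Submodule.inclusion hle₂))
  obtain ⟨d₁, hd₁'⟩ := exists_eq_smul_form hm hk
    ((f₁.curryLeft u₁).compLinearMap (Submodule.inclusion hr₁))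
  obtain ⟨d₂, hd₂'⟩ := exists_eq_smul_form hm hk
    ((f₂.curryLeft u₂).compLinearMap (Submodule.inclusion hr₂))
  obtain ⟨hc₁0, e₁⟩ := orientationSign_eq hσ h₁ hn hd₁ (u := v₂)
    (by simpa [v₂, u₂] using h₂.le hg₂) (by simpa [v₂, u₂] using hgn₂) hf hf₁ hle₁ hc₁
  obtain ⟨hc₂0, e₂⟩ := orientationSign_eq hσ h₂ hn hd₂ (u := v₁)
    (by simpa [v₁, u₁] using h₁.le hg₁) (by simpa [v₁, u₁] using hgn₁) hf hf₂ hle₂ hc₂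
  obtain ⟨hd₁0, e₃⟩ := orientationSign_eq hτ₁ hρ₁ hd₁ hm (u := u₁)
    (by simpa [u₁] using hg₁) (by simpa [u₁] using fun h => hgn₁ (hr₂ h)) hf₁ hk hr₁ hd₁'
  obtain ⟨hd₂0, e₄⟩ := orientationSign_eq hτ₂ hρ₂ hd₂ hm (u := u₂)
    (by simpa [u₂] using hg₂) (by simpa [u₂] using fun h => hgn₂ (hr₁ h)) hf₂ hk hr₂ hd₂'
  obtain ⟨t, ht⟩ : ∃ t, k t ≠ 0 := by
    by_contra! h
    exact hk (AlternatingMap.ext h)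
  have E₁ : f (Matrix.vecCons v₂ (Matrix.vecCons v₁ fun j =>
      ⟨t j, hle₁ (hr₁ (t j).2)⟩)) = c₁ * (d₁ * k t) := by
    have a := congrArg (fun q => q (Matrix.vecCons u₁ fun j => ⟨t j, hr₁ (t j).2⟩)) hc₁
    have b := congrArg (fun q => q t) hd₁'
    simp only [AlternatingMap.compLinearMap_apply, AlternatingMap.smul_apply,
      AlternatingMap.curryLeft_apply_apply, smul_eq_mul] at a b
    rw [← b]
    refine Eq.trans (congrArg f ?_) (a.trans ?_)
    · ext1 j
      refine Fin.cases rfl (fun j => ?_) j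
      refine Fin.cases rfl (fun j => rfl) j
    · rfl
  have E₂ : f (Matrix.vecCons v₁ (Matrix.vecCons v₂ fun j =>
      ⟨t j, hle₁ (hr₁ (t j).2)⟩)) = c₂ * (d₂ * k t) := by
    have a := congrArg (fun q => q (Matrix.vecCons u₂ fun j => ⟨t j, hr₂ (t j).2⟩)) hc₂
    have b := congrArg (fun q => q t) hd₂'
    simp only [AlternatingMap.compLinearMap_apply, AlternatingMap.smul_apply,
      AlternatingMap.curryLeft_apply_apply, smul_eq_mul] at a b
    rw [← b]
    refine Eq.trans (congrArg f ?_) (a.trans ?_)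
    · ext1 j
      refine Fin.cases rfl (fun j => ?_) j
      refine Fin.cases rfl (fun j => rfl) j
    · rfl
  have hswap := f.map_swap (Matrix.vecCons v₁ (Matrix.vecCons v₂ fun j =>
      (⟨t j, hle₁ (hr₁ (t j).2)⟩ : linSpan σ))) (i := 0) (j := 1) (by simp)
  have hcomp : (Matrix.vecCons v₁ (Matrix.vecCons v₂ fun j =>
      (⟨t j, hle₁ (hr₁ (t j).2)⟩ : linSpan σ))) ∘ Equiv.swap 0 1 =
      Matrix.vecCons v₂ (Matrix.vecCons v₁ fun j => ⟨t j, hle₁ (hr₁ (t j).2)⟩) := by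
    ext1 j
    refine Fin.cases ?_ (fun j => ?_) j
    · simp
    refine Fin.cases ?_ (fun j => ?_) j
    · simp
    · rw [Function.comp_apply, Equiv.swap_apply_of_ne_of_ne]
      · rfl
      · exact Fin.succ_ne_zero _
      · intro h
        exact Fin.succ_ne_zero j (Fin.succ_injective _ h)
  rw [hcomp, E₁, E₂] at hswap
  have hcd : d₁ * c₁ = -(d₂ * c₂) := by
    have : (d₁ * c₁ + d₂ * c₂) * k t = 0 := by linarith
    have := (mul_eq_zero.1 this).resolve_right ht
    linarith
  rw [e₁, e₂, e₃, e₄, ← ite_pos_mul hd₁0 hc₁0, ← ite_pos_mul hd₂0 hc₂0, hcd,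
    ite_pos_neg (mul_ne_zero hd₂0 hc₂0)]

end Signs

/-! ### The embedding of an imaginary quadratic ring of integers -/

section Arithmetic

variable {E : Type*} [Field E]

/-- The properties of the embedding `𝓞 E → ℂ` of the ring of integers of an imaginary quadratic
field which are used below: the absolute value of a nonzero element is at least `1`, with equality
for units only, and the image is discrete. -/
structure IsDiscreteEmbedding (φ : E →+* ℂ) : Prop where
  one_le_norm : ∀ x : 𝓞 E, x ≠ 0 → 1 ≤ ‖φ x‖
  norm_eq_one_iff : ∀ x : 𝓞 E, ‖φ x‖ = 1 ↔ IsUnit x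
  finite_norm_le : ∀ B : ℝ, {x : 𝓞 E | ‖φ x‖ ≤ B}.Finite

theorem isDiscreteEmbedding [NumberField E] (hdeg : Module.finrank ℚ E = 2)
    [NumberField.IsTotallyComplex E] (φ : E →+* ℂ) : IsDiscreteEmbedding φ := by
  have hφ : ¬ NumberField.ComplexEmbedding.IsReal φ :=
    NumberField.InfinitePlace.isComplex_mk_iff.1 (NumberField.IsTotallyComplex.isComplex _)
  have hcard : Fintype.card (E →+* ℂ) = 2 := by
    rw [NumberField.Embeddings.card, hdeg]
  -- The only embeddings are `φ` and its conjugate, so all conjugates of `x` have the same absolute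
  -- value and `|N x| = ‖φ x‖²`.
  have hall : ∀ (ψ : E →+* ℂ) (x : E), ‖ψ x‖ = ‖φ x‖ := by
    classical
    intro ψ x
    have huniv : ({φ, NumberField.ComplexEmbedding.conjugate φ} : Finset (E →+* ℂ)) =
        Finset.univ := by
      refine Finset.eq_univ_of_card _ ?_
      rw [hcard, Finset.card_pair]
      intro h
      exact hφ (NumberField.ComplexEmbedding.isReal_iff.2 h.symm)
    have hmem : ψ ∈ ({φ, NumberField.ComplexEmbedding.conjugate φ} : Finset (E →+* ℂ)) := by
      rw [huniv]; exact Finset.mem_univ _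
    rw [Finset.mem_insert, Finset.mem_singleton] at hmem
    rcases hmem with rfl | rfl
    · rfl
    · rw [NumberField.ComplexEmbedding.conjugate_coe_eq, Complex.norm_conj]
  have hnorm : ∀ x : 𝓞 E, ((|Algebra.norm ℤ x| : ℤ) : ℝ) = ‖φ x‖ ^ 2 := by
    intro x
    have h1 := Algebra.norm_eq_prod_embeddings ℚ ℂ (x : E)
    have h2 := congrArg norm h1
    have h3 : ∏ ψ : E →ₐ[ℚ] ℂ, ‖ψ (x : E)‖ = ‖φ x‖ ^ 2 := by
      have h4 : ∀ ψ ∈ (Finset.univ : Finset (E →ₐ[ℚ] ℂ)), ‖ψ (x : E)‖ = ‖φ x‖ :=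
        fun ψ _ => hall (ψ : E →+* ℂ) x
      rw [Finset.prod_congr rfl h4, Finset.prod_const, Finset.card_univ, AlgHom.card, hdeg]
    rw [norm_prod, h3, ← Algebra.coe_norm_int] at h2
    rw [← h2]
    simp
  have hone : ∀ x : 𝓞 E, x ≠ 0 → 1 ≤ ‖φ x‖ := by
    intro x hx
    have h1 : Algebra.norm ℤ x ≠ 0 := Algebra.norm_ne_zero_iff.2 hx
    have h2 : (1 : ℝ) ≤ ((|Algebra.norm ℤ x| : ℤ) : ℝ) := by
      exact_mod_cast Int.one_le_abs h1
    rw [hnorm] at h2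
    by_contra h
    push Not at h
    have := pow_lt_one₀ (norm_nonneg (φ x)) h two_ne_zero
    linarith
  refine ⟨hone, fun x => ?_, fun B => ?_⟩
  · have key : ‖φ x‖ = 1 ↔ |Algebra.norm ℤ x| = 1 := by
      rw [← pow_eq_one_iff_of_nonneg (norm_nonneg (φ x)) two_ne_zero, ← hnorm]
      norm_cast
    rw [key, NumberField.isUnit_iff_norm, RingOfIntegers.coe_norm, ← Algebra.coe_norm_int]
    norm_cast
  · have h := NumberField.Embeddings.finite_of_norm_le E ℂ B
    refine Set.Finite.of_finite_image (f := fun x : 𝓞 E => (x : E)) (h.subset ?_)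
      NumberField.RingOfIntegers.coe_injective.injOn
    rintro _ ⟨x, hx, rfl⟩
    exact ⟨x.2, fun ψ => (hall ψ x).trans_le hx⟩

end Arithmetic

/-! ### Hermitian forms -/

section Forms

variable {r : ℕ}

/-- The value of the Hermitian form with matrix `A` at a complex vector. -/
noncomputable def hermVal (A : Matrix (Fin r) (Fin r) ℂ) (x : Fin r → ℂ) : ℝ :=
  (x ⬝ᵥ A.mulVec (star x)).re

theorem hermVal_smul (A : Matrix (Fin r) (Fin r) ℂ) (c : ℂ) (x : Fin r → ℂ) :
    hermVal A (c • x) = ‖c‖ ^ 2 * hermVal A x := by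
  rw [hermVal, hermVal, star_smul, Matrix.mulVec_smul, smul_dotProduct, dotProduct_smul,
    smul_smul, smul_eq_mul, Complex.star_def, Complex.mul_conj, Complex.re_ofReal_mul,
    Complex.normSq_eq_norm_sq]

theorem hermVal_zero (A : Matrix (Fin r) (Fin r) ℂ) : hermVal A 0 = 0 := by
  simp [hermVal]

theorem hermVal_add (A B : Matrix (Fin r) (Fin r) ℂ) (x : Fin r → ℂ) :
    hermVal (A + B) x = hermVal A x + hermVal B x := by
  rw [hermVal, Matrix.add_mulVec, dotProduct_add, Complex.add_re]; rfl

theorem hermVal_real_smul (t : ℝ) (A : Matrix (Fin r) (Fin r) ℂ) (x : Fin r → ℂ) :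
    hermVal (t • A) x = t * hermVal A x := by
  rw [hermVal, Matrix.smul_mulVec, dotProduct_smul, Complex.smul_re]; rfl

theorem posDef_iff_hermVal {A : Matrix (Fin r) (Fin r) ℂ} :
    A.PosDef ↔ A.IsHermitian ∧ ∀ x : Fin r → ℂ, x ≠ 0 → 0 < hermVal A x := by
  rw [Matrix.posDef_iff_dotProduct_mulVec]
  refine and_congr_right fun hA => ⟨fun h x hx => ?_, fun h x hx => ?_⟩
  · have := h (x := star x) (by simpa using hx)
    rw [star_star] at this
    exact (Complex.pos_iff.1 this).1
  · have h1 := h (star x) (by simpa using hx)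
    rw [hermVal, star_star] at h1
    exact Complex.pos_iff.2 ⟨h1, (hA.im_star_dotProduct_mulVec_self x).symm⟩

theorem continuous_hermVal (A : Matrix (Fin r) (Fin r) ℂ) : Continuous (hermVal A) := by
  unfold hermVal dotProduct Matrix.mulVec dotProduct
  simp only [Pi.star_apply, RCLike.star_def]
  fun_prop

theorem hermVal_scale (A : Matrix (Fin r) (Fin r) ℂ) {x : Fin r → ℂ} (hx : x ≠ 0) :
    ∃ y : Fin r → ℂ, ‖y‖ = 1 ∧ hermVal A x = ‖x‖ ^ 2 * hermVal A y := by
  have hx' : ‖x‖ ≠ 0 := norm_ne_zero_iff.2 hx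
  refine ⟨((‖x‖⁻¹ : ℝ) : ℂ) • x, ?_, ?_⟩
  · rw [norm_smul, Complex.norm_real, norm_inv, norm_norm, inv_mul_cancel₀ hx']
  · rw [hermVal_smul, Complex.norm_real, norm_inv, norm_norm]
    field_simp

theorem exists_hermVal_lower_bound {A : Matrix (Fin r) (Fin r) ℂ} (hA : A.PosDef) :
    ∃ l : ℝ, 0 < l ∧ ∀ x, l * ‖x‖ ^ 2 ≤ hermVal A x := by
  have hpos := (posDef_iff_hermVal.1 hA).2
  -- The sphere is empty when `r = 0`; otherwise the bound is the minimum of the form on it.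
  rcases (Metric.sphere (0 : Fin r → ℂ) 1).eq_empty_or_nonempty with he | hne
  · refine ⟨1, one_pos, fun x => ?_⟩
    have : x = 0 := by
      by_contra hx
      obtain ⟨y, hy, -⟩ := hermVal_scale A hx
      exact he.subset (mem_sphere_zero_iff_norm.2 hy)
    rw [this, hermVal_zero]; simp
  · obtain ⟨z, hz, hmin⟩ := (isCompact_sphere (0 : Fin r → ℂ) 1).exists_isMinOn hne
      (continuous_hermVal A).continuousOn
    have hz0 : z ≠ 0 := by
      rintro rfl
      simp at hz
    refine ⟨hermVal A z, hpos z hz0, fun x => ?_⟩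
    by_cases hx : x = 0
    · rw [hx, hermVal_zero]; simp
    · obtain ⟨y, hy, h⟩ := hermVal_scale A hx
      rw [h, mul_comm]
      exact mul_le_mul_of_nonneg_left (hmin (mem_sphere_zero_iff_norm.2 hy)) (by positivity)

theorem exists_hermVal_upper_bound (B : Matrix (Fin r) (Fin r) ℂ) :
    ∃ K : ℝ, 0 < K ∧ ∀ x, |hermVal B x| ≤ K * ‖x‖ ^ 2 := by
  obtain ⟨K, hK⟩ := (isCompact_sphere (0 : Fin r → ℂ) 1).exists_bound_of_continuousOn
    (continuous_hermVal B).continuousOn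
  refine ⟨max K 1, lt_max_of_lt_right one_pos, fun x => ?_⟩
  by_cases hx : x = 0
  · rw [hx, hermVal_zero]; simp
  · obtain ⟨y, hy, h⟩ := hermVal_scale B hx
    rw [h, abs_mul, abs_of_nonneg (by positivity), mul_comm]
    exact mul_le_mul_of_nonneg_right ((hK y (mem_sphere_zero_iff_norm.2 hy)).trans
      (le_max_left _ _)) (by positivity)

/-- The real pairing `X ↦ Re ∑ Aᵢⱼ Xᵢⱼ`. -/
noncomputable def pairing (A : Matrix (Fin r) (Fin r) ℂ) :
    Matrix (Fin r) (Fin r) ℂ →ₗ[ℝ] ℝ where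
  toFun X := (∑ i, ∑ j, A i j * X i j).re
  map_add' X Y := by
    rw [← Complex.add_re, ← Finset.sum_add_distrib]
    simp only [← Finset.sum_add_distrib, Matrix.add_apply, mul_add]
  map_smul' c X := by
    simp only [RingHom.id_apply, Matrix.smul_apply, mul_smul_comm, ← Finset.smul_sum,
      Complex.smul_re]

theorem pairing_apply (A X : Matrix (Fin r) (Fin r) ℂ) :
    pairing A X = (∑ i, ∑ j, A i j * X i j).re := rfl

theorem pairing_vecMulVec (A : Matrix (Fin r) (Fin r) ℂ) (x : Fin r → ℂ) :
    pairing A (Matrix.vecMulVec x (star x)) = hermVal A x := by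
  rw [pairing_apply, hermVal, dotProduct]
  congr 1
  refine Finset.sum_congr rfl fun i _ => ?_
  rw [Matrix.mulVec, dotProduct, Finset.mul_sum]
  refine Finset.sum_congr rfl fun j _ => ?_
  rw [Matrix.vecMulVec_apply]; ring

theorem hermVal_vecMulVec (y x : Fin r → ℂ) :
    hermVal (Matrix.vecMulVec y (star y)) x = ‖y ⬝ᵥ x‖ ^ 2 := by
  have h : Matrix.mulVec (Matrix.vecMulVec y (star y)) (star x) = (star (y ⬝ᵥ x)) • y := by
    ext i
    simp only [Matrix.mulVec, dotProduct, Matrix.vecMulVec_apply, Pi.smul_apply, smul_eq_mul,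
      star_sum, Finset.sum_mul, Pi.star_apply, star_mul']
    exact Finset.sum_congr rfl fun j _ => by ring
  rw [hermVal, h, dotProduct_smul, dotProduct_comm, smul_eq_mul, mul_comm, Complex.star_def,
    Complex.mul_conj, Complex.ofReal_re, Complex.normSq_eq_norm_sq]

/-- Every real functional is represented on the Hermitian matrices by a Hermitian matrix. -/
theorem exists_hermitian_pairing (ℓ : Matrix (Fin r) (Fin r) ℂ →ₗ[ℝ] ℝ) :
    ∃ B : Matrix (Fin r) (Fin r) ℂ, B.IsHermitian ∧
      ∀ X : Matrix (Fin r) (Fin r) ℂ, X.IsHermitian → pairing B X = ℓ X := by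
  -- The real part of `C i j * X i j` involves `-Im (C i j) * Im (X i j)`, which explains the minus
  -- sign. `C` represents `ℓ` on all matrices, and its Hermitian part has the same pairing with
  -- Hermitian matrices.
  let C : Matrix (Fin r) (Fin r) ℂ := Matrix.of fun i j =>
    ⟨ℓ (Matrix.single i j 1), -ℓ (Matrix.single i j Complex.I)⟩
  have hC : ∀ X, pairing C X = ℓ X := fun X => by
    have hX : X = ∑ i, ∑ j, ((X i j).re • Matrix.single i j (1 : ℂ) +
        (X i j).im • Matrix.single i j Complex.I) := by
      conv_lhs => rw [Matrix.matrix_eq_sum_single X]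
      refine Finset.sum_congr rfl fun i _ => Finset.sum_congr rfl fun j _ => ?_
      rw [Matrix.smul_single, Matrix.smul_single, ← Matrix.single_add]
      congr 1
      apply Complex.ext <;> simp
    conv_rhs => rw [hX]
    rw [pairing_apply]
    simp only [map_sum, map_add, map_smul, Complex.re_sum, Complex.mul_re, C, Matrix.of_apply,
      smul_eq_mul]
    refine Finset.sum_congr rfl fun i _ => Finset.sum_congr rfl fun j _ => ?_
    ring
  refine ⟨(2⁻¹ : ℝ) • (C + C.conjTranspose), ?_, fun X hX => ?_⟩
  · rw [Matrix.IsHermitian, Matrix.conjTranspose_smul, Matrix.conjTranspose_add,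
      Matrix.conjTranspose_conjTranspose, add_comm]
    simp
  · have h1 : pairing C.conjTranspose X = pairing C X := by
      rw [pairing_apply, pairing_apply, ← Complex.conj_re, map_sum, Finset.sum_comm,
        Finset.sum_congr rfl (fun i _ => map_sum _ _ _), Finset.sum_comm]
      congr 1
      rw [Finset.sum_comm]
      refine Finset.sum_congr rfl fun i _ => Finset.sum_congr rfl fun j _ => ?_
      rw [map_mul, Matrix.conjTranspose_apply, ← hX.apply i j]
      simp
    rw [← hC X]
    have h2 : pairing ((2⁻¹ : ℝ) • (C + C.conjTranspose)) X =
        2⁻¹ * (pairing C X + pairing C.conjTranspose X) := by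
      simp only [pairing_apply, ← Complex.add_re, ← Finset.sum_add_distrib, ← add_mul,
        Matrix.smul_apply, smul_mul_assoc, ← Finset.smul_sum, Complex.smul_re, Matrix.add_apply,
        smul_eq_mul]
    rw [h2, h1]; ring

end Forms

/-! ### Minimal vectors and perfect cones -/

section PerfectCones

variable {E : Type*} [Field E] {φ : E →+* ℂ} {r : ℕ}

theorem toComplex_smul (a : 𝓞 E) (v : Fin r → 𝓞 E) :
    toComplex φ (a • v) = (φ a) • toComplex φ v := by
  ext i; simp [toComplex]

theorem toComplex_add (v w : Fin r → 𝓞 E) :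
    toComplex φ (v + w) = toComplex φ v + toComplex φ w := by
  ext i; simp [toComplex]

theorem map_coe_eq_zero {a : 𝓞 E} : φ a = 0 ↔ a = 0 := by
  rw [map_eq_zero]
  exact NumberField.RingOfIntegers.coe_eq_zero_iff

theorem map_coe_inj {a b : 𝓞 E} : φ a = φ b ↔ a = b :=
  φ.injective.eq_iff.trans NumberField.RingOfIntegers.coe_injective.eq_iff

theorem toComplex_eq_zero {v : Fin r → 𝓞 E} : toComplex φ v = 0 ↔ v = 0 := by
  simp only [funext_iff, toComplex, Pi.zero_apply, map_coe_eq_zero]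

theorem formValue_eq_hermVal (A : Matrix (Fin r) (Fin r) ℂ) (v : Fin r → 𝓞 E) :
    formValue φ A v = hermVal A (toComplex φ v) := rfl

theorem pairing_rankOne (A : Matrix (Fin r) (Fin r) ℂ) (v : Fin r → 𝓞 E) :
    pairing A (rankOne φ v) = formValue φ A v :=
  pairing_vecMulVec A _

theorem rankOne_isHermitian (v : Fin r → 𝓞 E) : (rankOne φ v).IsHermitian := by
  ext i j
  simp [rankOne, Matrix.vecMulVec_apply, mul_comm]

theorem formValue_smul (A : Matrix (Fin r) (Fin r) ℂ) (a : 𝓞 E) (v : Fin r → 𝓞 E) :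
    formValue φ A (a • v) = ‖φ a‖ ^ 2 * formValue φ A v := by
  rw [formValue_eq_hermVal, toComplex_smul, hermVal_smul]; rfl

theorem formValue_pos {A : Matrix (Fin r) (Fin r) ℂ} (hA : A.PosDef) {v : Fin r → 𝓞 E}
    (hv : v ≠ 0) : 0 < formValue φ A v :=
  (posDef_iff_hermVal.1 hA).2 _ (toComplex_eq_zero.not.2 hv)

theorem rankOne_unit_smul (hφ : IsDiscreteEmbedding φ) {u : 𝓞 E} (hu : IsUnit u)
    (v : Fin r → 𝓞 E) : rankOne φ (u • v) = rankOne φ v := by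
  have h := (hφ.norm_eq_one_iff u).2 hu
  rw [rankOne, toComplex_smul, star_smul, Matrix.smul_vecMulVec, Matrix.vecMulVec_smul,
    smul_smul, Complex.star_def, Complex.mul_conj, Complex.normSq_eq_norm_sq, h, rankOne]
  simp

theorem rankOne_ne_zero {v : Fin r → 𝓞 E} (hv : v ≠ 0) : rankOne φ v ≠ 0 := by
  obtain ⟨i, hi⟩ := Function.ne_iff.1 hv
  intro h
  have h1 := congrFun (congrFun h i) i
  rw [rankOne, Matrix.vecMulVec_apply, Pi.star_apply, Complex.star_def, Complex.mul_conj, Matrix.zero_apply] at h1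
  have h2 : Complex.normSq (toComplex φ v i) = 0 := by exact_mod_cast h1
  exact hi (map_coe_eq_zero.1 (Complex.normSq_eq_zero.1 h2))

theorem finite_formValue_le (hφ : IsDiscreteEmbedding φ) {A : Matrix (Fin r) (Fin r) ℂ}
    (hA : A.PosDef) (B : ℝ) : {v : Fin r → 𝓞 E | formValue φ A v ≤ B}.Finite := by
  obtain ⟨l, hl, hA⟩ := exists_hermVal_lower_bound hA
  -- Since `l * ‖x‖² ≤ B` and `t ≤ t² + 1`, each coordinate has absolute value at most `B / l + 1`.
  refine (Set.Finite.pi (t := fun _ : Fin r => {x : 𝓞 E | ‖φ x‖ ≤ B / l + 1})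
    fun i => hφ.finite_norm_le _).subset fun v hv i _ => ?_
  have h1 : l * ‖toComplex φ v‖ ^ 2 ≤ B := (hA _).trans hv
  have h2 : ‖φ (v i)‖ ≤ ‖toComplex φ v‖ := norm_le_pi_norm (toComplex φ v) i
  have h3 : ‖toComplex φ v‖ ^ 2 ≤ B / l := by rw [le_div_iff₀ hl]; linarith
  have h4 := sq_nonneg (‖toComplex φ v‖ - 1)
  change ‖φ (v i)‖ ≤ B / l + 1
  nlinarith [norm_nonneg (toComplex φ v)]

theorem finite_minVectors (hφ : IsDiscreteEmbedding φ) {A : Matrix (Fin r) (Fin r) ℂ}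
    (hA : A.PosDef) : (minVectors φ A).Finite := by
  rcases (minVectors φ A).eq_empty_or_nonempty with h | ⟨v, hv⟩
  · rw [h]; exact Set.finite_empty
  · exact (finite_formValue_le hφ hA (formValue φ A v)).subset fun w hw => hw.2 v hv.1

/-- Only finitely many vectors have value at most `m + 1`, so the second smallest value is attained.
The gap leaves room for perturbing `A`. -/
theorem exists_gap (hφ : IsDiscreteEmbedding φ) {A : Matrix (Fin r) (Fin r) ℂ}
    (hA : A.PosDef) {v : Fin r → 𝓞 E} (hv : v ∈ minVectors φ A) :
    ∃ δ : ℝ, 0 < δ ∧ ∀ w : Fin r → 𝓞 E, w ≠ 0 → w ∉ minVectors φ A →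
      formValue φ A v + δ ≤ formValue φ A w := by
  set m := formValue φ A v with hm
  have hlt : ∀ w : Fin r → 𝓞 E, w ≠ 0 → w ∉ minVectors φ A → m < formValue φ A w := by
    intro w hw hw'
    by_contra h
    push Not at h
    exact hw' ⟨hw, fun x hx => h.trans (hv.2 x hx)⟩
  set T := {w : Fin r → 𝓞 E | formValue φ A w ≤ m + 1 ∧ w ≠ 0 ∧ w ∉ minVectors φ A} with hT
  have hfin : T.Finite := (finite_formValue_le hφ hA (m + 1)).subset fun w hw => hw.1
  rcases T.eq_empty_or_nonempty with he | hne
  · refine ⟨1, one_pos, fun w hw hw' => ?_⟩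
    by_contra h
    push Not at h
    exact he.subset (show w ∈ T from ⟨h.le, hw, hw'⟩)
  · obtain ⟨w₀, hw₀, hmin⟩ := hfin.toFinset.exists_min_image (formValue φ A)
      (hfin.toFinset_nonempty.2 hne)
    have hw₀' := hfin.mem_toFinset.1 hw₀
    have h0 := hlt w₀ hw₀'.2.1 hw₀'.2.2
    refine ⟨formValue φ A w₀ - m, by linarith, fun w hw hw' => ?_⟩
    by_cases h : formValue φ A w ≤ m + 1
    · linarith [hmin w (hfin.mem_toFinset.2 ⟨h, hw, hw'⟩)]
    · linarith [hw₀'.1]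

/-- A vector is primitive if some functional takes the value `1` at it. -/
def IsPrimitive (v : Fin r → 𝓞 E) : Prop :=
  ∃ ξ : (Fin r → 𝓞 E) →ₗ[𝓞 E] 𝓞 E, ξ v = 1

theorem IsPrimitive.ne_zero {v : Fin r → 𝓞 E} (h : IsPrimitive v) : v ≠ 0 := by
  rintro rfl
  obtain ⟨ξ, hξ⟩ := h
  rw [map_zero] at hξ
  exact zero_ne_one hξ

theorem IsPrimitive.smul_unit {v : Fin r → 𝓞 E} (h : IsPrimitive v) (u : (𝓞 E)ˣ) :
    IsPrimitive ((u : 𝓞 E) • v) := by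
  obtain ⟨ξ, hξ⟩ := h
  exact ⟨((u⁻¹ : (𝓞 E)ˣ) : 𝓞 E) • ξ, by simp [hξ]⟩

/-- Proportionality gives `w = ξ w • v` whenever `ξ v = 1`; a functional equal to `1` at `w` then
shows that `ξ w` is invertible. -/
theorem IsPrimitive.exists_unit {v w : Fin r → 𝓞 E} (hv : IsPrimitive v) (hw : IsPrimitive w)
    (h : ∀ i j, w i * v j = w j * v i) : ∃ u : (𝓞 E)ˣ, w = (u : 𝓞 E) • v := by
  obtain ⟨ξ, hξ⟩ := hv
  obtain ⟨η, hη⟩ := hw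
  have key : w = ξ w • v := by
    ext1 i
    rw [Pi.smul_apply, smul_eq_mul]
    calc w i = w i * ξ v := by rw [hξ, mul_one]
      _ = ξ (w i • v) := by rw [map_smul, smul_eq_mul]
      _ = ξ (v i • w) := by
        congr 1
        ext1 j
        rw [Pi.smul_apply, Pi.smul_apply, smul_eq_mul, smul_eq_mul, h i j, mul_comm]
      _ = ξ w * v i := by rw [map_smul, smul_eq_mul, mul_comm]
  have hu : ξ w * η v = 1 := by
    rw [key, map_smul, smul_eq_mul] at hη
    exact hη
  exact ⟨⟨ξ w, η v, hu, by rw [mul_comm, hu]⟩, key⟩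

/-- The functional `x ↦ φ (ξ x)` as a complex vector. -/
noncomputable def dualVec (φ : E →+* ℂ) (ξ : (Fin r → 𝓞 E) →ₗ[𝓞 E] 𝓞 E) : Fin r → ℂ :=
  fun i => φ (ξ (Pi.single i 1))

theorem dualVec_dotProduct (ξ : (Fin r → 𝓞 E) →ₗ[𝓞 E] 𝓞 E) (v : Fin r → 𝓞 E) :
    dualVec φ ξ ⬝ᵥ toComplex φ v = φ (ξ v) := by
  rw [LinearMap.pi_apply_eq_sum_univ ξ v]
  simp only [dotProduct, dualVec, toComplex, smul_eq_mul, map_sum, map_mul]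
  refine Finset.sum_congr rfl fun i _ => ?_
  rw [mul_comm]
  congr 4
  ext j
  simp [Pi.single_apply, eq_comm]

/-- The real functional `X ↦ y X y*`. -/
noncomputable def evalAt (y : Fin r → ℂ) : Matrix (Fin r) (Fin r) ℂ →ₗ[ℝ] ℝ :=
  pairing (Matrix.vecMulVec y (star y))

/-- These functionals are nonnegative on every perfect cone and vanish on `v v*` exactly when `y` is
orthogonal to `v`; they cut out the faces used below. -/
theorem evalAt_rankOne (y : Fin r → ℂ) (v : Fin r → 𝓞 E) :
    evalAt y (rankOne φ v) = ‖y ⬝ᵥ toComplex φ v‖ ^ 2 := by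
  rw [evalAt, pairing_rankOne, formValue_eq_hermVal, hermVal_vecMulVec]

theorem evalAt_dualVec_rankOne (ξ : (Fin r → 𝓞 E) →ₗ[𝓞 E] 𝓞 E) (v : Fin r → 𝓞 E) :
    evalAt (dualVec φ ξ) (rankOne φ v) = ‖φ (ξ v)‖ ^ 2 := by
  rw [evalAt_rankOne, dualVec_dotProduct]

/-- The primitive vectors `v` for which `v v*` lies in the cone. For the cone `σ(A)` these are the
minimal vectors of `A`. -/
def coneVectors (φ : E →+* ℂ) (σ : PointedCone ℝ (Matrix (Fin r) (Fin r) ℂ)) :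
    Set (Fin r → 𝓞 E) :=
  {v | IsPrimitive v ∧ rankOne φ v ∈ σ}

theorem coneVectors_mono {σ τ : PointedCone ℝ (Matrix (Fin r) (Fin r) ℂ)} (h : τ ≤ σ) :
    coneVectors φ τ ⊆ coneVectors φ σ :=
  fun _ hv => ⟨hv.1, h hv.2⟩

theorem coneVectors_bot :
    coneVectors φ (⊥ : PointedCone ℝ (Matrix (Fin r) (Fin r) ℂ)) = ∅ :=
  Set.eq_empty_of_forall_notMem fun _ hv => rankOne_ne_zero hv.1.ne_zero hv.2

/-- A primitive vector whose rank one matrix is a nonnegative combination of rank one matrices of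
primitive vectors is, up to a unit, one of these vectors. -/
theorem exists_unit_of_mem_hull {S : Set (Fin r → 𝓞 E)} (hS : ∀ w ∈ S, IsPrimitive w)
    {v : Fin r → 𝓞 E} (hv : IsPrimitive v)
    (h : rankOne φ v ∈ PointedCone.hull ℝ (rankOne φ '' S)) :
    ∃ w ∈ S, ∃ u : (𝓞 E)ˣ, w = (u : 𝓞 E) • v := by
  obtain ⟨c, hc, h0, hsum⟩ := PointedCone.mem_hull_set.1 h
  have hne : c.support.Nonempty := by
    rw [Finset.nonempty_iff_ne_empty]
    intro he
    rw [Finsupp.support_eq_empty] at he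
    rw [he, Finsupp.sum_zero_index] at hsum
    exact rankOne_ne_zero hv.ne_zero hsum.symm
  obtain ⟨X, hX⟩ := hne
  obtain ⟨w, hw, rfl⟩ := hc hX
  refine ⟨w, hw, hv.exists_unit (hS w hw) fun i j => ?_⟩
  have hpos : 0 < c (rankOne φ w) := lt_of_le_of_ne (h0 _) (Ne.symm (Finsupp.mem_support_iff.1 hX))
  -- On a vanishing sum of nonnegative terms each term vanishes, so whatever is orthogonal to `v` is
  -- orthogonal to `w`. The vectors `v j • e i - v i • e j` then show that `w` is proportional to
  -- `v`.
  have key : ∀ y : Fin r → ℂ, y ⬝ᵥ toComplex φ v = 0 → y ⬝ᵥ toComplex φ w = 0 := by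
    intro y hy
    have h1 : evalAt y (rankOne φ v) = 0 := by rw [evalAt_rankOne, hy]; simp
    rw [← hsum, Finsupp.sum, map_sum, Finset.sum_eq_zero_iff_of_nonneg] at h1
    · have h2 := h1 _ hX
      rw [map_smul, smul_eq_mul, evalAt_rankOne] at h2
      exact norm_eq_zero.1 (pow_eq_zero_iff two_ne_zero |>.1
        ((mul_eq_zero.1 h2).resolve_left hpos.ne'))
    · intro Y hY
      obtain ⟨w', -, rfl⟩ := hc hY
      rw [map_smul, smul_eq_mul, evalAt_rankOne]
      exact mul_nonneg (h0 _) (sq_nonneg _)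
  have h3 := key (toComplex φ v j • Pi.single i 1 - toComplex φ v i • Pi.single j 1) (by
    simp only [sub_dotProduct, smul_dotProduct, single_one_dotProduct, smul_eq_mul]; ring)
  simp only [sub_dotProduct, smul_dotProduct, single_one_dotProduct, smul_eq_mul] at h3
  have h4 : φ ((v j * w i : 𝓞 E) : E) = φ ((v i * w j : 𝓞 E) : E) := by
    rw [sub_eq_zero] at h3
    simpa [toComplex] using h3
  rw [mul_comm (w i), mul_comm (w j)]
  exact map_coe_inj.1 h4

theorem smul_mem_minVectors (hφ : IsDiscreteEmbedding φ) {A : Matrix (Fin r) (Fin r) ℂ}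
    {v : Fin r → 𝓞 E} (u : (𝓞 E)ˣ) (h : (u : 𝓞 E) • v ∈ minVectors φ A) :
    v ∈ minVectors φ A := by
  have h1 := (hφ.norm_eq_one_iff u).2 u.isUnit
  refine ⟨fun h0 => h.1 (by rw [h0, smul_zero]), fun w hw => ?_⟩
  have := h.2 w hw
  rwa [formValue_smul, h1, one_pow, one_mul] at this

theorem mem_linSpan_nonneg {σ : PointedCone ℝ (Matrix (Fin r) (Fin r) ℂ)}
    {S : Set (Fin r → 𝓞 E)} (hσ : σ = PointedCone.hull ℝ (rankOne φ '' S)) (y : Fin r → ℂ) :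
    ∀ X ∈ σ, 0 ≤ evalAt y X := by
  subst hσ
  refine le_of_generators_le ?_
  rintro _ ⟨w, -, rfl⟩
  rw [evalAt_rankOne]
  positivity

variable {σ τ : PointedCone ℝ (Matrix (Fin r) (Fin r) ℂ)}

/-- The faces of a Hermitian perfect cone are Hermitian perfect cones. -/
theorem IsHermitianPerfectCone.of_isFaceOf (hφ : IsDiscreteEmbedding φ) (h : IsHermitianPerfectCone φ σ)
    (hτ : τ.IsFaceOf σ) : IsHermitianPerfectCone φ τ := by
  rcases h with rfl | ⟨A, hA, rfl⟩
  · exact Or.inl (le_bot_iff.1 hτ.le)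
  have hfin := finite_minVectors hφ hA
  have hτ' : τ = PointedCone.hull ℝ (rankOne φ '' {v ∈ minVectors φ A | rankOne φ v ∈ τ}) := by
    rw [face_eq_hull hτ]
    congr 1
    ext X
    constructor
    · rintro ⟨⟨v, hv, rfl⟩, hX⟩
      exact ⟨v, ⟨hv, by rw [← face_eq_hull hτ]; exact hX⟩, rfl⟩
    · rintro ⟨v, ⟨hv, hv'⟩, rfl⟩
      rw [← face_eq_hull hτ] at hv'
      exact ⟨⟨v, hv, rfl⟩, hv'⟩
  by_cases hne : {v ∈ minVectors φ A | rankOne φ v ∈ τ}.Nonempty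
  swap
  · rw [Set.not_nonempty_iff_eq_empty.1 hne, Set.image_empty] at hτ'
    exact Or.inl (hτ'.trans Submodule.span_empty)
  obtain ⟨v₀, hv₀, hv₀τ⟩ := hne
  -- Adding a small positive multiple of a form `B` representing `ℓ` keeps the minimum `m` on the
  -- vectors of `τ` and raises the value at all the other minimal vectors of `A`.
  obtain ⟨ℓ, hℓ⟩ := exists_exposing (hfin.image _) hτ
  obtain ⟨B, hB, hBℓ⟩ := exists_hermitian_pairing ℓ
  have hℓv : ∀ v, formValue φ B v = ℓ (rankOne φ v) := fun v => by
    rw [← pairing_rankOne, hBℓ _ (rankOne_isHermitian v)]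
  obtain ⟨l, hl, hlA⟩ := exists_hermVal_lower_bound hA
  obtain ⟨K, hK, hKB⟩ := exists_hermVal_upper_bound B
  obtain ⟨δ, hδ, hgap⟩ := exists_gap hφ hA hv₀
  set m := formValue φ A v₀ with hm
  have hm0 : 0 < m := formValue_pos hA hv₀.1
  have hmin : ∀ v ∈ minVectors φ A, formValue φ A v = m := fun v hv =>
    le_antisymm (hv.2 _ hv₀.1) (hv₀.2 _ hv.1)
  -- perturb `A` by a small multiple of `B`
  set s : ℝ := δ / (2 * (m + δ)) with hs
  have hs0 : 0 < s := by positivity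
  have hs1 : s * (m + δ) = δ / 2 := by rw [hs]; field_simp
  have hs2 : s < 1 := by nlinarith
  set t : ℝ := s * l / K with ht
  have ht0 : 0 < t := by positivity
  -- The constant `t` is chosen so that `t * |B| ≤ s * A`, and `s` so that `(1 - s) * (m + δ) = m +
  -- δ / 2`. Hence vectors that are not minimal for `A` stay above `m`.
  have hbound : ∀ x, (1 - s) * hermVal A x ≤ hermVal (A + t • B) x := fun x => by
    rw [hermVal_add, hermVal_real_smul]
    have h1 := (abs_le.1 (hKB x)).1
    have h2 := hlA x
    have h3 : t * -(K * ‖x‖ ^ 2) ≤ t * hermVal B x := mul_le_mul_of_nonneg_left h1 ht0.le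
    have h4 : t * (K * ‖x‖ ^ 2) = s * (l * ‖x‖ ^ 2) := by rw [ht]; field_simp
    have h5 := mul_le_mul_of_nonneg_left h2 hs0.le
    linarith
  have hA' : (A + t • B).PosDef := by
    rw [posDef_iff_hermVal] at hA ⊢
    refine ⟨hA.1.add (by
      rw [Matrix.IsHermitian, Matrix.conjTranspose_smul, hB.eq]; simp), fun x hx => ?_⟩
    exact lt_of_lt_of_le (mul_pos (by linarith) (hA.2 x hx)) (hbound x)
  have hval : ∀ v, formValue φ (A + t • B) v = formValue φ A v + t * ℓ (rankOne φ v) := fun v => by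
    rw [formValue_eq_hermVal, hermVal_add, hermVal_real_smul, ← formValue_eq_hermVal,
      ← formValue_eq_hermVal, hℓv]
  have hmem : ∀ v ∈ minVectors φ A, rankOne φ v ∈ perfectCone φ A := fun v hv =>
    PointedCone.subset_hull ⟨v, hv, rfl⟩
  have hval₀ : formValue φ (A + t • B) v₀ = m := by
    rw [hval, (hℓ _ (hmem v₀ hv₀)).2.2 hv₀τ]; simp [hm]
  have hbig : ∀ w : Fin r → 𝓞 E, w ≠ 0 → w ∉ minVectors φ A →
      m < formValue φ (A + t • B) w := fun w hw hw' => by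
    have h1 := hgap w hw hw'
    have h2 := hbound (toComplex φ w)
    have h3 := mul_le_mul_of_nonneg_left h1 (show 0 ≤ 1 - s by linarith)
    rw [← formValue_eq_hermVal, ← formValue_eq_hermVal] at h2
    nlinarith
  have hge : ∀ w : Fin r → 𝓞 E, w ≠ 0 → m ≤ formValue φ (A + t • B) w := fun w hw => by
    by_cases hw' : w ∈ minVectors φ A
    · rw [hval, hmin w hw']
      have := mul_nonneg ht0.le (hℓ _ (hmem w hw')).1
      linarith
    · exact (hbig w hw hw').le
  refine Or.inr ⟨A + t • B, hA', ?_⟩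
  rw [hτ', perfectCone]
  congr 2
  ext v
  constructor
  · rintro ⟨hv, hvτ⟩
    refine ⟨hv.1, fun w hw => ?_⟩
    rw [hval v, (hℓ _ (hmem v hv)).2.2 hvτ, hmin v hv, mul_zero, add_zero]
    exact hge w hw
  · rintro ⟨hv0, hv⟩
    have h1 := hv v₀ hv₀.1
    rw [hval₀] at h1
    have hvA : v ∈ minVectors φ A := by
      by_contra h
      exact absurd (hbig v hv0 h) (not_lt.2 h1)
    refine ⟨hvA, (hℓ _ (hmem v hvA)).2.1 ?_⟩
    rw [hval, hmin v hvA] at h1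
    have h2 := (hℓ _ (hmem v hvA)).1
    nlinarith [mul_nonneg ht0.le h2, h1]

variable [IsPrincipalIdealRing (𝓞 E)]

/-- The entries of `v` generate a principal ideal `(d)`, and `v = d • w` with `w` primitive.
Minimality against `w` forces `‖φ d‖ = 1`, so `d` is a unit. -/
theorem isPrimitive_of_mem_minVectors (hφ : IsDiscreteEmbedding φ)
    {A : Matrix (Fin r) (Fin r) ℂ} (hA : A.PosDef) {v : Fin r → 𝓞 E}
    (hv : v ∈ minVectors φ A) : IsPrimitive v := by
  set I := Ideal.span (Set.range v) with hI
  obtain ⟨d, hd⟩ := (IsPrincipalIdealRing.principal I).principal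
  have hdvd : ∀ i, ∃ b, v i = d * b := fun i => by
    have : v i ∈ I := Ideal.subset_span ⟨i, rfl⟩
    rw [hd] at this
    exact Ideal.mem_span_singleton.1 this
  choose w hw using hdvd
  have hvw : v = d • w := by ext1 i; rw [hw, Pi.smul_apply, smul_eq_mul]
  have hw0 : w ≠ 0 := fun h => hv.1 (by rw [hvw, h, smul_zero])
  have hd0 : d ≠ 0 := fun h => hv.1 (by rw [hvw, h, zero_smul])
  have hdI : d ∈ I := by rw [hd]; exact Ideal.mem_span_singleton_self d
  obtain ⟨a, ha⟩ := (Ideal.mem_span_range_iff_exists_fun).1 hdI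
  have ha1 : ∑ i, a i * w i = 1 := by
    refine mul_left_cancel₀ hd0 ?_
    rw [mul_one, Finset.mul_sum]
    conv_rhs => rw [← ha]
    exact Finset.sum_congr rfl fun i _ => by rw [hw i]; ring
  have h1 := hv.2 w hw0
  rw [hvw, formValue_smul] at h1
  have hpos := formValue_pos (φ := φ) hA hw0
  have hd1 : ‖φ d‖ = 1 := by
    refine le_antisymm ?_ (hφ.one_le_norm d hd0)
    by_contra h
    push Not at h
    nlinarith [one_lt_pow₀ h two_ne_zero]
  have hu : IsUnit d := (hφ.norm_eq_one_iff d).1 hd1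
  obtain ⟨u, rfl⟩ := hu
  rw [hvw]
  refine IsPrimitive.smul_unit ⟨∑ i, a i • LinearMap.proj i, ?_⟩ u
  simpa [LinearMap.sum_apply] using ha1

/-- Recovers the minimal vectors from the cone alone, so that later notions do not depend on the
choice of `A`. -/
theorem coneVectors_perfectCone (hφ : IsDiscreteEmbedding φ)
    {A : Matrix (Fin r) (Fin r) ℂ} (hA : A.PosDef) :
    coneVectors φ (perfectCone φ A) = minVectors φ A := by
  ext v
  constructor
  · rintro ⟨hv, h⟩
    obtain ⟨w, hw, u, rfl⟩ :=
      exists_unit_of_mem_hull (fun w hw => isPrimitive_of_mem_minVectors hφ hA hw) hv h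
    exact smul_mem_minVectors hφ u hw
  · exact fun hv => ⟨isPrimitive_of_mem_minVectors hφ hA hv,
      PointedCone.subset_hull ⟨v, hv, rfl⟩⟩

namespace IsHermitianPerfectCone

theorem eq_hull (hφ : IsDiscreteEmbedding φ) (h : IsHermitianPerfectCone φ σ) :
    σ = PointedCone.hull ℝ (rankOne φ '' coneVectors φ σ) := by
  rcases h with rfl | ⟨A, hA, rfl⟩
  · rw [coneVectors_bot, Set.image_empty]; exact Submodule.span_empty.symm
  · rw [coneVectors_perfectCone hφ hA]; rfl

theorem finite (hφ : IsDiscreteEmbedding φ) (h : IsHermitianPerfectCone φ σ) :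
    (coneVectors φ σ).Finite := by
  rcases h with rfl | ⟨A, hA, rfl⟩
  · rw [coneVectors_bot]; exact Set.finite_empty
  · rw [coneVectors_perfectCone hφ hA]; exact finite_minVectors hφ hA

theorem fg (hφ : IsDiscreteEmbedding φ) (h : IsHermitianPerfectCone φ σ) : σ.FG := by
  rw [h.eq_hull hφ]
  exact Submodule.fg_span ((h.finite hφ).image _)

theorem ext (hφ : IsDiscreteEmbedding φ) (h : IsHermitianPerfectCone φ σ)
    (h' : IsHermitianPerfectCone φ τ) (he : coneVectors φ σ = coneVectors φ τ) : σ = τ := by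
  rw [h.eq_hull hφ, h'.eq_hull hφ, he]

theorem evalAt_nonneg (hφ : IsDiscreteEmbedding φ) (h : IsHermitianPerfectCone φ σ)
    (y : Fin r → ℂ) : ∀ X ∈ σ, 0 ≤ evalAt y X :=
  mem_linSpan_nonneg (h.eq_hull hφ) y

theorem linSpan_eq (hφ : IsDiscreteEmbedding φ) (h : IsHermitianPerfectCone φ σ) :
    linSpan σ = Submodule.span ℝ (rankOne φ '' coneVectors φ σ) := by
  refine le_antisymm (Submodule.span_le.2 fun X hX => ?_) (Submodule.span_mono ?_)
  · rw [h.eq_hull hφ] at hX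
    exact PointedCone.hull_le_span (R := ℝ) _ hX
  · rintro _ ⟨v, hv, rfl⟩
    exact hv.2

end IsHermitianPerfectCone

end PerfectCones

/-! ### The action of `GL_r(R)` on cones -/

section Pullback

variable {r : ℕ}

/-- The matrix of the Hermitian form `x ↦ A(Nx)`. -/
def pullForm (A N : Matrix (Fin r) (Fin r) ℂ) : Matrix (Fin r) (Fin r) ℂ :=
  N.transpose * A * N.conjTranspose.transpose

theorem hermVal_pullForm (A N : Matrix (Fin r) (Fin r) ℂ) (x : Fin r → ℂ) :
    hermVal (pullForm A N) x = hermVal A (N.mulVec x) := by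
  rw [hermVal, hermVal, pullForm, Matrix.star_mulVec, ← Matrix.mulVec_mulVec,
    ← Matrix.mulVec_mulVec, Matrix.dotProduct_mulVec, Matrix.vecMul_transpose,
    Matrix.mulVec_transpose]

theorem isHermitian_pullForm {A : Matrix (Fin r) (Fin r) ℂ} (hA : A.IsHermitian)
    (N : Matrix (Fin r) (Fin r) ℂ) : (pullForm A N).IsHermitian := by
  have h : N.conjTranspose.transpose.conjTranspose = N.transpose := by ext i j; simp
  rw [Matrix.IsHermitian, pullForm, Matrix.conjTranspose_mul, Matrix.conjTranspose_mul, hA.eq, h,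
    mul_assoc]
  rfl

end Pullback

/-! ### Transport of cones, their vectors and their invariants -/

section Action

variable {E : Type*} [Field E] {φ : E →+* ℂ} {r n : ℕ}
  {σ τ : PointedCone ℝ (Matrix (Fin r) (Fin r) ℂ)}

theorem toComplex_mulVec (g : Matrix (Fin r) (Fin r) (𝓞 E)) (v : Fin r → 𝓞 E) :
    toComplex φ (g.mulVec v) =
      ((φ.comp (algebraMap (𝓞 E) E)).mapMatrix g).mulVec (toComplex φ v) := by
  ext i
  simp [toComplex, Matrix.mulVec, dotProduct]

theorem glToComplex_mulVec (g : GL (Fin r) (𝓞 E)) (v : Fin r → 𝓞 E) :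
    (glToComplex φ g).val.mulVec (toComplex φ v) = toComplex φ (g.val.mulVec v) :=
  (toComplex_mulVec _ _).symm

theorem act_apply (g : GL (Fin r) (𝓞 E)) (X : Matrix (Fin r) (Fin r) ℂ) :
    act φ g X = (glToComplex φ g).val * X * (glToComplex φ g).val.conjTranspose := rfl

theorem act_rankOne (g : GL (Fin r) (𝓞 E)) (v : Fin r → 𝓞 E) :
    act φ g (rankOne φ v) = rankOne φ (g.val.mulVec v) := by
  rw [act_apply, rankOne, rankOne, ← glToComplex_mulVec, Matrix.star_mulVec,
    Matrix.mul_vecMulVec, Matrix.vecMulVec_mul]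

theorem act_mul (g h : GL (Fin r) (𝓞 E)) (X : Matrix (Fin r) (Fin r) ℂ) :
    act φ (g * h) X = act φ g (act φ h X) := by
  simp only [act_apply, glToComplex, map_mul, Units.val_mul, Matrix.conjTranspose_mul, mul_assoc]

theorem act_one (X : Matrix (Fin r) (Fin r) ℂ) : act φ 1 X = X := by
  simp [act_apply, glToComplex]

theorem mem_moveCone {g : GL (Fin r) (𝓞 E)} {X : Matrix (Fin r) (Fin r) ℂ} :
    X ∈ moveCone φ g σ ↔ ∃ Y ∈ σ, act φ g Y = X := by
  rw [moveCone, PointedCone.mem_map]; rfl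

theorem act_mem_moveCone {g : GL (Fin r) (𝓞 E)} {X : Matrix (Fin r) (Fin r) ℂ} (h : X ∈ σ) :
    act φ g X ∈ moveCone φ g σ :=
  mem_moveCone.2 ⟨X, h, rfl⟩

theorem moveCone_mul (g h : GL (Fin r) (𝓞 E)) :
    moveCone φ (g * h) σ = moveCone φ g (moveCone φ h σ) := by
  ext X
  simp only [mem_moveCone, act_mul]
  constructor
  · rintro ⟨Y, hY, rfl⟩
    exact ⟨_, ⟨Y, hY, rfl⟩, rfl⟩
  · rintro ⟨_, ⟨Y, hY, rfl⟩, rfl⟩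
    exact ⟨Y, hY, rfl⟩

variable (σ) in
theorem moveCone_one : moveCone φ 1 σ = σ := by
  ext X
  simp [mem_moveCone, act_one]

theorem moveCone_inv {g : GL (Fin r) (𝓞 E)} (h : moveCone φ g σ = τ) :
    moveCone φ g⁻¹ τ = σ := by
  rw [← h, ← moveCone_mul, inv_mul_cancel, moveCone_one]

theorem moveCone_trans {ρ : PointedCone ℝ (Matrix (Fin r) (Fin r) ℂ)} {g h : GL (Fin r) (𝓞 E)}
    (hg : moveCone φ g σ = τ) (hh : moveCone φ h τ = ρ) : moveCone φ (h * g) σ = ρ := by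
  rw [moveCone_mul, hg, hh]

theorem isFaceOf_moveCone (g : GL (Fin r) (𝓞 E)) (h : τ.IsFaceOf σ) :
    (moveCone φ g τ).IsFaceOf (moveCone φ g σ) :=
  h.map_equiv (act φ g)

theorem spanEquiv_apply {g : GL (Fin r) (𝓞 E)} (h : moveCone φ g σ = τ) (x : linSpan σ) :
    (spanEquiv φ h x : Matrix (Fin r) (Fin r) ℂ) = act φ g x := rfl

theorem finrank_moveCone {g : GL (Fin r) (𝓞 E)} (h : moveCone φ g σ = τ) :
    Module.finrank ℝ (linSpan τ) = Module.finrank ℝ (linSpan σ) :=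
  (spanEquiv φ h).finrank_eq.symm

theorem IsPrimitive.mulVec {v : Fin r → 𝓞 E} (h : IsPrimitive v) (g : GL (Fin r) (𝓞 E)) :
    IsPrimitive (g.val.mulVec v) := by
  obtain ⟨ξ, hξ⟩ := h
  refine ⟨ξ ∘ₗ (g⁻¹).val.mulVecLin, ?_⟩
  rw [LinearMap.comp_apply, Matrix.mulVecLin_apply, Matrix.mulVec_mulVec, Units.inv_mul,
    Matrix.one_mulVec, hξ]

theorem inv_mulVec_mulVec (g : GL (Fin r) (𝓞 E)) (v : Fin r → 𝓞 E) :
    (g⁻¹).val.mulVec (g.val.mulVec v) = v := by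
  rw [Matrix.mulVec_mulVec, Units.inv_mul, Matrix.one_mulVec]

theorem mulVec_mem_coneVectors {g : GL (Fin r) (𝓞 E)} (h : moveCone φ g σ = τ)
    {v : Fin r → 𝓞 E} (hv : v ∈ coneVectors φ σ) : g.val.mulVec v ∈ coneVectors φ τ := by
  subst h
  refine ⟨hv.1.mulVec g, ?_⟩
  rw [← act_rankOne]
  exact act_mem_moveCone hv.2

theorem exists_mulVec_eq {g : GL (Fin r) (𝓞 E)} (h : moveCone φ g σ = τ)
    {w : Fin r → 𝓞 E} (hw : w ∈ coneVectors φ τ) :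
    ∃ v ∈ coneVectors φ σ, g.val.mulVec v = w := by
  refine ⟨(g⁻¹).val.mulVec w, mulVec_mem_coneVectors (moveCone_inv h) hw, ?_⟩
  have := inv_mulVec_mulVec g⁻¹ w
  rwa [inv_inv] at this

theorem coneVectors_moveCone {g : GL (Fin r) (𝓞 E)} (h : moveCone φ g σ = τ) :
    coneVectors φ τ = (fun v => g.val.mulVec v) '' coneVectors φ σ := by
  ext w
  constructor
  · intro hw
    obtain ⟨v, hv, rfl⟩ := exists_mulVec_eq h hw
    exact ⟨v, hv, rfl⟩
  · rintro ⟨v, hv, rfl⟩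
    exact mulVec_mem_coneVectors h hv

/-- The minimal vectors of `w ↦ A (g⁻¹ w)` are the images under `g` of those of `A`. -/
theorem perfectCone_pullForm (A : Matrix (Fin r) (Fin r) ℂ) (g : GL (Fin r) (𝓞 E)) :
    moveCone φ g (perfectCone φ A) =
      perfectCone φ (pullForm A (glToComplex φ g⁻¹).val) := by
  have hval : ∀ w : Fin r → 𝓞 E, formValue φ (pullForm A (glToComplex φ g⁻¹).val) w =
      formValue φ A ((g⁻¹).val.mulVec w) := fun w => by
    rw [formValue_eq_hermVal, hermVal_pullForm, glToComplex_mulVec]; rfl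
  have hmin : minVectors φ (pullForm A (glToComplex φ g⁻¹).val) =
      (fun v => g.val.mulVec v) '' minVectors φ A := by
    have hne : ∀ (k : GL (Fin r) (𝓞 E)) (w : Fin r → 𝓞 E), w ≠ 0 → k.val.mulVec w ≠ 0 := by
      intro k w hw h
      have := inv_mulVec_mulVec k w
      rw [h, Matrix.mulVec_zero] at this
      exact hw this.symm
    ext w
    constructor
    · rintro ⟨hw, h⟩
      refine ⟨(g⁻¹).val.mulVec w, ⟨hne _ _ hw, fun x hx => ?_⟩, ?_⟩
      · have := h _ (hne g x hx)
        rwa [hval, hval, inv_mulVec_mulVec] at this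
      · have := inv_mulVec_mulVec g⁻¹ w
        rwa [inv_inv] at this
    · rintro ⟨v, ⟨hv, h⟩, rfl⟩
      refine ⟨hne _ _ hv, fun x hx => ?_⟩
      rw [hval, hval, inv_mulVec_mulVec]
      exact h _ (hne _ _ hx)
  rw [perfectCone, perfectCone, hmin, Set.image_image]
  simp only [← act_rankOne]
  rw [← Set.image_image (fun X => act φ g X)]
  exact Submodule.map_span _ _

theorem posDef_pullForm {A : Matrix (Fin r) (Fin r) ℂ} (hA : A.PosDef)
    (k : GL (Fin r) (𝓞 E)) : (pullForm A (glToComplex φ k).val).PosDef := by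
  rw [posDef_iff_hermVal] at hA ⊢
  refine ⟨isHermitian_pullForm hA.1 _, fun x hx => ?_⟩
  rw [hermVal_pullForm]
  refine hA.2 _ fun h => hx ?_
  have h1 : (glToComplex φ k)⁻¹.val.mulVec ((glToComplex φ k).val.mulVec x) = x := by
    rw [Matrix.mulVec_mulVec, Units.inv_mul, Matrix.one_mulVec]
  rw [← h1, h, Matrix.mulVec_zero]

theorem IsHermitianPerfectCone.moveCone {g : GL (Fin r) (𝓞 E)}
    (h : moveCone φ g σ = τ) (hσ : IsHermitianPerfectCone φ σ) : IsHermitianPerfectCone φ τ := by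
  subst h
  rcases hσ with rfl | ⟨A, hA, rfl⟩
  · left
    rw [eq_bot_iff]
    intro X hX
    obtain ⟨Y, hY, rfl⟩ := mem_moveCone.1 hX
    rw [(Submodule.mem_bot _).1 hY, map_zero]
    exact zero_mem _
  · exact Or.inr ⟨_, posDef_pullForm hA _, perfectCone_pullForm A g⟩

/-- A stabilizer `k` of `τ` corresponds to `g⁻¹ k g` stabilizing `σ`, and conjugation preserves
determinants. -/
theorem IsAlternating.moveCone {g : GL (Fin r) (𝓞 E)}
    (h : moveCone φ g σ = τ) (hσ : IsAlternating φ σ) : IsAlternating φ τ := by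
  intro k hk
  have h1 := moveCone_inv h
  have h2 := moveCone_trans (moveCone_trans h hk) h1
  have h3 := hσ _ h2
  have h4 : (spanEquiv φ hk : linSpan τ →ₗ[ℝ] linSpan τ) =
      (spanEquiv φ h : linSpan σ →ₗ[ℝ] linSpan τ) ∘ₗ
        (spanEquiv φ h2 : linSpan σ →ₗ[ℝ] linSpan σ) ∘ₗ
          ((spanEquiv φ h).symm : linSpan τ →ₗ[ℝ] linSpan σ) := by
    ext x : 2
    obtain ⟨y, rfl⟩ := (spanEquiv φ h).surjective x
    simp only [LinearMap.comp_apply, LinearEquiv.coe_coe, LinearEquiv.symm_apply_apply,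
      spanEquiv_apply]
    rw [← act_mul, ← act_mul]
    congr 2
    group
  rw [h4, LinearMap.det_conj]
  exact h3

theorem coneRank_moveCone {g : GL (Fin r) (𝓞 E)} (h : moveCone φ g σ = τ) :
    coneRank τ = coneRank σ := by
  subst h
  rw [coneRank, coneRank]
  congr 1
  ext k
  have hrank : ∀ X, (act φ g X).rank = X.rank := fun X => by
    have h1 : IsUnit (glToComplex φ g).val.det :=
      (Matrix.isUnit_iff_isUnit_det _).1 (glToComplex φ g).isUnit
    rw [act_apply, Matrix.rank_mul_eq_left_of_isUnit_det, Matrix.rank_mul_eq_right_of_isUnit_det _ _ h1]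
    rw [Matrix.det_conjTranspose]
    exact h1.star
  constructor
  · rintro ⟨X, hX, rfl⟩
    obtain ⟨Y, hY, rfl⟩ := mem_moveCone.1 hX
    exact ⟨Y, hY, (hrank Y).symm⟩
  · rintro ⟨X, hX, rfl⟩
    exact ⟨_, act_mem_moveCone hX, hrank X⟩

theorem exists_gl_of_linearEquiv (e : (Fin r → 𝓞 E) ≃ₗ[𝓞 E] (Fin r → 𝓞 E)) :
    ∃ g : GL (Fin r) (𝓞 E), ∀ v, g.val.mulVec v = e v := by
  refine ⟨⟨LinearMap.toMatrix' e.toLinearMap, LinearMap.toMatrix' e.symm.toLinearMap, ?_, ?_⟩,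
    fun v => ?_⟩
  · rw [← LinearMap.toMatrix'_comp]; simp
  · rw [← LinearMap.toMatrix'_comp]; simp
  · change (LinearMap.toMatrix' e.toLinearMap).mulVec v = e v
    rw [LinearMap.toMatrix'_mulVec]; rfl

end Action

/-! ### Unimodular vectors over a principal ideal domain -/

section Unimodular

open Module

variable {R V : Type*} [CommRing R] [AddCommGroup V] [Module R V]

/-- A functional taking the value `1` at `x` splits the module as `R x ⊕ ker ξ`. -/
def splitEquiv {ξ : V →ₗ[R] R} {x : V} (h : ξ x = 1) : (R × LinearMap.ker ξ) ≃ₗ[R] V where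
  toFun p := p.1 • x + p.2
  map_add' p q := by simp only [Prod.fst_add, Prod.snd_add, Submodule.coe_add, add_smul]; abel
  map_smul' c p := by simp [mul_smul]
  invFun y := (ξ y, ⟨y - ξ y • x, by simp [h]⟩)
  left_inv p := by
    have hp : ξ (p.2 : V) = 0 := p.2.2
    ext <;> simp [h, hp]
  right_inv y := by simp

theorem splitEquiv_apply {ξ : V →ₗ[R] R} {x : V} (h : ξ x = 1) (p : R × LinearMap.ker ξ) :
    splitEquiv h p = p.1 • x + p.2 := rfl

variable [IsDomain R] [IsPrincipalIdealRing R] [Module.Free R V] [Module.Finite R V]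

theorem free_submodule (A : Submodule R V) : Module.Free R A := inferInstance

/-- A unimodular vector is a member of a basis whose other members span the kernel of the
functional. -/
theorem exists_basis_of_functional {r : ℕ} {ξ : (Fin r → R) →ₗ[R] R} {x : Fin r → R}
    (h : ξ x = 1) : ∃ (b : Basis (Fin r) R (Fin r → R)) (i : Fin r), b i = x ∧
      ∀ y, ξ y = 0 → y ∈ Submodule.span R (b '' {j | j ≠ i}) := by
  let bN := Module.Free.chooseBasis R (LinearMap.ker ξ)
  let b₀ := (((Basis.singleton Unit R).prod bN).map (splitEquiv h))
  let e := b₀.indexEquiv (Pi.basisFun R (Fin r))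
  let b := b₀.reindex e
  have hb0 : b₀ (Sum.inl ()) = x := by
    simp [b₀, splitEquiv_apply]
  have hb1 : ∀ j, ξ (b₀ (Sum.inr j)) = 0 := fun j => by
    have : b₀ (Sum.inr j) = ((bN j : LinearMap.ker ξ) : Fin r → R) := by
      simp [b₀, splitEquiv_apply]
    rw [this]
    exact (bN j).2
  refine ⟨b, e (Sum.inl ()), by simp [b, hb0], fun y hy => ?_⟩
  -- The coordinate at `x` is `ξ` itself, so `ker ξ` is spanned by the remaining basis vectors.
  have hcoord : b.coord (e (Sum.inl ())) = ξ := by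
    refine b.ext fun j => ?_
    obtain ⟨k, rfl⟩ := e.surjective j
    have hbe : b (e k) = b₀ k := by simp [b]
    rw [Basis.coord_apply, b.repr_self]
    rcases k with k | k
    · rw [hbe, hb0, h]; simp
    · rw [hbe, hb1]; simp
  rw [b.mem_span_image]
  intro j hj hji
  subst hji
  have h1 : b.coord (e (Sum.inl ())) y ≠ 0 := Finsupp.mem_support_iff.1 hj
  rw [hcoord] at h1
  exact h1 hy

/-- Both `ker ξ` and `ker η` are free complements of a line in `V`, hence of equal rank and
isomorphic. -/
theorem exists_equiv_apply_eq {ξ η : V →ₗ[R] R} {x y : V} (hx : ξ x = 1) (hy : η y = 1) :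
    ∃ e : V ≃ₗ[R] V, e x = y := by
  have h1 : finrank R V = 1 + finrank R (LinearMap.ker ξ) := by
    rw [← (splitEquiv hx).finrank_eq, finrank_prod, finrank_self]
  have h2 : finrank R V = 1 + finrank R (LinearMap.ker η) := by
    rw [← (splitEquiv hy).finrank_eq, finrank_prod, finrank_self]
  let k : LinearMap.ker ξ ≃ₗ[R] LinearMap.ker η := LinearEquiv.ofFinrankEq _ _ (by omega)
  refine ⟨(splitEquiv hx).symm.trans ((LinearEquiv.prodCongr (LinearEquiv.refl R R) k).trans
    (splitEquiv hy)), ?_⟩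
  have : (splitEquiv hx).symm x = (1, 0) := by
    rw [LinearEquiv.symm_apply_eq, splitEquiv_apply]; simp
  rw [LinearEquiv.trans_apply, this, LinearEquiv.trans_apply, splitEquiv_apply]
  simp

/-- Two vectors that are complementary to a set `S` are conjugate under an automorphism that fixes
`S`. -/
theorem exists_equiv_fixing {S : Set V} {ξ η : V →ₗ[R] R} {x y : V} (hx : ξ x = 1) (hy : η y = 1)
    (hξ : ∀ s ∈ S, ξ s = 0) (hη : ∀ s ∈ S, η s = 0) :
    ∃ e : V ≃ₗ[R] V, (∀ s ∈ S, e s = s) ∧ e x = y := by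
  -- the quotient of `V` by the saturation of the span of `S`
  let A : Submodule R (Dual R V) := ⨅ s ∈ S, LinearMap.ker (Dual.eval R V s)
  have hA : ∀ ζ : Dual R V, ζ ∈ A ↔ ∀ s ∈ S, ζ s = 0 := fun ζ => by
    simp [A, Submodule.mem_iInf]
  let T₀ : V →ₗ[R] Dual R A := A.subtype.dualMap ∘ₗ Dual.eval R V
  have hT₀ : ∀ (v : V) (ζ : A), T₀ v ζ = (ζ : Dual R V) v := fun v ζ => rfl
  let Q := LinearMap.range T₀
  let T : V →ₗ[R] Q := T₀.rangeRestrict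
  have hTsurj : Function.Surjective T := T₀.surjective_rangeRestrict
  have hT : ∀ (v : V) (ζ : A), (T v : Dual R A) ζ = (ζ : Dual R V) v := fun v ζ => rfl
  have hTS : ∀ s ∈ S, T s = 0 := fun s hs => by
    ext ζ
    rw [hT]
    exact (hA _).1 ζ.2 s hs
  have : Module.Free R A := free_submodule A
  have : Module.Free R Q := free_submodule Q
  obtain ⟨s, hs⟩ := Module.projective_lifting_property T LinearMap.id hTsurj
  have hs' : ∀ q, T (s q) = q := fun q => LinearMap.congr_fun hs q
  -- Functionals vanishing on `S` factor through the free module `Q`. There `T x` and `T y` are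
  -- still unimodular, so some automorphism `e` of `Q` maps one to the other.
  let ev : A → (Q →ₗ[R] R) := fun ζ => (Dual.eval R A ζ) ∘ₗ Q.subtype
  have hev : ∀ (ζ : A) (v : V), ev ζ (T v) = (ζ : Dual R V) v := fun ζ v => rfl
  obtain ⟨e, he⟩ := exists_equiv_apply_eq (ξ := ev ⟨ξ, (hA ξ).2 hξ⟩) (η := ev ⟨η, (hA η).2 hη⟩)
    (x := T x) (y := T y) (by rw [hev]; exact hx) (by rw [hev]; exact hy)
  -- `f` lifts `e` along the splitting `s` of `T` and is the identity on `ker T`, which contains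
  -- `S`.
  let f : V ≃ₗ[R] V :=
    LinearEquiv.ofLinearMap (LinearMap.id - s ∘ₗ T + s ∘ₗ e.toLinearMap ∘ₗ T)
      (LinearMap.id - s ∘ₗ T + s ∘ₗ e.symm.toLinearMap ∘ₗ T)
      (by ext v; simp [hs'])
      (by ext v; simp [hs'])
  have hf : ∀ v, f v = v - s (T v) + s (e (T v)) := fun v => rfl
  have hTf : T (f x) = T y := by rw [hf]; simp [hs', he]
  have hηf : η (y - f x) = 0 := by
    have h1 := hev ⟨η, (hA η).2 hη⟩ (y - f x)
    rw [map_sub, hTf, sub_self, map_zero] at h1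
    exact h1.symm
  have hηfx : η (f x) = 1 := by
    rw [map_sub, hy] at hηf
    exact (sub_eq_zero.1 hηf).symm
  -- Now `f x` and `y` agree modulo `ker T`. The transvection `z ↦ z + η z • (y - f x)` corrects the
  -- difference and fixes `S`, because `η` vanishes there.
  refine ⟨f.trans (LinearEquiv.transvection hηf), fun v hv => ?_, ?_⟩
  · have hfv : f v = v := by rw [hf, hTS v hv]; simp
    rw [LinearEquiv.trans_apply, LinearEquiv.transvection.apply, hfv, hη v hv, zero_smul, add_zero]
  · rw [LinearEquiv.trans_apply, LinearEquiv.transvection.apply, hηfx]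
    simp

end Unimodular

/-! ### Coloops of cones -/

section ConeColoops

variable {E : Type*} [Field E] {φ : E →+* ℂ} {r n : ℕ}
  {σ τ ρ : PointedCone ℝ (Matrix (Fin r) (Fin r) ℂ)}

/-- The functional `ξ` exhibits `v` as a coloop of the cone `σ`. -/
structure IsConeColoop (φ : E →+* ℂ) (σ : PointedCone ℝ (Matrix (Fin r) (Fin r) ℂ))
    (v : Fin r → 𝓞 E) (ξ : (Fin r → 𝓞 E) →ₗ[𝓞 E] 𝓞 E) : Prop where
  mem : v ∈ coneVectors φ σ
  apply_self : ξ v = 1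
  apply_other : ∀ w ∈ coneVectors φ σ, ξ w = 0 ∨ ∃ u : (𝓞 E)ˣ, w = (u : 𝓞 E) • v

theorem smul_mem_coneVectors (hφ : IsDiscreteEmbedding φ) {v : Fin r → 𝓞 E}
    (hv : v ∈ coneVectors φ σ) (u : (𝓞 E)ˣ) : (u : 𝓞 E) • v ∈ coneVectors φ σ :=
  ⟨hv.1.smul_unit u, by rw [rankOne_unit_smul hφ u.isUnit]; exact hv.2⟩

section Transversal

variable {R : Type*} [CommRing R]

/-- Orbit representatives under the units are chosen arbitrarily, except that `v` represents its own
orbit. -/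
theorem exists_isUnitTransversal {M : Set (Fin r → R)} (hM : ∀ v ∈ M, ∀ u : Rˣ, u • v ∈ M)
    {v : Fin r → R} (hv : v ∈ M) :
    ∃ M', IsUnitTransversal M' M ∧ v ∈ M' := by
  classical
  let f : MulAction.orbitRel.Quotient Rˣ (Fin r → R) → (Fin r → R) := fun q =>
    if q = Quotient.mk'' v then v else q.out
  have hf : ∀ q, Quotient.mk'' (f q) = q := fun q => by
    by_cases h : q = Quotient.mk'' v
    · subst h; simp [f]
    · simp only [f, if_neg h]
      exact Quotient.out_eq' q
  refine ⟨{w | w ∈ M ∧ w = f (Quotient.mk'' w)}, ⟨fun w hw => hw.1, fun x hx => ?_⟩, hv, ?_⟩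
  · have h1 : (Quotient.mk'' (f (Quotient.mk'' x)) : MulAction.orbitRel.Quotient Rˣ (Fin r → R)) =
        Quotient.mk'' x := hf _
    obtain ⟨u, hu⟩ := MulAction.orbitRel_apply.1 (Quotient.eq''.1 h1)
    refine ⟨f (Quotient.mk'' x), ⟨⟨?_, ?_⟩, u, hu.symm⟩, ?_⟩
    · rw [← hu]; exact hM x hx u
    · rw [h1]
    · rintro s ⟨⟨-, hs⟩, u', hu'⟩
      rw [hs]
      congr 1
      exact Quotient.eq''.2 (MulAction.orbitRel_apply.2 ⟨u', hu'.symm⟩)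
  · simp only [f, if_pos]

end Transversal

namespace IsConeColoop

variable {v : Fin r → 𝓞 E} {ξ : (Fin r → 𝓞 E) →ₗ[𝓞 E] 𝓞 E}

theorem moveCone {g : GL (Fin r) (𝓞 E)} (h : moveCone φ g σ = τ) (hc : IsConeColoop φ σ v ξ) :
    IsConeColoop φ τ (g.val.mulVec v) (ξ ∘ₗ (g⁻¹).val.mulVecLin) where
  mem := mulVec_mem_coneVectors h hc.mem
  apply_self := by
    rw [LinearMap.comp_apply, Matrix.mulVecLin_apply, inv_mulVec_mulVec, hc.apply_self]
  apply_other w hw := by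
    obtain ⟨w, hw', rfl⟩ := exists_mulVec_eq h hw
    rw [LinearMap.comp_apply, Matrix.mulVecLin_apply, inv_mulVec_mulVec]
    refine (hc.apply_other w hw').imp id ?_
    rintro ⟨u, rfl⟩
    exact ⟨u, Matrix.mulVec_smul _ _ _⟩

theorem of_face (hc : IsConeColoop φ σ v ξ) (h : τ ≤ σ) (hv : v ∈ coneVectors φ τ) :
    IsConeColoop φ τ v ξ :=
  ⟨hv, hc.apply_self, fun w hw => hc.apply_other w (coneVectors_mono h hw)⟩

end IsConeColoop

/-- The face of `σ` spanned by the vectors on which the functional `ξ` vanishes. -/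
noncomputable def deflate (φ : E →+* ℂ) (σ : PointedCone ℝ (Matrix (Fin r) (Fin r) ℂ))
    (ξ : (Fin r → 𝓞 E) →ₗ[𝓞 E] 𝓞 E) : PointedCone ℝ (Matrix (Fin r) (Fin r) ℂ) :=
  zeroFace σ (evalAt (dualVec φ ξ))

theorem coneVectors_deflate (ξ : (Fin r → 𝓞 E) →ₗ[𝓞 E] 𝓞 E) :
    coneVectors φ (deflate φ σ ξ) = {w ∈ coneVectors φ σ | ξ w = 0} := by
  ext w
  have h : evalAt (dualVec φ ξ) (rankOne φ w) = 0 ↔ ξ w = 0 := by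
    rw [evalAt_dualVec_rankOne, sq_eq_zero_iff, norm_eq_zero, map_coe_eq_zero]
  constructor
  · rintro ⟨h1, h2, h3⟩
    exact ⟨⟨h1, h2⟩, h.1 h3⟩
  · rintro ⟨⟨h1, h2⟩, h3⟩
    exact ⟨h1, h2, h.2 h3⟩

namespace IsConeColoop

variable {v : Fin r → 𝓞 E} {ξ : (Fin r → 𝓞 E) →ₗ[𝓞 E] 𝓞 E}

theorem evalAt_eq_one (hφ : IsDiscreteEmbedding φ) (hc : IsConeColoop φ σ v ξ) :
    evalAt (dualVec φ ξ) (rankOne φ v) = 1 := by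
  rw [evalAt_dualVec_rankOne, hc.apply_self, (hφ.norm_eq_one_iff 1).2 isUnit_one, one_pow]

theorem evalAt_eq_zero_of_mem {X : Matrix (Fin r) (Fin r) ℂ}
    (hX : X ∈ linSpan (deflate φ σ ξ)) : evalAt (dualVec φ ξ) X = 0 := by
  have : linSpan (deflate φ σ ξ) ≤ LinearMap.ker (evalAt (dualVec φ ξ)) :=
    Submodule.span_le.2 fun Y hY => hY.2
  exact this hX

theorem rankOne_mem (hc : IsConeColoop φ σ v ξ) : rankOne φ v ∈ linSpan σ :=
  Submodule.subset_span hc.mem.2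

end IsConeColoop

variable [IsPrincipalIdealRing (𝓞 E)]

/-- Trades the transversal and the basis for one functional: the coordinate functional of the coloop
in one direction, completion of a unimodular vector to a basis in the other. -/
theorem hasColoop_iff (hφ : IsDiscreteEmbedding φ) (hσ : IsHermitianPerfectCone φ σ) :
    HasColoop φ σ ↔ ∃ v ξ, IsConeColoop φ σ v ξ := by
  constructor
  · rintro ⟨A, hA, rfl, M', hM', v, hv, b, i, rfl, hb⟩
    have hcv := coneVectors_perfectCone hφ hA
    refine ⟨b i, b.coord i, ?_, by simp, fun w hw => ?_⟩
    · rw [hcv]; exact hM'.1 hv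
    · rw [hcv] at hw
      obtain ⟨s, ⟨hs, u, rfl⟩, -⟩ := hM'.2 w hw
      by_cases hsv : u • w = b i
      · right
        refine ⟨u⁻¹, ?_⟩
        rw [← hsv, ← Units.smul_def, inv_smul_smul]
      · left
        have h1 := hb _ hs hsv
        have h2 : Submodule.span (𝓞 E) (b '' {j | j ≠ i}) ≤ LinearMap.ker (b.coord i) := by
          rw [Submodule.span_le]
          rintro _ ⟨j, hj, rfl⟩
          simpa [Finsupp.single_apply] using hj
        have h3 : b.coord i (u • w) = 0 := h2 h1
        rw [Units.smul_def, map_smul, smul_eq_mul, mul_eq_zero] at h3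
        exact h3.resolve_left u.ne_zero
  · rintro ⟨v, ξ, hc⟩
    rcases hσ with rfl | ⟨A, hA, rfl⟩
    · have := hc.mem
      rw [coneVectors_bot] at this
      exact this.elim
    have hcv := coneVectors_perfectCone hφ hA
    obtain ⟨M', hM', hvM'⟩ := exists_isUnitTransversal (M := minVectors φ A) (fun w hw u => by
      rw [← hcv] at hw ⊢
      exact smul_mem_coneVectors hφ hw u) (hcv ▸ hc.mem)
    refine ⟨A, hA, rfl, M', hM', v, hvM', ?_⟩
    obtain ⟨b, i, hbi, hb⟩ := exists_basis_of_functional hc.apply_self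
    refine ⟨b, i, hbi, fun w hw hwv => hb w ?_⟩
    have hwM := hM'.1 hw
    rw [← hcv] at hwM
    refine (hc.apply_other w hwM).resolve_right ?_
    rintro ⟨u, rfl⟩
    obtain ⟨s, -, hs⟩ := hM'.2 v (hcv ▸ hc.mem)
    exact hwv ((hs _ ⟨hw, u, rfl⟩).trans (hs _ ⟨hvM', 1, (one_smul _ _).symm⟩).symm)

theorem HasColoop.moveCone (hφ : IsDiscreteEmbedding φ) (hσ : IsHermitianPerfectCone φ σ)
    {g : GL (Fin r) (𝓞 E)} (h : moveCone φ g σ = τ) (hc : HasColoop φ σ) : HasColoop φ τ := by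
  obtain ⟨v, ξ, hc⟩ := (hasColoop_iff hφ hσ).1 hc
  exact (hasColoop_iff hφ (hσ.moveCone h)).2 ⟨_, _, hc.moveCone h⟩

/-! ### Deflation -/

theorem deflate_isFaceOf (hφ : IsDiscreteEmbedding φ) (hσ : IsHermitianPerfectCone φ σ)
    (ξ : (Fin r → 𝓞 E) →ₗ[𝓞 E] 𝓞 E) : (deflate φ σ ξ).IsFaceOf σ :=
  zeroFace_isFaceOf (hσ.evalAt_nonneg hφ _)

theorem deflate_isHermitianPerfectCone (hφ : IsDiscreteEmbedding φ)
    (hσ : IsHermitianPerfectCone φ σ) (ξ : (Fin r → 𝓞 E) →ₗ[𝓞 E] 𝓞 E) :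
    IsHermitianPerfectCone φ (deflate φ σ ξ) :=
  hσ.of_isFaceOf hφ (deflate_isFaceOf hφ hσ ξ)

namespace IsConeColoop

variable {v : Fin r → 𝓞 E} {ξ : (Fin r → 𝓞 E) →ₗ[𝓞 E] 𝓞 E}

/-- A face missing `v` misses all its unit multiples, so `ξ` vanishes on every vector of the face.
-/
theorem face_le_deflate (hφ : IsDiscreteEmbedding φ) (hσ : IsHermitianPerfectCone φ σ)
    (hc : IsConeColoop φ σ v ξ) (hτ : τ.IsFaceOf σ) (hv : v ∉ coneVectors φ τ) :
    τ ≤ deflate φ σ ξ := by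
  rw [(hσ.of_isFaceOf hφ hτ).eq_hull hφ]
  refine Submodule.span_le.2 ?_
  rintro _ ⟨w, hw, rfl⟩
  have h1 : w ∈ coneVectors φ (deflate φ σ ξ) := by
    rw [coneVectors_deflate]
    refine ⟨coneVectors_mono hτ.le hw, (hc.apply_other w (coneVectors_mono hτ.le hw)).resolve_right ?_⟩
    rintro ⟨u, rfl⟩
    have h2 := smul_mem_coneVectors hφ hw u⁻¹
    rw [smul_smul, Units.inv_mul, one_smul] at h2
    exact hv h2
  exact h1.2

theorem linSpan_eq_sup (hφ : IsDiscreteEmbedding φ) (hσ : IsHermitianPerfectCone φ σ)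
    (hc : IsConeColoop φ σ v ξ) :
    linSpan σ ≤ linSpan (deflate φ σ ξ) ⊔ Submodule.span ℝ {rankOne φ v} := by
  rw [hσ.linSpan_eq hφ]
  refine Submodule.span_le.2 ?_
  rintro _ ⟨w, hw, rfl⟩
  rcases hc.apply_other w hw with h | ⟨u, rfl⟩
  · refine Submodule.mem_sup_left (Submodule.subset_span ?_)
    have : w ∈ coneVectors φ (deflate φ σ ξ) := by
      rw [coneVectors_deflate]; exact ⟨hw, h⟩
    exact this.2
  · rw [rankOne_unit_smul hφ u.isUnit]
    exact Submodule.mem_sup_right (Submodule.mem_span_singleton_self _)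

/-- The decomposition `ℝ⟨σ⟩ = ℝ⟨ρ⟩ ⊕ ℝ v v*`, where `ρ` is the deflation of `σ`. -/
theorem exists_decomposition (hφ : IsDiscreteEmbedding φ) (hσ : IsHermitianPerfectCone φ σ)
    (hc : IsConeColoop φ σ v ξ) :
    ∃ e : (linSpan (deflate φ σ ξ) × ℝ) ≃ₗ[ℝ] linSpan σ,
      ∀ p, (e p : Matrix (Fin r) (Fin r) ℂ) = p.1 + p.2 • rankOne φ v := by
  let f : (linSpan (deflate φ σ ξ) × ℝ) →ₗ[ℝ] linSpan σ :=
    LinearMap.coprod (Submodule.inclusion (linSpan_mono (deflate_isFaceOf hφ hσ ξ).le))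
      (LinearMap.toSpanSingleton ℝ _ ⟨rankOne φ v, hc.rankOne_mem⟩)
  have hf : ∀ p, (f p : Matrix (Fin r) (Fin r) ℂ) = p.1 + p.2 • rankOne φ v := fun p => by
    simp [f]
  refine ⟨LinearEquiv.ofBijective f ⟨?_, ?_⟩, hf⟩
  · rw [← LinearMap.ker_eq_bot, LinearMap.ker_eq_bot']
    intro p hp
    have h1 : (p.1 : Matrix (Fin r) (Fin r) ℂ) + p.2 • rankOne φ v = 0 := by
      rw [← hf, hp]; rfl
    -- This functional is `0` on the span of the deflation and `1` at `v v*`, so the sum is direct.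
    have h2 := congrArg (evalAt (dualVec φ ξ)) h1
    rw [map_add, map_smul, evalAt_eq_zero_of_mem p.1.2, hc.evalAt_eq_one hφ, map_zero] at h2
    have h3 : p.2 = 0 := by simpa using h2
    rw [h3, zero_smul, add_zero] at h1
    exact Prod.ext (Subtype.ext h1) h3
  · rintro ⟨X, hX⟩
    obtain ⟨Y, hY, Z, hZ, rfl⟩ := Submodule.mem_sup.1 (hc.linSpan_eq_sup hφ hσ hX)
    obtain ⟨t, rfl⟩ := Submodule.mem_span_singleton.1 hZ
    exact ⟨(⟨Y, hY⟩, t), Subtype.ext (hf _)⟩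

theorem finrank_deflate (hφ : IsDiscreteEmbedding φ) (hσ : IsHermitianPerfectCone φ σ)
    (hc : IsConeColoop φ σ v ξ) :
    Module.finrank ℝ (linSpan σ) = Module.finrank ℝ (linSpan (deflate φ σ ξ)) + 1 := by
  obtain ⟨e, -⟩ := hc.exists_decomposition hφ hσ
  rw [← e.finrank_eq, Module.finrank_prod, Module.finrank_self]

/-- A facet of a cone with a coloop `v` is the deflation or contains `v`. -/
theorem facet_eq_deflate (hφ : IsDiscreteEmbedding φ) (hσ : IsHermitianPerfectCone φ σ)
    (hc : IsConeColoop φ σ v ξ) (hτ : τ.IsFaceOf σ)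
    (hn : Module.finrank ℝ (linSpan σ) = Module.finrank ℝ (linSpan τ) + 1)
    (hv : v ∉ coneVectors φ τ) : τ = deflate φ σ ξ := by
  refine face_eq_of_finrank_eq hτ (deflate_isFaceOf hφ hσ ξ) (hc.face_le_deflate hφ hσ hτ hv) ?_
  have := hc.finrank_deflate hφ hσ
  rw [hn] at this
  exact Nat.add_right_cancel this

/-- An automorphism of `σ` that fixes `v v*` has the same determinant on `σ` and on the
deflation. -/
theorem det_eq (hφ : IsDiscreteEmbedding φ) (hσ : IsHermitianPerfectCone φ σ)
    (hc : IsConeColoop φ σ v ξ) {g k : GL (Fin r) (𝓞 E)} (hg : HermitianPerfectCone.moveCone φ g σ = σ)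
    (hk : HermitianPerfectCone.moveCone φ k (deflate φ σ ξ) = deflate φ σ ξ)
    (hgk : ∀ w ∈ coneVectors φ (deflate φ σ ξ), g.val.mulVec w = k.val.mulVec w)
    (hv : act φ g (rankOne φ v) = rankOne φ v) :
    LinearMap.det (spanEquiv φ hg : linSpan σ →ₗ[ℝ] linSpan σ) =
      LinearMap.det (spanEquiv φ hk : linSpan (deflate φ σ ξ) →ₗ[ℝ] linSpan (deflate φ σ ξ)) := by
  obtain ⟨e, he⟩ := hc.exists_decomposition hφ hσ
  have hact : ∀ X ∈ linSpan (deflate φ σ ξ), act φ g X = act φ k X := by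
    rw [(deflate_isHermitianPerfectCone hφ hσ ξ).linSpan_eq hφ]
    intro X hX
    refine LinearMap.eqOn_span (f := (act φ g).toLinearMap) (g := (act φ k).toLinearMap) ?_ hX
    rintro _ ⟨w, hw, rfl⟩
    change act φ g _ = act φ k _
    rw [act_rankOne, act_rankOne, hgk w hw]
  -- In the decomposition the action is block diagonal: that of `k` on the deflation and the
  -- identity on the line of `v v*`.
  have h1 : (spanEquiv φ hg : linSpan σ →ₗ[ℝ] linSpan σ) =
      (e : _ →ₗ[ℝ] linSpan σ) ∘ₗ (LinearMap.prodMap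
        (spanEquiv φ hk : linSpan (deflate φ σ ξ) →ₗ[ℝ] linSpan (deflate φ σ ξ))
        (LinearMap.id : ℝ →ₗ[ℝ] ℝ)) ∘ₗ (e.symm : linSpan σ →ₗ[ℝ] _) := by
    ext x : 2
    obtain ⟨p, rfl⟩ := e.surjective x
    simp only [LinearMap.comp_apply, LinearEquiv.coe_coe, LinearEquiv.symm_apply_apply,
      spanEquiv_apply, he, LinearMap.prodMap_apply, LinearMap.id_apply]
    rw [map_add, map_smul, hv, hact _ p.1.2]
  rw [h1, LinearMap.det_conj, LinearMap.det_prodMap, LinearMap.det_id, mul_one]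

/-- Two different coloops of a cone can be swapped, so an alternating cone has at most one. -/
theorem unique (hφ : IsDiscreteEmbedding φ) (hσ : IsHermitianPerfectCone φ σ)
    (halt : IsAlternating φ σ) {w : Fin r → 𝓞 E} {η : (Fin r → 𝓞 E) →ₗ[𝓞 E] 𝓞 E}
    (hv : IsConeColoop φ σ v ξ) (hw : IsConeColoop φ σ w η) :
    ∃ u : (𝓞 E)ˣ, w = (u : 𝓞 E) • v := by
  by_contra hne
  have hne' : ¬ ∃ u : (𝓞 E)ˣ, v = (u : 𝓞 E) • w := by
    rintro ⟨u, rfl⟩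
    exact hne ⟨u⁻¹, by rw [smul_smul, Units.inv_mul, one_smul]⟩
  have hξw : ξ w = 0 := (hv.apply_other w hw.mem).resolve_right hne
  have hηv : η v = 0 := (hw.apply_other v hv.mem).resolve_right hne'
  have h2 : (ξ - η) (v - w) = 2 := by
    simp only [LinearMap.sub_apply, map_sub, hv.apply_self, hw.apply_self, hξw, hηv]; ring
  -- As `ξ - η` takes the value `2` at `v - w`, the reflection is defined over `R`. It exchanges `v`
  -- and `w` and fixes the vectors of `σ` killed by both functionals.
  obtain ⟨g, hg⟩ := exists_gl_of_linearEquiv (Module.reflection h2)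
  have hg' : ∀ x, g.val.mulVec x = x - (ξ x - η x) • (v - w) := fun x => by
    rw [hg, Module.reflection_apply]; rfl
  have hgv : g.val.mulVec v = w := by rw [hg', hv.apply_self, hηv]; simp
  have hgw : g.val.mulVec w = v := by rw [hg', hw.apply_self, hξw]; simp
  have hcases : ∀ x ∈ coneVectors φ σ, (∃ u : (𝓞 E)ˣ, x = (u : 𝓞 E) • v) ∨
      (∃ u : (𝓞 E)ˣ, x = (u : 𝓞 E) • w) ∨ (ξ x = 0 ∧ η x = 0) := fun x hx => by
    rcases hv.apply_other x hx with h | h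
    · rcases hw.apply_other x hx with h' | h'
      · exact Or.inr (Or.inr ⟨h, h'⟩)
      · exact Or.inr (Or.inl h')
    · exact Or.inl h
  have hmaps : ∀ x ∈ coneVectors φ σ, g.val.mulVec x ∈ coneVectors φ σ := by
    intro x hx
    rcases hcases x hx with ⟨u, rfl⟩ | ⟨u, rfl⟩ | ⟨h, h'⟩
    · rw [Matrix.mulVec_smul, hgv]; exact smul_mem_coneVectors hφ hw.mem u
    · rw [Matrix.mulVec_smul, hgw]; exact smul_mem_coneVectors hφ hv.mem u
    · rw [hg', h, h']; simpa using hx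
  have hinvol : ∀ x, g.val.mulVec (g.val.mulVec x) = x := fun x => by
    rw [hg, hg]; exact Module.involutive_reflection h2 x
  have hstab : HermitianPerfectCone.moveCone φ g σ = σ := by
    refine (hσ.moveCone rfl).ext hφ hσ ?_
    rw [coneVectors_moveCone rfl]
    refine Set.Subset.antisymm (Set.image_subset_iff.2 hmaps) fun x hx => ?_
    exact ⟨_, hmaps x hx, hinvol x⟩
  let q : linSpan σ →ₗ[ℝ] ℝ :=
    (evalAt (dualVec φ η) - evalAt (dualVec φ ξ)) ∘ₗ (linSpan σ).subtype
  let d : linSpan σ := ⟨rankOne φ v, hv.rankOne_mem⟩ - ⟨rankOne φ w, hw.rankOne_mem⟩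
  have e1 : evalAt (dualVec φ η) (rankOne φ v) = 0 := by rw [evalAt_dualVec_rankOne, hηv]; simp
  have e2 : evalAt (dualVec φ ξ) (rankOne φ w) = 0 := by rw [evalAt_dualVec_rankOne, hξw]; simp
  -- On the span of `σ` the element `g` acts as `X ↦ X + q X • d`; since `q d = -2`, the determinant
  -- is `1 + q d = -1`.
  have hdet : (spanEquiv φ hstab : linSpan σ →ₗ[ℝ] linSpan σ) = LinearMap.transvection q d := by
    have hX : ∀ X ∈ linSpan σ, act φ g X = X + (evalAt (dualVec φ η) X - evalAt (dualVec φ ξ) X) •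
        (rankOne φ v - rankOne φ w) := by
      rw [hσ.linSpan_eq hφ]
      intro X hX
      refine LinearMap.eqOn_span (f := (act φ g).toLinearMap)
        (g := LinearMap.transvection (evalAt (dualVec φ η) - evalAt (dualVec φ ξ))
          (rankOne φ v - rankOne φ w)) ?_ hX
      rintro _ ⟨x, hx, rfl⟩
      rw [LinearMap.transvection.apply, LinearMap.sub_apply]
      change act φ g _ = _
      rw [act_rankOne]
      rcases hcases x hx with ⟨u, rfl⟩ | ⟨u, rfl⟩ | ⟨h, h'⟩
      · rw [Matrix.mulVec_smul, hgv, rankOne_unit_smul hφ u.isUnit, rankOne_unit_smul hφ u.isUnit,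
          e1, hv.evalAt_eq_one hφ]
        simp
      · rw [Matrix.mulVec_smul, hgw, rankOne_unit_smul hφ u.isUnit, rankOne_unit_smul hφ u.isUnit,
          e2, hw.evalAt_eq_one hφ]
        simp
      · rw [hg', h, h', evalAt_dualVec_rankOne, evalAt_dualVec_rankOne, h, h']
        simp
    ext x : 2
    exact hX x x.2
  have hpos := halt g hstab
  rw [hdet, LinearMap.transvection.det] at hpos
  have hq : q d = -2 := by
    change evalAt (dualVec φ η) (rankOne φ v - rankOne φ w) -
      evalAt (dualVec φ ξ) (rankOne φ v - rankOne φ w) = -2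
    rw [map_sub, map_sub, e1, e2, hv.evalAt_eq_one hφ, hw.evalAt_eq_one hφ]
    norm_num
  rw [hq] at hpos
  norm_num at hpos

/-- The deflation of an alternating cone has no coloop. -/
theorem not_isConeColoop_deflate (hφ : IsDiscreteEmbedding φ) (hσ : IsHermitianPerfectCone φ σ)
    (halt : IsAlternating φ σ) (hv : IsConeColoop φ σ v ξ) (w : Fin r → 𝓞 E)
    (η : (Fin r → 𝓞 E) →ₗ[𝓞 E] 𝓞 E) : ¬ IsConeColoop φ (deflate φ σ ξ) w η := by
  intro hw
  have hwmem := hw.mem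
  rw [coneVectors_deflate] at hwmem
  -- The corrected functional kills `v` and agrees with `η` on `ker ξ`, so `w` would be a second
  -- coloop of `σ`. By uniqueness `w = u • v`, contradicting `ξ w = 0`.
  have key : IsConeColoop φ σ w (η - η v • ξ) := by
    refine ⟨hwmem.1, ?_, fun x hx => ?_⟩
    · rw [LinearMap.sub_apply, LinearMap.smul_apply, hwmem.2, hw.apply_self]; simp
    · rcases hv.apply_other x hx with h | ⟨u, rfl⟩
      · rw [LinearMap.sub_apply, LinearMap.smul_apply, h, smul_zero, sub_zero]
        exact hw.apply_other x (by rw [coneVectors_deflate]; exact ⟨hx, h⟩)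
      · left
        simp only [LinearMap.sub_apply, LinearMap.smul_apply, map_smul, hv.apply_self, smul_eq_mul]
        ring
  obtain ⟨u, rfl⟩ := hv.unique hφ hσ halt key
  have h := hwmem.2
  rw [map_smul, hv.apply_self, smul_eq_mul, mul_one] at h
  exact u.ne_zero h

end IsConeColoop

/-- An isomorphism of deflations extends to the cones. -/
theorem exists_gl_extending (hφ : IsDiscreteEmbedding φ) {σ₁ σ₂ : PointedCone ℝ (Matrix (Fin r) (Fin r) ℂ)}
    (h₁ : IsHermitianPerfectCone φ σ₁) (h₂ : IsHermitianPerfectCone φ σ₂)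
    {v₁ v₂ : Fin r → 𝓞 E} {ξ₁ ξ₂ : (Fin r → 𝓞 E) →ₗ[𝓞 E] 𝓞 E}
    (hc₁ : IsConeColoop φ σ₁ v₁ ξ₁) (hc₂ : IsConeColoop φ σ₂ v₂ ξ₂)
    {k : GL (Fin r) (𝓞 E)} (hk : moveCone φ k (deflate φ σ₁ ξ₁) = deflate φ σ₂ ξ₂) :
    ∃ g : GL (Fin r) (𝓞 E), moveCone φ g σ₁ = σ₂ ∧ g.val.mulVec v₁ = v₂ ∧
      ∀ w ∈ coneVectors φ (deflate φ σ₁ ξ₁), g.val.mulVec w = k.val.mulVec w := by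
  -- Both `k v₁` and `v₂` are complementary to the vectors of the second deflation; an automorphism
  -- fixing these vectors and taking `k v₁` to `v₂` corrects `k`.
  obtain ⟨e, heS, hev⟩ := exists_equiv_fixing (S := coneVectors φ (deflate φ σ₂ ξ₂))
    (ξ := ξ₁ ∘ₗ (k⁻¹).val.mulVecLin) (η := ξ₂) (x := k.val.mulVec v₁) (y := v₂)
    (by rw [LinearMap.comp_apply, Matrix.mulVecLin_apply, inv_mulVec_mulVec, hc₁.apply_self])
    hc₂.apply_self
    (by
      intro s hs
      obtain ⟨w, hw, rfl⟩ := exists_mulVec_eq hk hs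
      rw [coneVectors_deflate] at hw
      rw [LinearMap.comp_apply, Matrix.mulVecLin_apply, inv_mulVec_mulVec, hw.2])
    (by
      intro s hs
      rw [coneVectors_deflate] at hs
      exact hs.2)
  obtain ⟨g, hg⟩ := exists_gl_of_linearEquiv e
  have hgk : ∀ w, (g * k).val.mulVec w = e (k.val.mulVec w) := fun w => by
    rw [Units.val_mul, ← Matrix.mulVec_mulVec, hg]
  have hv : (g * k).val.mulVec v₁ = v₂ := by rw [hgk, hev]
  have hS : ∀ w ∈ coneVectors φ (deflate φ σ₁ ξ₁), (g * k).val.mulVec w = k.val.mulVec w :=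
    fun w hw => by rw [hgk, heS _ (mulVec_mem_coneVectors hk hw)]
  refine ⟨g * k, (h₁.moveCone rfl).ext hφ h₂ ?_, hv, hS⟩
  rw [coneVectors_moveCone rfl]
  ext x
  constructor
  · rintro ⟨w, hw, rfl⟩
    rcases hc₁.apply_other w hw with h | ⟨u, rfl⟩
    · have hw' : w ∈ coneVectors φ (deflate φ σ₁ ξ₁) := by
        rw [coneVectors_deflate]; exact ⟨hw, h⟩
      have := mulVec_mem_coneVectors hk hw'
      rw [coneVectors_deflate] at this
      dsimp only
      rw [hS w hw']
      exact this.1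
    · dsimp only
      rw [Matrix.mulVec_smul, hv]
      exact smul_mem_coneVectors hφ hc₂.mem u
  · intro hx
    rcases hc₂.apply_other x hx with h | ⟨u, rfl⟩
    · have hx' : x ∈ coneVectors φ (deflate φ σ₂ ξ₂) := by
        rw [coneVectors_deflate]; exact ⟨hx, h⟩
      obtain ⟨w, hw, rfl⟩ := exists_mulVec_eq hk hx'
      have hw' := hw
      rw [coneVectors_deflate] at hw'
      exact ⟨w, hw'.1, hS w hw⟩
    · exact ⟨(u : 𝓞 E) • v₁, smul_mem_coneVectors hφ hc₁.mem u, by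
        dsimp only
        rw [Matrix.mulVec_smul, hv]⟩

/-- A stabilizer of the deflation extends to a stabilizer of `σ` fixing `v`, with the same
determinant. -/
theorem isAlternating_deflate (hφ : IsDiscreteEmbedding φ)
    (hσ : IsHermitianPerfectCone φ σ) (halt : IsAlternating φ σ) {v : Fin r → 𝓞 E}
    {ξ : (Fin r → 𝓞 E) →ₗ[𝓞 E] 𝓞 E} (hc : IsConeColoop φ σ v ξ) :
    IsAlternating φ (deflate φ σ ξ) := by
  intro k hk
  obtain ⟨g, hg, hgv, hgS⟩ := exists_gl_extending hφ hσ hσ hc hc hk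
  rw [← hc.det_eq hφ hσ hg hk hgS (by rw [act_rankOne, hgv])]
  exact halt g hg

/-- Without coloops in the deflation, `v` is the only coloop of `σ` up to units. So stabilizers of
`σ` fix `v v*` and preserve the deflation, and the determinants agree. -/
theorem isAlternating_of_deflate (hφ : IsDiscreteEmbedding φ)
    (hσ : IsHermitianPerfectCone φ σ) {v : Fin r → 𝓞 E} {ξ : (Fin r → 𝓞 E) →ₗ[𝓞 E] 𝓞 E}
    (hc : IsConeColoop φ σ v ξ) (halt : IsAlternating φ (deflate φ σ ξ))
    (hno : ∀ w η, ¬ IsConeColoop φ (deflate φ σ ξ) w η) : IsAlternating φ σ := by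
  intro g hg
  -- every coloop of `σ` is a unit multiple of `v`
  have huniq : ∀ w η, IsConeColoop φ σ w η → ∃ u : (𝓞 E)ˣ, w = (u : 𝓞 E) • v := by
    intro w η hw
    refine (hc.apply_other w hw.mem).resolve_left fun h => ?_
    exact hno w η (hw.of_face (deflate_isFaceOf hφ hσ ξ).le
      (by rw [coneVectors_deflate]; exact ⟨hw.mem, h⟩))
  have hmaps : ∀ (k : GL (Fin r) (𝓞 E)), moveCone φ k σ = σ →
      ∀ w ∈ coneVectors φ (deflate φ σ ξ), k.val.mulVec w ∈ coneVectors φ (deflate φ σ ξ) := by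
    intro k hk w hw
    rw [coneVectors_deflate] at hw ⊢
    refine ⟨mulVec_mem_coneVectors hk hw.1, ?_⟩
    refine (hc.apply_other _ (mulVec_mem_coneVectors hk hw.1)).resolve_right ?_
    rintro ⟨u, hu⟩
    obtain ⟨u', hu'⟩ := huniq _ _ (hc.moveCone (moveCone_inv hk))
    have h1 := inv_mulVec_mulVec k w
    rw [hu, Matrix.mulVec_smul, hu', smul_smul] at h1
    have h2 := hw.2
    rw [← h1, map_smul, hc.apply_self, smul_eq_mul, mul_one, ← Units.val_mul] at h2
    exact (u * u').ne_zero h2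
  have hρ := deflate_isHermitianPerfectCone hφ hσ ξ
  have hk : moveCone φ g (deflate φ σ ξ) = deflate φ σ ξ := by
    refine (hρ.moveCone rfl).ext hφ hρ ?_
    rw [coneVectors_moveCone rfl]
    refine Set.Subset.antisymm (Set.image_subset_iff.2 (hmaps g hg)) fun x hx => ?_
    refine ⟨_, hmaps g⁻¹ (moveCone_inv hg) x hx, ?_⟩
    have := inv_mulVec_mulVec g⁻¹ x
    rwa [inv_inv] at this
  obtain ⟨u, hu⟩ := huniq _ _ (hc.moveCone hg)
  rw [hc.det_eq hφ hσ hg hk (fun _ _ => rfl)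
    (by rw [act_rankOne, hu, rankOne_unit_smul hφ u.isUnit])]
  exact halt g hk

end ConeColoops

/-! ### Inflation -/

section Inflation

variable {E : Type*} [Field E] {φ : E →+* ℂ} {r : ℕ}
  {σ τ ρ : PointedCone ℝ (Matrix (Fin r) (Fin r) ℂ)}

theorem one_le_formValue_one (hφ : IsDiscreteEmbedding φ) {w : Fin r → 𝓞 E} (hw : w ≠ 0) :
    1 ≤ formValue φ 1 w := by
  obtain ⟨i, hi⟩ := Function.ne_iff.1 hw
  have h1 : formValue φ 1 w = ∑ j, ‖φ (w j)‖ ^ 2 := by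
    rw [formValue_eq_hermVal, hermVal, Matrix.one_mulVec, dotProduct, Complex.re_sum]
    refine Finset.sum_congr rfl fun j _ => ?_
    rw [Pi.star_apply, Complex.star_def, Complex.mul_conj, Complex.ofReal_re,
      Complex.normSq_eq_norm_sq]
    rfl
  rw [h1]
  have h2 := hφ.one_le_norm (w i) hi
  exact (one_le_pow₀ h2).trans (Finset.single_le_sum (f := fun j => ‖φ (w j)‖ ^ 2)
    (fun j _ => sq_nonneg _) (Finset.mem_univ i))

theorem posDef_one : (1 : Matrix (Fin r) (Fin r) ℂ).PosDef := Matrix.PosDef.one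

variable [IsPrincipalIdealRing (𝓞 E)]

theorem exists_form_with_minimum (hφ : IsDiscreteEmbedding φ) (hρ : IsHermitianPerfectCone φ ρ) :
    ∃ (B : Matrix (Fin r) (Fin r) ℂ) (m : ℝ), B.PosDef ∧ 0 < m ∧
      (∀ w : Fin r → 𝓞 E, w ≠ 0 → m ≤ formValue φ B w) ∧
      ∀ w, w ∈ coneVectors φ ρ ↔ w ≠ 0 ∧ formValue φ B w = m := by
  rcases (coneVectors φ ρ).eq_empty_or_nonempty with he | ⟨v₀, hv₀⟩
  -- Without vectors to realize, `m` is put strictly below the minimum of the identity form, so that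
  -- no vector attains it.
  · refine ⟨1, 1 / 2, posDef_one, by norm_num, fun w hw => ?_, fun w => ?_⟩
    · linarith [one_le_formValue_one hφ hw]
    · rw [he]
      refine ⟨fun h => h.elim, fun ⟨h1, h2⟩ => ?_⟩
      linarith [one_le_formValue_one hφ h1]
  · rcases hρ with rfl | ⟨A, hA, rfl⟩
    · rw [coneVectors_bot] at hv₀
      exact hv₀.elim
    rw [coneVectors_perfectCone hφ hA] at hv₀ ⊢
    refine ⟨A, formValue φ A v₀, hA, formValue_pos hA hv₀.1, hv₀.2, fun w => ⟨fun h =>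
      ⟨h.1, le_antisymm (h.2 _ hv₀.1) (hv₀.2 _ h.1)⟩, fun h => ⟨h.1, fun x hx => ?_⟩⟩⟩
    rw [h.2]
    exact hv₀.2 x hx

/-- A cone can be inflated by a vector complementary to it. -/
theorem exists_inflation (hφ : IsDiscreteEmbedding φ) (hρ : IsHermitianPerfectCone φ ρ)
    {v : Fin r → 𝓞 E} {ξ : (Fin r → 𝓞 E) →ₗ[𝓞 E] 𝓞 E} (hξ : ξ v = 1)
    (hker : ∀ w ∈ coneVectors φ ρ, ξ w = 0) :
    ∃ σ, IsHermitianPerfectCone φ σ ∧ IsConeColoop φ σ v ξ ∧ deflate φ σ ξ = ρ := by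
  obtain ⟨B, m, hB, hm, hmin, hmem⟩ := exists_form_with_minimum hφ hρ
  set y := dualVec φ ξ with hy
  -- `N` projects along `v` onto the kernel of `ξ`, so the new form is `B (x - ξ x • v) + m * |ξ
  -- x|²`. At vectors of `R^r` with `ξ w ≠ 0` it is at least `m`, as `‖φ (ξ w)‖ ≥ 1`, with equality
  -- only at unit multiples of `v`; on `ker ξ` it is `B`.
  set N : Matrix (Fin r) (Fin r) ℂ := 1 - Matrix.vecMulVec (toComplex φ v) y with hN
  have hNx : ∀ x, N.mulVec x = x - (y ⬝ᵥ x) • toComplex φ v := fun x => by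
    rw [hN, Matrix.sub_mulVec, Matrix.one_mulVec, Matrix.vecMulVec_mulVec]
    simp
  set A := pullForm B N + m • Matrix.vecMulVec y (star y) with hA
  have hval : ∀ x, hermVal A x = hermVal B (x - (y ⬝ᵥ x) • toComplex φ v) + m * ‖y ⬝ᵥ x‖ ^ 2 :=
    fun x => by
      rw [hA, hermVal_add, hermVal_pullForm, hNx, hermVal_real_smul, hermVal_vecMulVec]
  have hB' := posDef_iff_hermVal.1 hB
  have hB0 : ∀ x, 0 ≤ hermVal B x := fun x => by
    by_cases hx : x = 0
    · rw [hx, hermVal_zero]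
    · exact (hB'.2 x hx).le
  have hApos : A.PosDef := by
    rw [posDef_iff_hermVal]
    refine ⟨(isHermitian_pullForm hB'.1 N).add ?_, fun x hx => ?_⟩
    · ext i j
      simp [Matrix.vecMulVec_apply, mul_comm]
    · rw [hval]
      by_cases hyx : y ⬝ᵥ x = 0
      · rw [hyx, zero_smul, sub_zero]
        have := hB'.2 x hx
        simpa using this
      · have h1 := hB0 (x - (y ⬝ᵥ x) • toComplex φ v)
        have h2 : 0 < ‖y ⬝ᵥ x‖ := norm_pos_iff.2 hyx
        positivity
  have hfv : ∀ w : Fin r → 𝓞 E, formValue φ A w =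
      formValue φ B (w - ξ w • v) + m * ‖φ (ξ w)‖ ^ 2 := fun w => by
    rw [formValue_eq_hermVal, hval, hy, dualVec_dotProduct, formValue_eq_hermVal]
    congr 2
    rw [sub_eq_add_neg w, ← neg_smul, toComplex_add, toComplex_smul, sub_eq_add_neg, ← neg_smul]
    simp
  have hv0 : v ≠ 0 := by
    rintro rfl
    rw [map_zero] at hξ
    exact zero_ne_one hξ
  have hv : formValue φ A v = m := by
    rw [hfv, hξ, one_smul, sub_self, (hφ.norm_eq_one_iff 1).2 isUnit_one, formValue_eq_hermVal,
      toComplex_eq_zero.2 rfl, hermVal_zero]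
    simp
  have hge : ∀ w : Fin r → 𝓞 E, w ≠ 0 → m ≤ formValue φ A w := fun w hw => by
    rw [hfv]
    by_cases h : ξ w = 0
    · rw [h, zero_smul, sub_zero]
      simpa using hmin w hw
    · have h1 := hφ.one_le_norm _ h
      have h2 := hB0 (toComplex φ (w - ξ w • v))
      rw [← formValue_eq_hermVal] at h2
      nlinarith [one_le_pow₀ h1 (n := 2)]
  have hminA : ∀ w, w ∈ minVectors φ A ↔ w ≠ 0 ∧ formValue φ A w = m := fun w =>
    ⟨fun h => ⟨h.1, le_antisymm ((h.2 v hv0).trans hv.le) (hge w h.1)⟩,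
      fun h => ⟨h.1, fun x hx => h.2.le.trans (hge x hx)⟩⟩
  have hσ : IsHermitianPerfectCone φ (perfectCone φ A) := Or.inr ⟨A, hApos, rfl⟩
  have hcv := coneVectors_perfectCone hφ hApos
  refine ⟨perfectCone φ A, hσ, ⟨?_, hξ, fun w hw => ?_⟩, ?_⟩
  · rw [hcv, hminA]
    exact ⟨hv0, hv⟩
  · rw [hcv, hminA, hfv] at hw
    by_cases h : ξ w = 0
    · exact Or.inl h
    right
    have h1 := hφ.one_le_norm _ h
    have h2 : w - ξ w • v = 0 := by
      by_contra hne
      have := formValue_pos (φ := φ) hB hne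
      nlinarith [one_le_pow₀ h1 (n := 2), hw.2]
    have h3 : ‖φ (ξ w)‖ = 1 := by
      have h4 := hw.2
      rw [h2, formValue_eq_hermVal, toComplex_eq_zero.2 rfl, hermVal_zero, zero_add] at h4
      have h5 : ‖φ (ξ w)‖ ^ 2 = 1 := by
        have : m * (‖φ (ξ w)‖ ^ 2 - 1) = 0 := by linarith
        have := (mul_eq_zero.1 this).resolve_left hm.ne'
        linarith
      exact (pow_eq_one_iff_of_nonneg (norm_nonneg _) two_ne_zero).1 h5
    obtain ⟨u, hu⟩ := (hφ.norm_eq_one_iff _).1 h3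
    exact ⟨u, by rw [hu]; exact sub_eq_zero.1 h2⟩
  · refine (deflate_isHermitianPerfectCone hφ hσ ξ).ext hφ hρ ?_
    ext w
    rw [coneVectors_deflate, hcv, hmem]
    constructor
    · rintro ⟨h1, h2⟩
      rw [hminA, hfv, h2, zero_smul, sub_zero] at h1
      simpa using h1
    · intro h
      have h2 := hker w ((hmem w).2 h)
      refine ⟨?_, h2⟩
      rw [hminA, hfv, h2, zero_smul, sub_zero]
      simpa using h

/-! ### The rank of a cone -/

theorem exists_mulVec_eq_zero_iff_rank_lt {X : Matrix (Fin r) (Fin r) ℂ} :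
    (∃ y, y ≠ 0 ∧ X.mulVec y = 0) ↔ X.rank < r := by
  have h := LinearMap.finrank_range_add_finrank_ker X.mulVecLin
  rw [Module.finrank_fin_fun] at h
  have h2 : X.rank < r ↔ 0 < Module.finrank ℂ (LinearMap.ker X.mulVecLin) := by
    rw [Matrix.rank]; omega
  rw [h2, Module.finrank_pos_iff, Submodule.nontrivial_iff_ne_bot, Submodule.ne_bot_iff]
  constructor
  · rintro ⟨y, hy, h⟩
    exact ⟨y, h, hy⟩
  · rintro ⟨y, h, hy⟩
    exact ⟨y, hy, h⟩

theorem rank_le (X : Matrix (Fin r) (Fin r) ℂ) : X.rank ≤ r := by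
  simpa using X.rank_le_width

theorem bddAbove_rank (σ : PointedCone ℝ (Matrix (Fin r) (Fin r) ℂ)) :
    BddAbove {k | ∃ X ∈ σ, X.rank = k} :=
  ⟨r, by rintro _ ⟨X, -, rfl⟩; exact rank_le X⟩

theorem nonempty_rank (σ : PointedCone ℝ (Matrix (Fin r) (Fin r) ℂ)) :
    {k | ∃ X ∈ σ, X.rank = k}.Nonempty :=
  ⟨_, 0, zero_mem _, rfl⟩

theorem coneRank_mono (h : τ ≤ σ) : coneRank τ ≤ coneRank σ :=
  csSup_le_csSup (bddAbove_rank σ) (nonempty_rank τ) fun _ ⟨X, hX, hk⟩ => ⟨X, h hX, hk⟩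

theorem coneRank_le (σ : PointedCone ℝ (Matrix (Fin r) (Fin r) ℂ)) : coneRank σ ≤ r :=
  csSup_le (nonempty_rank σ) (by rintro _ ⟨X, -, rfl⟩; exact rank_le X)

theorem evalAt_eq_hermVal (y : Fin r → ℂ) (X : Matrix (Fin r) (Fin r) ℂ) :
    evalAt y X = hermVal X y := by
  rw [← pairing_vecMulVec, evalAt, pairing_apply, pairing_apply]
  simp only [mul_comm]

/-- All matrices in the span of `σ` kill the conjugate of the nonzero vector representing `ξ`. -/
theorem coneRank_lt (hφ : IsDiscreteEmbedding φ) (hσ : IsHermitianPerfectCone φ σ)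
    {v : Fin r → 𝓞 E} {ξ : (Fin r → 𝓞 E) →ₗ[𝓞 E] 𝓞 E} (hξ : ξ v = 1)
    (hker : ∀ w ∈ coneVectors φ σ, ξ w = 0) : coneRank σ < r := by
  have hy : dualVec φ ξ ≠ 0 := by
    intro h
    have h1 := dualVec_dotProduct (φ := φ) ξ v
    rw [h, zero_dotProduct, hξ] at h1
    simp at h1
  let K : Submodule ℝ (Matrix (Fin r) (Fin r) ℂ) :=
    { carrier := {X | X.mulVec (star (dualVec φ ξ)) = 0}
      add_mem' := fun {X Y} hX hY => by
        rw [Set.mem_ofPred_eq] at *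
        rw [Matrix.add_mulVec, hX, hY, add_zero]
      zero_mem' := Matrix.zero_mulVec _
      smul_mem' := fun c X hX => by
        rw [Set.mem_ofPred_eq] at *
        rw [Matrix.smul_mulVec, hX, smul_zero] }
  have hK : linSpan σ ≤ K := by
    rw [hσ.linSpan_eq hφ]
    refine Submodule.span_le.2 ?_
    rintro _ ⟨w, hw, rfl⟩
    change (rankOne φ w).mulVec _ = 0
    have h2 : star (toComplex φ w) ⬝ᵥ star (dualVec φ ξ) = 0 := by
      rw [Matrix.star_dotProduct_star, dualVec_dotProduct, hker w hw]
      simp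
    rw [rankOne, Matrix.vecMulVec_mulVec, h2]
    simp
  have hlt : ∀ k ∈ {k | ∃ X ∈ σ, X.rank = k}, k < r := by
    rintro _ ⟨X, hX, rfl⟩
    exact exists_mulVec_eq_zero_iff_rank_lt.1
      ⟨_, star_ne_zero.2 hy, hK (Submodule.subset_span hX)⟩
  exact hlt _ (Nat.sSup_mem (nonempty_rank σ) (bddAbove_rank σ))

/-- A functional with a nonzero multiple of given values is a multiple of a unimodular one. -/
theorem exists_unimodular_functional {S : Set (Fin r → 𝓞 E)}
    {ζ : (Fin r → 𝓞 E) →ₗ[𝓞 E] 𝓞 E} (hζ : ζ ≠ 0) (hS : ∀ w ∈ S, ζ w = 0) :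
    ∃ (v : Fin r → 𝓞 E) (ξ : (Fin r → 𝓞 E) →ₗ[𝓞 E] 𝓞 E), ξ v = 1 ∧ ∀ w ∈ S, ξ w = 0 := by
  -- The image of `ζ` is a nonzero principal ideal `(d)`; dividing `ζ` by `d` makes it surjective.
  obtain ⟨d, hd⟩ := (IsPrincipalIdealRing.principal (LinearMap.range ζ)).principal
  have hdvd : ∀ x, ∃ b, ζ x = d * b := fun x => by
    have : ζ x ∈ LinearMap.range ζ := ⟨x, rfl⟩
    rw [hd] at this
    exact Ideal.mem_span_singleton.1 this
  choose c hc using hdvd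
  have hd0 : d ≠ 0 := by
    rintro rfl
    exact hζ (LinearMap.ext fun x => by rw [hc x]; simp)
  let ξ : (Fin r → 𝓞 E) →ₗ[𝓞 E] 𝓞 E :=
    { toFun := c
      map_add' := fun x y => mul_left_cancel₀ hd0 (by rw [mul_add, ← hc, ← hc, ← hc, map_add])
      map_smul' := fun a x => mul_left_cancel₀ hd0 (by
        rw [← hc, map_smul, hc x, RingHom.id_apply, smul_eq_mul, smul_eq_mul]; ring) }
  have hξ : ∀ x, ζ x = d * ξ x := hc
  obtain ⟨v, hv⟩ : d ∈ LinearMap.range ζ := by rw [hd]; exact Ideal.mem_span_singleton_self d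
  refine ⟨v, ξ, mul_left_cancel₀ hd0 (by rw [← hξ, hv, mul_one]), fun w hw => ?_⟩
  have := hS w hw
  rw [hξ] at this
  exact (mul_eq_zero.1 this).resolve_left hd0

theorem exists_functional_of_coneRank_lt [NumberField E] (hφ : IsDiscreteEmbedding φ)
    (hσ : IsHermitianPerfectCone φ σ) (hr : coneRank σ < r) :
    ∃ (v : Fin r → 𝓞 E) (ξ : (Fin r → 𝓞 E) →ₗ[𝓞 E] 𝓞 E), ξ v = 1 ∧
      ∀ w ∈ coneVectors φ σ, ξ w = 0 := by
  classical
  set S := (hσ.finite hφ).toFinset with hS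
  have hSmem : ∀ w, w ∈ S ↔ w ∈ coneVectors φ σ := fun w => Set.Finite.mem_toFinset _
  -- a complex vector orthogonal to all the vectors of the cone
  have hz : ∃ z : Fin r → ℂ, z ≠ 0 ∧ ∀ w ∈ S, z ⬝ᵥ toComplex φ w = 0 := by
    -- A kernel vector of this single matrix is orthogonal to every `w`, since the terms of the sum
    -- are positive semidefinite.
    have hX : ∑ w ∈ S, rankOne φ w ∈ σ := Submodule.sum_mem _ fun w hw => ((hSmem w).1 hw).2
    have hlt : (∑ w ∈ S, rankOne φ w).rank < r :=
      lt_of_le_of_lt (le_csSup (bddAbove_rank σ) ⟨_, hX, rfl⟩) hr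
    obtain ⟨y, hy, hy0⟩ := exists_mulVec_eq_zero_iff_rank_lt.2 hlt
    refine ⟨star y, star_ne_zero.2 hy, ?_⟩
    have h1 : evalAt (star y) (∑ w ∈ S, rankOne φ w) = 0 := by
      rw [evalAt_eq_hermVal, hermVal, star_star, hy0, dotProduct_zero, Complex.zero_re]
    rw [map_sum, Finset.sum_eq_zero_iff_of_nonneg] at h1
    · intro w hw
      have h2 := h1 w hw
      rw [evalAt_rankOne, sq_eq_zero_iff, norm_eq_zero] at h2
      exact h2
    · intro w _
      rw [evalAt_rankOne]
      positivity
  obtain ⟨z, hz0, hz⟩ := hz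
  -- descend to the field `E`
  let W : Matrix S (Fin r) E := Matrix.of fun w i => ((w : Fin r → 𝓞 E) i : E)
  -- If the system had only the trivial solution over `E`, its matrix would have a left inverse over
  -- `E`, which stays one over `ℂ` and excludes `z`.
  have ht : ∃ t : Fin r → E, t ≠ 0 ∧ W.mulVec t = 0 := by
    by_contra! h
    have hker : LinearMap.ker W.mulVecLin = ⊥ := by
      rw [LinearMap.ker_eq_bot']
      intro t ht
      by_contra hne
      exact h t hne ht
    obtain ⟨U, hU⟩ := W.mulVecLin.exists_leftInverse_of_injective hker
    have hUW : LinearMap.toMatrix' U * W = 1 := by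
      rw [← LinearMap.toMatrix'_id, ← hU, LinearMap.toMatrix'_comp, ← Matrix.toLin'_apply',
        LinearMap.toMatrix'_toLin']
    have hmap := congrArg (fun M : Matrix (Fin r) (Fin r) E => M.map φ) hUW
    rw [Matrix.map_mul, Matrix.map_one φ (map_zero φ) (map_one φ)] at hmap
    have hWz : (W.map φ).mulVec z = 0 := by
      ext w
      have := hz w w.2
      rw [dotProduct_comm] at this
      exact this
    apply hz0
    rw [← Matrix.one_mulVec z, ← hmap, ← Matrix.mulVec_mulVec, hWz, Matrix.mulVec_zero]
  obtain ⟨t, ht0, ht⟩ := ht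
  obtain ⟨b, hb⟩ := IsLocalization.exist_integer_multiples_of_finite (nonZeroDivisors (𝓞 E)) t
  choose a ha using hb
  have hb0 : (b : 𝓞 E) ≠ 0 := nonZeroDivisors.ne_zero b.2
  have ha' : ∀ i, ((a i : 𝓞 E) : E) = (b : 𝓞 E) * t i := fun i => by
    have := ha i
    rw [Algebra.smul_def] at this
    exact this
  let ζ : (Fin r → 𝓞 E) →ₗ[𝓞 E] 𝓞 E := ∑ i, a i • LinearMap.proj i
  have hζ : ∀ x, ζ x = ∑ i, a i * x i := fun x => by simp [ζ, LinearMap.sum_apply]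
  refine exists_unimodular_functional (ζ := ζ) (fun h => ht0 ?_) fun w hw => ?_
  · ext i
    have h1 : a i = 0 := by
      have := LinearMap.congr_fun h (Pi.single i 1)
      rw [hζ] at this
      simpa [Pi.single_apply] using this
    have h2 := ha' i
    rw [h1] at h2
    have h3 : ((b : 𝓞 E) : E) * t i = 0 := by rw [← h2]; simp
    exact (mul_eq_zero.1 h3).resolve_left (NumberField.RingOfIntegers.coe_ne_zero_iff.2 hb0)
  · have h1 := congrFun ht ⟨w, (hSmem w).2 hw⟩
    have h2 : ∑ i, (w i : E) * t i = 0 := h1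
    rw [hζ]
    apply NumberField.RingOfIntegers.coe_injective
    rw [map_sum, map_zero]
    calc ∑ i, algebraMap (𝓞 E) E (a i * w i) = (b : 𝓞 E) * ∑ i, (w i : E) * t i := by
          rw [Finset.mul_sum]
          refine Finset.sum_congr rfl fun i _ => ?_
          rw [map_mul]
          have := ha' i
          rw [show algebraMap (𝓞 E) E (a i) = (b : 𝓞 E) * t i from this]
          ring
      _ = 0 := by rw [h2, mul_zero]

end Inflation

/-! ### The square of the differential -/

section Differential

open Module (finrank)

variable {E : Type*} [Field E] {φ : E →+* ℂ} {r n : ℕ}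
  {σ τ ρ : PointedCone ℝ (Matrix (Fin r) (Fin r) ℂ)}

theorem SameOrbit.symm {σ τ : AltCone φ r n} (h : SameOrbit σ τ) : SameOrbit τ σ := by
  obtain ⟨g, hg⟩ := h
  exact ⟨g⁻¹, moveCone_inv hg⟩

theorem SameOrbit.trans {σ τ ρ : AltCone φ r n} (h : SameOrbit σ τ) (h' : SameOrbit τ ρ) :
    SameOrbit σ ρ := by
  obtain ⟨g, hg⟩ := h
  obtain ⟨k, hk⟩ := h'
  exact ⟨k * g, moveCone_trans hg hk⟩

/-- The cone `g · ρ`. -/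
noncomputable def AltCone.move (g : GL (Fin r) (𝓞 E)) (ρ : AltCone φ r n) : AltCone φ r n :=
  ⟨moveCone φ g ρ.1, ρ.2.1.moveCone rfl, ρ.2.2.1.moveCone rfl,
    (finrank_moveCone (φ := φ) rfl).trans ρ.2.2.2⟩

theorem AltCone.move_bijective (g : GL (Fin r) (𝓞 E)) :
    Function.Bijective (AltCone.move (φ := φ) (n := n) g) := by
  refine Function.bijective_iff_has_inverse.2 ⟨AltCone.move g⁻¹, fun ρ => ?_, fun ρ => ?_⟩
  · exact Subtype.ext (moveCone_inv rfl)
  · refine Subtype.ext ?_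
    have := moveCone_inv (φ := φ) (g := g⁻¹) (σ := ρ.1) rfl
    rwa [inv_inv] at this

namespace ConeChoices

variable (c : ConeChoices φ r)

theorem sameOrbit_rep (τ : AltCone φ r n) : SameOrbit τ (c.rep τ).1 :=
  (c.existsUnique_rep n τ).choose_spec.1.2

theorem rep_eq_of_sameOrbit {τ : AltCone φ r n} {ρ : c.reps n} (h : SameOrbit τ ρ.1) :
    c.rep τ = ρ :=
  Subtype.ext ((c.existsUnique_rep n τ).unique ⟨(c.rep τ).2, c.sameOrbit_rep τ⟩ ⟨ρ.2, h⟩)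

theorem rep_move (g : GL (Fin r) (𝓞 E)) (τ : AltCone φ r n) : c.rep (τ.move g) = c.rep τ := by
  refine c.rep_eq_of_sameOrbit (SameOrbit.trans ?_ (c.sameOrbit_rep τ))
  exact SameOrbit.symm ⟨g, rfl⟩

/-- The boundary of a cone, which need not be alternating, with a given orientation. -/
noncomputable def facetSum (τ : PointedCone ℝ (Matrix (Fin r) (Fin r) ℂ))
    (o : Orientation ℝ (linSpan τ) (Fin (n + 1))) : c.Chains n :=
  ∑ᶠ ρ ∈ {ρ : AltCone φ r n | ρ.1.IsFaceOf τ},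
    orientationSign (c.orient n ρ) o • (Finsupp.single (c.rep ρ) 1 : c.Chains n)

theorem boundary_single (σ : c.reps (n + 1)) (a : ℚ) :
    c.boundary n (Finsupp.single σ a) = a • c.facetSum σ.1.1 (c.orient _ σ.1) := by
  rw [boundary, Finsupp.linearCombination_single]
  rfl

end ConeChoices

variable [IsPrincipalIdealRing (𝓞 E)]

theorem finite_facets (hφ : IsDiscreteEmbedding φ) (hσ : IsHermitianPerfectCone φ σ) :
    {τ : PointedCone ℝ (Matrix (Fin r) (Fin r) ℂ) | τ.IsFaceOf σ}.Finite := by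
  obtain ⟨G, rfl⟩ := hσ.fg hφ
  exact finite_faces G.finite_toSet

theorem finite_altFacets (hφ : IsDiscreteEmbedding φ) (hσ : IsHermitianPerfectCone φ σ) :
    {τ : AltCone φ r n | τ.1.IsFaceOf σ}.Finite :=
  (finite_facets hφ hσ).preimage Subtype.val_injective.injOn

namespace ConeChoices

variable (c : ConeChoices φ r)

theorem facetSum_neg (hφ : IsDiscreteEmbedding φ) (hτ : IsHermitianPerfectCone φ τ)
    (hn : finrank ℝ (linSpan τ) = n + 1) (o : Orientation ℝ (linSpan τ) (Fin (n + 1))) :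
    c.facetSum τ (-o) = -c.facetSum τ o := by
  rw [facetSum, facetSum, ← finsum_mem_neg_distrib _ (finite_altFacets hφ hτ)]
  refine finsum_mem_congr rfl fun ρ hρ => ?_
  rw [orientationSign_neg_right (hτ.fg hφ) hρ hn ρ.2.2.2, neg_smul]

/-- Moving the facets by `g` keeps their representatives, and the signs agree because the chosen
orientations are compatible with the action. -/
theorem facetSum_move (hφ : IsDiscreteEmbedding φ) (hτ : IsHermitianPerfectCone φ τ)
    (hn : finrank ℝ (linSpan τ) = n + 1) {g : GL (Fin r) (𝓞 E)} (h : moveCone φ g τ = σ)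
    (o : Orientation ℝ (linSpan τ) (Fin (n + 1))) :
    c.facetSum σ (Orientation.map _ (spanEquiv φ h) o) = c.facetSum τ o := by
  refine (finsum_mem_eq_of_bijOn (AltCone.move g) ⟨fun ρ hρ => ?_,
    (AltCone.move_bijective g).1.injOn, fun ρ hρ => ?_⟩ fun ρ hρ => ?_).symm
  · subst h
    exact isFaceOf_moveCone g hρ
  · obtain ⟨ρ, rfl⟩ := (AltCone.move_bijective g).2 ρ
    refine ⟨ρ, ?_, rfl⟩
    have h1 : (moveCone φ g⁻¹ (moveCone φ g ρ.1)).IsFaceOf (moveCone φ g⁻¹ σ) :=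
      isFaceOf_moveCone g⁻¹ hρ
    rwa [moveCone_inv rfl, moveCone_inv h] at h1
  · have hF : (moveCone φ g ρ.1).IsFaceOf σ := by
      subst h
      exact isFaceOf_moveCone g hρ
    have h1 := orientationSign_map (hτ.fg hφ) hρ hn ρ.2.2.2 ((hτ.moveCone h).fg hφ) hF
      (spanEquiv φ h) (spanEquiv φ rfl) (fun x => rfl)
      (fun x hx => by subst h; exact act_mem_moveCone hx) (c.orient n ρ) o
    rw [c.rep_move, ← h1]
    exact congrArg (fun x => orientationSign x _ • Finsupp.single (c.rep ρ) (1 : ℚ))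
      (c.orient_compatible n ρ (ρ.move g) g rfl)

/-- An orientation-reversing stabilizer shows that the sums for `o` and `-o` coincide, while they
are negatives of each other. -/
theorem facetSum_eq_zero (hφ : IsDiscreteEmbedding φ) (hτ : IsHermitianPerfectCone φ τ)
    (hn : finrank ℝ (linSpan τ) = n + 1) (hna : ¬IsAlternating φ τ)
    (o : Orientation ℝ (linSpan τ) (Fin (n + 1))) : c.facetSum τ o = 0 := by
  rw [IsAlternating] at hna
  push Not at hna
  obtain ⟨g, h, hdet⟩ := hna
  have hdet' := lt_of_le_of_ne hdet (LinearEquiv.isUnit_det' (spanEquiv φ h)).ne_zero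
  have h1 := (Orientation.map_eq_neg_iff_det_neg o (spanEquiv φ h)
    (by rw [Fintype.card_fin, hn])).2 hdet'
  have h2 := c.facetSum_move hφ hτ hn h o
  rw [h1, c.facetSum_neg hφ hτ hn] at h2
  exact self_eq_neg.1 h2.symm

theorem facetSum_rep (hφ : IsDiscreteEmbedding φ) (τ : AltCone φ r (n + 1)) :
    c.facetSum (c.rep τ).1.1 (c.orient _ (c.rep τ).1) = c.facetSum τ.1 (c.orient _ τ) := by
  obtain ⟨g, hg⟩ := c.sameOrbit_rep τ
  rw [← c.orient_compatible _ τ _ g hg, c.facetSum_move hφ τ.2.1 τ.2.2.2]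

/-- An index set not depending on `τ` lets the double sum in `∂²` be interchanged. -/
theorem facetSum_eq_sum (hφ : IsDiscreteEmbedding φ) (hσ : IsHermitianPerfectCone φ σ)
    (hτ : τ.IsFaceOf σ) [Fintype {ρ : AltCone φ r n // ρ.1.IsFaceOf σ}]
    [∀ ρ : PointedCone ℝ (Matrix (Fin r) (Fin r) ℂ), Decidable (ρ ≤ τ)]
    (o : Orientation ℝ (linSpan τ) (Fin (n + 1))) :
    c.facetSum τ o = ∑ ρ : {ρ : AltCone φ r n // ρ.1.IsFaceOf σ},
      (if ρ.1.1 ≤ τ then orientationSign (c.orient n ρ.1) o else 0) •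
        (Finsupp.single (c.rep ρ.1) 1 : c.Chains n) := by
  have hfin : Finite {ρ : AltCone φ r n | ρ.1.IsFaceOf τ} :=
    (finite_altFacets hφ (hσ.of_isFaceOf hφ hτ)).to_subtype
  have := Fintype.ofFinite {ρ : AltCone φ r n | ρ.1.IsFaceOf τ}
  rw [facetSum, ← finsum_set_coe_eq_finsum_mem, finsum_eq_sum_of_fintype]
  refine Fintype.sum_of_injective (fun ρ => ⟨ρ.1, PointedCone.IsFaceOf.trans ρ.2 hτ⟩)
    (fun ρ ρ' h => ?_) _ _ (fun ρ hρ => ?_) (fun ρ => ?_)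
  · exact Subtype.ext (congrArg (fun x => x.1) h)
  · rw [if_neg, zero_smul]
    exact fun hle => hρ ⟨⟨ρ.1, (PointedCone.IsFaceOf.isFaceOf_iff_le ρ.2 hτ).2 hle⟩, rfl⟩
  · rw [if_pos (PointedCone.IsFaceOf.le ρ.2)]

theorem boundary_boundary_single (hφ : IsDiscreteEmbedding φ) (σ : c.reps (n + 2)) :
    c.boundary n (c.boundary (n + 1) (Finsupp.single σ 1)) = 0 := by
  classical
  have hσ := σ.1.2.1
  have hfin : Finite {T : PointedCone ℝ (Matrix (Fin r) (Fin r) ℂ) //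
      T.IsFaceOf σ.1.1 ∧ finrank ℝ (linSpan T) = n + 1} :=
    ((finite_facets hφ hσ).subset fun T hT => hT.1).to_subtype
  have := Fintype.ofFinite {T : PointedCone ℝ (Matrix (Fin r) (Fin r) ℂ) //
      T.IsFaceOf σ.1.1 ∧ finrank ℝ (linSpan T) = n + 1}
  have hfin₁ : Finite {ρ : AltCone φ r (n + 1) | ρ.1.IsFaceOf σ.1.1} :=
    (finite_altFacets hφ hσ).to_subtype
  have := Fintype.ofFinite {ρ : AltCone φ r (n + 1) | ρ.1.IsFaceOf σ.1.1}
  have hfin₀ : Finite {ρ : AltCone φ r n // ρ.1.IsFaceOf σ.1.1} :=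
    (finite_altFacets hφ hσ).to_subtype
  have := Fintype.ofFinite {ρ : AltCone φ r n // ρ.1.IsFaceOf σ.1.1}
  -- orientations of all the facets of `σ`
  let o : ∀ T : {T : PointedCone ℝ (Matrix (Fin r) (Fin r) ℂ) //
      T.IsFaceOf σ.1.1 ∧ finrank ℝ (linSpan T) = n + 1},
      Orientation ℝ (linSpan T.1) (Fin (n + 1)) := fun T =>
    if h : IsAlternating φ T.1 then
      c.orient (n + 1) ⟨T.1, hσ.of_isFaceOf hφ T.2.1, h, T.2.2⟩
    else (nonempty_orientation T.2.2).some
  have ho : ∀ (τ : AltCone φ r (n + 1)) (h : τ.1.IsFaceOf σ.1.1),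
      o ⟨τ.1, h, τ.2.2.2⟩ = c.orient (n + 1) τ := fun τ h => dif_pos τ.2.2.1
  -- Facets that are not alternating may be included with any orientation, as their facet sums
  -- vanish. Then both facets through each codimension two face occur.
  have h1 : c.boundary n (c.boundary (n + 1) (Finsupp.single σ 1)) =
      ∑ T : {T : PointedCone ℝ (Matrix (Fin r) (Fin r) ℂ) //
        T.IsFaceOf σ.1.1 ∧ finrank ℝ (linSpan T) = n + 1},
        orientationSign (o T) (c.orient _ σ.1) • c.facetSum T.1 (o T) := by
    rw [boundary_single, one_smul, facetSum, ← finsum_set_coe_eq_finsum_mem,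
      finsum_eq_sum_of_fintype, map_sum]
    refine Fintype.sum_of_injective (fun τ => ⟨τ.1.1, τ.2.out, τ.1.2.2.2⟩)
      (fun τ τ' h => ?_) _ _ (fun T hT => ?_) (fun τ => ?_)
    · exact Subtype.ext (Subtype.ext (congrArg (fun x => x.1) h))
    · rw [c.facetSum_eq_zero hφ (hσ.of_isFaceOf hφ T.2.1) T.2.2, smul_zero]
      exact fun ha => hT ⟨⟨⟨T.1, hσ.of_isFaceOf hφ T.2.1, ha, T.2.2⟩, T.2.1⟩, rfl⟩
    · rw [map_smul, boundary_single, one_smul, c.facetSum_rep hφ]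
      change _ = orientationSign (o ⟨τ.1.1, τ.2.out, τ.1.2.2.2⟩) _ •
        c.facetSum τ.1.1 (o ⟨τ.1.1, τ.2.out, τ.1.2.2.2⟩)
      rw [ho]
      exact τ.2
  rw [h1]
  simp_rw [fun T : {T : PointedCone ℝ (Matrix (Fin r) (Fin r) ℂ) //
      T.IsFaceOf σ.1.1 ∧ finrank ℝ (linSpan T) = n + 1} =>
    c.facetSum_eq_sum hφ hσ T.2.1 (o T), Finset.smul_sum, smul_smul]
  rw [Finset.sum_comm]
  refine Finset.sum_eq_zero fun ρ _ => ?_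
  rw [← Finset.sum_smul]
  obtain ⟨G, hG⟩ := hσ.fg hφ
  have hG' : σ.1.1 = PointedCone.hull ℝ (G : Set (Matrix (Fin r) (Fin r) ℂ)) := hG.symm
  obtain ⟨T₁, T₂, hT₁, hT₂, hρ₁, hρ₂, hd₁, hd₂, hg₁, hg₂, huniq⟩ :=
    exists_two_facets (n := n) G.finite_toSet (hG' ▸ ρ.2) (hG' ▸ σ.1.2.2.2) ρ.1.2.2.2
  rw [← hG'] at hT₁ hT₂ huniq
  have hne : T₁ ≠ T₂ := by
    rintro rfl
    obtain ⟨g, hg, hg'⟩ := hg₁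
    exact hg' (Submodule.subset_span hg)
  have h2 := orientationSign_diamond (hσ.fg hφ) hT₁ hT₂
    ((hσ.of_isFaceOf hφ hT₁).fg hφ) ((hσ.of_isFaceOf hφ hT₂).fg hφ)
    ((PointedCone.IsFaceOf.isFaceOf_iff_le ρ.2 hT₁).2 hρ₁)
    ((PointedCone.IsFaceOf.isFaceOf_iff_le ρ.2 hT₂).2 hρ₂)
    σ.1.2.2.2 hd₁ hd₂ ρ.1.2.2.2 hg₁ hg₂ (c.orient n ρ.1) (o ⟨T₁, hT₁, hd₁⟩)
    (o ⟨T₂, hT₂, hd₂⟩) (c.orient _ σ.1)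
  rw [Fintype.sum_eq_add (⟨T₁, hT₁, hd₁⟩ : {T : PointedCone ℝ (Matrix (Fin r) (Fin r) ℂ) //
    T.IsFaceOf σ.1.1 ∧ finrank ℝ (linSpan T) = n + 1}) ⟨T₂, hT₂, hd₂⟩
    (fun h => hne (congrArg (fun x => x.1) h)), if_pos hρ₁, if_pos hρ₂,
    mul_comm, h2, mul_comm (orientationSign (o ⟨T₂, hT₂, hd₂⟩) _), neg_add_cancel, zero_smul]
  rintro T ⟨hne₁, hne₂⟩
  rw [if_neg, mul_zero]
  intro hle
  rcases huniq T.1 T.2.1 hle T.2.2 with h | h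
  · exact hne₁ (Subtype.ext h)
  · exact hne₂ (Subtype.ext h)

theorem boundary_comp_boundary (hφ : IsDiscreteEmbedding φ) (n : ℕ) :
    c.boundary n ∘ₗ c.boundary (n + 1) = 0 := by
  refine Finsupp.lhom_ext' fun σ => LinearMap.ext_ring ?_
  exact c.boundary_boundary_single hφ σ

end ConeChoices

end Differential

/-! ### Acyclicity of the inflation subcomplex -/

section Acyclicity

open Module (finrank)

variable {E : Type*} [Field E] {φ : E →+* ℂ} {r n : ℕ}
  {σ τ ρ : PointedCone ℝ (Matrix (Fin r) (Fin r) ℂ)}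

namespace ConeChoices

variable (c : ConeChoices φ r)

/-- The chosen representatives that have a coloop. -/
def coloopReps (n : ℕ) : Set (c.reps n) := {σ | HasColoop φ σ.1.1}

/-- The chosen representatives of rank less than `r` that have no coloop. -/
def deflatedReps (n : ℕ) : Set (c.reps n) := {σ | coneRank σ.1.1 < r ∧ ¬HasColoop φ σ.1.1}

/-- As no rank exceeds `r`, every coloop cone belongs to the inflation complex, whatever its rank.
-/
theorem inflation_eq_supported (n : ℕ) :
    c.inflation n = Finsupp.supported ℚ ℚ (c.coloopReps n ∪ c.deflatedReps n) := by
  rw [Finsupp.supported_eq_span_single, inflation]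
  congr 1
  ext x
  have h : ∀ σ : c.reps n, ((coneRank σ.1.1 = r ∧ HasColoop φ σ.1.1) ∨ coneRank σ.1.1 < r) ↔
      σ ∈ c.coloopReps n ∪ c.deflatedReps n := fun σ => by
    change _ ↔ HasColoop φ σ.1.1 ∨ (coneRank σ.1.1 < r ∧ ¬HasColoop φ σ.1.1)
    have := (coneRank_le σ.1.1).lt_or_eq
    tauto
  constructor
  · rintro ⟨σ, hσ, rfl⟩
    exact ⟨σ, (h σ).1 hσ, rfl⟩
  · rintro ⟨σ, hσ, rfl⟩
    exact ⟨σ, (h σ).2 hσ, rfl⟩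

variable [IsPrincipalIdealRing (𝓞 E)]

theorem rep_mem_coloopReps (hφ : IsDiscreteEmbedding φ) {τ : AltCone φ r n}
    (h : HasColoop φ τ.1) : c.rep τ ∈ c.coloopReps n := by
  obtain ⟨g, hg⟩ := c.sameOrbit_rep τ
  exact h.moveCone hφ τ.2.1 hg

theorem rep_mem_deflatedReps (hφ : IsDiscreteEmbedding φ) {τ : AltCone φ r n}
    (h : coneRank τ.1 < r) (h' : ¬HasColoop φ τ.1) : c.rep τ ∈ c.deflatedReps n := by
  obtain ⟨g, hg⟩ := c.sameOrbit_rep τ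
  refine ⟨by rwa [coneRank_moveCone hg], fun hc => h' ?_⟩
  exact hc.moveCone hφ (c.rep τ).1.2.1 (moveCone_inv hg)

theorem not_mem_coloopReps_zero (hφ : IsDiscreteEmbedding φ) (σ : c.reps 0) :
    σ ∉ c.coloopReps 0 := by
  intro h
  obtain ⟨v, ξ, hc⟩ := (hasColoop_iff hφ σ.1.2.1).1 h
  have h1 := hc.finrank_deflate hφ σ.1.2.1
  rw [σ.1.2.2.2] at h1
  omega

/-- The deflation of an alternating cone along a coloop. -/
noncomputable def deflateAlt (hφ : IsDiscreteEmbedding φ) (σ : AltCone φ r (n + 1))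
    {v : Fin r → 𝓞 E} {ξ : (Fin r → 𝓞 E) →ₗ[𝓞 E] 𝓞 E} (hc : IsConeColoop φ σ.1 v ξ) :
    AltCone φ r n :=
  ⟨deflate φ σ.1 ξ, deflate_isHermitianPerfectCone hφ σ.2.1 ξ,
    isAlternating_deflate hφ σ.2.1 σ.2.2.1 hc,
    Nat.add_right_cancel ((hc.finrank_deflate hφ σ.2.1).symm.trans σ.2.2.2)⟩

theorem rep_deflateAlt_mem (hφ : IsDiscreteEmbedding φ) (σ : AltCone φ r (n + 1))
    {v : Fin r → 𝓞 E} {ξ : (Fin r → 𝓞 E) →ₗ[𝓞 E] 𝓞 E} (hc : IsConeColoop φ σ.1 v ξ) :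
    c.rep (deflateAlt hφ σ hc) ∈ c.deflatedReps n := by
  have hpc := deflate_isHermitianPerfectCone hφ σ.2.1 ξ
  refine c.rep_mem_deflatedReps hφ (coneRank_lt hφ hpc hc.apply_self fun w hw => ?_) fun h => ?_
  · change w ∈ coneVectors φ (deflate φ σ.1 ξ) at hw
    rw [coneVectors_deflate] at hw
    exact hw.2
  · obtain ⟨w, η, hw⟩ := (hasColoop_iff hφ hpc).1 h
    exact hc.not_isConeColoop_deflate hφ σ.2.1 σ.2.2.1 w η hw

/-- The boundary of a cone with a coloop is its deflation, up to sign and cones with a coloop. -/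
theorem facetSum_sub_mem (hφ : IsDiscreteEmbedding φ) (σ : AltCone φ r (n + 1))
    {v : Fin r → 𝓞 E} {ξ : (Fin r → 𝓞 E) →ₗ[𝓞 E] 𝓞 E} (hc : IsConeColoop φ σ.1 v ξ)
    (o : Orientation ℝ (linSpan σ.1) (Fin (n + 1))) :
    c.facetSum σ.1 o - orientationSign (c.orient n (deflateAlt hφ σ hc)) o •
      Finsupp.single (c.rep (deflateAlt hφ σ hc)) 1 ∈ Finsupp.supported ℚ ℚ (c.coloopReps n) := by
  classical
  have hfin : {ρ : AltCone φ r n | ρ.1.IsFaceOf σ.1}.Finite := finite_altFacets hφ σ.2.1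
  have hmem : deflateAlt hφ σ hc ∈ hfin.toFinset :=
    hfin.mem_toFinset.2 (deflate_isFaceOf hφ σ.2.1 ξ)
  rw [facetSum, finsum_mem_eq_finite_toFinset_sum _ hfin, ← Finset.add_sum_erase _ _ hmem,
    add_sub_cancel_left]
  refine Submodule.sum_mem _ fun ρ hρ => Submodule.smul_mem _ _ ?_
  obtain ⟨hne, hρ⟩ := Finset.mem_erase.1 hρ
  have hF : ρ.1.IsFaceOf σ.1 := hfin.mem_toFinset.1 hρ
  refine Finsupp.single_mem_supported ℚ 1 (c.rep_mem_coloopReps hφ ?_)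
  -- A facet other than the deflation contains `v`, and `ξ` still exhibits `v` as a coloop of it.
  by_cases hv : v ∈ coneVectors φ ρ.1
  · exact (hasColoop_iff hφ ρ.2.1).2 ⟨v, ξ, hc.of_face hF.le hv⟩
  · refine absurd (Subtype.ext ?_) hne
    exact hc.facet_eq_deflate hφ σ.2.1 hF (by rw [σ.2.2.2, ρ.2.2.2]) hv

theorem boundary_mem_inflation (hφ : IsDiscreteEmbedding φ) (n : ℕ) :
    ∀ x ∈ c.inflation (n + 1), c.boundary n x ∈ c.inflation n := by
  intro x hx
  have hle : c.inflation (n + 1) ≤ (c.inflation n).comap (c.boundary n) := by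
    rw [c.inflation_eq_supported (n + 1), Finsupp.supported_eq_span_single, Submodule.span_le]
    rintro _ ⟨σ, hσ, rfl⟩
    change c.boundary n (Finsupp.single σ 1) ∈ c.inflation n
    rw [boundary_single, one_smul, inflation_eq_supported]
    rcases hσ with hσ | hσ
    · obtain ⟨v, ξ, hc⟩ := (hasColoop_iff hφ σ.1.2.1).1 hσ
      have h1 := Finsupp.supported_mono (M := ℚ) (R := ℚ)
        (Set.subset_union_left (t := c.deflatedReps n))
        (c.facetSum_sub_mem hφ σ.1 hc (c.orient _ σ.1))
      refine (Submodule.sub_mem_iff_left _ (Submodule.smul_mem _ _ ?_)).1 h1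
      exact Finsupp.single_mem_supported ℚ 1 (Or.inr (c.rep_deflateAlt_mem hφ σ.1 hc))
    · refine finsum_mem_induction (fun y => y ∈ Finsupp.supported ℚ ℚ _) (zero_mem _)
        (fun _ _ => add_mem) fun ρ hρ => ?_
      refine Submodule.smul_mem _ _ (Finsupp.single_mem_supported ℚ 1 ?_)
      by_cases h : HasColoop φ ρ.1
      · exact Or.inl (c.rep_mem_coloopReps hφ h)
      · refine Or.inr (c.rep_mem_deflatedReps hφ (lt_of_le_of_lt (coneRank_mono ?_) hσ.1) h)
        exact PointedCone.IsFaceOf.le hρ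
  exact hle hx

/-- A cone with a coloop is determined up to `GL_r(R)` by its deflation. -/
theorem eq_of_rep_deflateAlt_eq (hφ : IsDiscreteEmbedding φ) {σ₁ σ₂ : c.reps (n + 1)}
    {v₁ v₂ : Fin r → 𝓞 E} {ξ₁ ξ₂ : (Fin r → 𝓞 E) →ₗ[𝓞 E] 𝓞 E}
    (hc₁ : IsConeColoop φ σ₁.1.1 v₁ ξ₁) (hc₂ : IsConeColoop φ σ₂.1.1 v₂ ξ₂)
    (h : c.rep (deflateAlt hφ σ₁.1 hc₁) = c.rep (deflateAlt hφ σ₂.1 hc₂)) : σ₁ = σ₂ := by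
  have h1 := c.sameOrbit_rep (deflateAlt hφ σ₁.1 hc₁)
  rw [h] at h1
  obtain ⟨k, hk⟩ := h1.trans (c.sameOrbit_rep (deflateAlt hφ σ₂.1 hc₂)).symm
  obtain ⟨g, hg, -⟩ := exists_gl_extending hφ σ₁.1.2.1 σ₂.1.2.1 hc₁ hc₂ hk
  have h2 : c.rep σ₁.1 = σ₁ := c.rep_eq_of_sameOrbit ⟨1, moveCone_one _⟩
  exact h2.symm.trans (c.rep_eq_of_sameOrbit ⟨g, hg⟩)

/-- The boundary map is injective on the span of the cones with a coloop. -/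
theorem eq_zero_of_boundary_eq_zero (hφ : IsDiscreteEmbedding φ) {d : c.Chains (n + 1)}
    (hd : d ∈ Finsupp.supported ℚ ℚ (c.coloopReps (n + 1))) (h : c.boundary n d = 0) : d = 0 := by
  by_contra hne
  obtain ⟨σ, hσ⟩ := Finsupp.support_nonempty_iff.2 hne
  have hcol : ∀ τ ∈ d.support, ∃ v ξ, IsConeColoop φ τ.1.1 v ξ := fun τ hτ =>
    (hasColoop_iff hφ τ.1.2.1).1 (hd hτ)
  obtain ⟨v, ξ, hc⟩ := hcol σ hσ
  -- The coefficient of the boundary at `μ` sees only `σ`: `μ` has no coloop, and different coloop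
  -- representatives have different deflations.
  set μ := c.rep (deflateAlt hφ σ.1 hc) with hμ
  have hμno : μ ∉ c.coloopReps n := (c.rep_deflateAlt_mem hφ σ.1 hc).2
  have happly : ∀ (τ : c.reps (n + 1)) (w : Fin r → 𝓞 E) (η : (Fin r → 𝓞 E) →ₗ[𝓞 E] 𝓞 E)
      (hw : IsConeColoop φ τ.1.1 w η), c.facetSum τ.1.1 (c.orient _ τ.1) μ =
        orientationSign (c.orient n (deflateAlt hφ τ.1 hw)) (c.orient _ τ.1) *
          (Finsupp.single (c.rep (deflateAlt hφ τ.1 hw)) 1 : c.Chains n) μ := by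
    intro τ w η hw
    have h1 := (Finsupp.mem_supported' ℚ _).1
      (c.facetSum_sub_mem hφ τ.1 hw (c.orient _ τ.1)) μ hμno
    rw [Finsupp.sub_apply, sub_eq_zero] at h1
    rw [h1, Finsupp.smul_apply, smul_eq_mul]
  have h0 : c.boundary n d μ = 0 := by rw [h]; rfl
  have hsum : c.boundary n d = ∑ τ ∈ d.support, d τ • c.facetSum τ.1.1 (c.orient _ τ.1) := by
    conv_lhs => rw [← Finsupp.sum_single d]
    rw [Finsupp.sum, map_sum]
    exact Finset.sum_congr rfl fun τ _ => c.boundary_single τ _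
  rw [hsum, Finsupp.finsetSum_apply, Finset.sum_eq_single_of_mem σ hσ, Finsupp.smul_apply,
    happly σ v ξ hc, ← hμ, Finsupp.single_eq_same, mul_one, smul_eq_mul] at h0
  · exact mul_ne_zero (Finsupp.mem_support_iff.1 hσ) (orientationSign_ne_zero _ _) h0
  · intro τ hτ hne
    obtain ⟨w, η, hw⟩ := hcol τ hτ
    rw [Finsupp.smul_apply, happly τ w η hw, Finsupp.single_eq_of_ne, mul_zero, smul_zero]
    exact fun h => hne (c.eq_of_rep_deflateAlt_eq hφ hw hc h.symm)

/-- Every cone of rank less than `r` without a coloop is, up to cones with a coloop, a boundary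
of a cone with a coloop. -/
theorem exists_boundary_sub_mem_single [NumberField E] (hφ : IsDiscreteEmbedding φ) {μ : c.reps n}
    (hμ : μ ∈ c.deflatedReps n) :
    ∃ y ∈ Finsupp.supported ℚ ℚ (c.coloopReps (n + 1)),
      Finsupp.single μ 1 - c.boundary n y ∈ Finsupp.supported ℚ ℚ (c.coloopReps n) := by
  obtain ⟨v, ξ, hξ, hker⟩ := exists_functional_of_coneRank_lt hφ μ.1.2.1 hμ.1
  obtain ⟨σ, hσ, hc, hdef⟩ := exists_inflation hφ μ.1.2.1 hξ hker
  have hno : ∀ w η, ¬IsConeColoop φ (deflate φ σ ξ) w η := fun w η hw =>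
    hμ.2 ((hasColoop_iff hφ μ.1.2.1).2 ⟨w, η, hdef ▸ hw⟩)
  have halt : IsAlternating φ σ := isAlternating_of_deflate hφ hσ hc (hdef ▸ μ.1.2.2.1) hno
  have hdim : finrank ℝ (linSpan σ) = n + 1 := by
    rw [hc.finrank_deflate hφ hσ, hdef, μ.1.2.2.2]
  let s : AltCone φ r (n + 1) := ⟨σ, hσ, halt, hdim⟩
  have hμ' : c.rep (deflateAlt hφ s hc) = μ :=
    c.rep_eq_of_sameOrbit ⟨1, (moveCone_one _).trans hdef⟩
  have h1 := c.facetSum_sub_mem hφ s hc (c.orient _ s)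
  rw [hμ', ← c.facetSum_rep hφ s] at h1
  set a := orientationSign (c.orient n (deflateAlt hφ s hc)) (c.orient _ s) with ha
  have ha0 : a ≠ 0 := orientationSign_ne_zero _ _
  -- The boundary of `s` is `a` times `μ` up to coloop cones, hence the coefficient `a⁻¹`.
  refine ⟨Finsupp.single (c.rep s) a⁻¹, Finsupp.single_mem_supported ℚ _
    (c.rep_mem_coloopReps hφ ((hasColoop_iff hφ hσ).2 ⟨v, ξ, hc⟩)), ?_⟩
  have h2 := Submodule.neg_mem _ (Submodule.smul_mem _ a⁻¹ h1)
  rw [smul_sub, smul_smul, inv_mul_cancel₀ ha0, one_smul, neg_sub] at h2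
  rwa [boundary_single]

theorem exists_boundary_sub_mem [NumberField E] (hφ : IsDiscreteEmbedding φ) {x : c.Chains n}
    (hx : x ∈ Finsupp.supported ℚ ℚ (c.deflatedReps n)) :
    ∃ y ∈ Finsupp.supported ℚ ℚ (c.coloopReps (n + 1)),
      x - c.boundary n y ∈ Finsupp.supported ℚ ℚ (c.coloopReps n) := by
  rw [Finsupp.supported_eq_span_single] at hx
  induction hx using Submodule.span_induction with
  | mem x hx =>
    obtain ⟨μ, hμ, rfl⟩ := hx
    exact c.exists_boundary_sub_mem_single hφ hμ
  | zero => exact ⟨0, zero_mem _, by simp⟩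
  | add x x' _ _ h h' =>
    obtain ⟨y, hy, h⟩ := h
    obtain ⟨y', hy', h'⟩ := h'
    refine ⟨y + y', add_mem hy hy', ?_⟩
    rw [map_add, add_sub_add_comm]
    exact add_mem h h'
  | smul a x _ h =>
    obtain ⟨y, hy, h⟩ := h
    refine ⟨a • y, Submodule.smul_mem _ _ hy, ?_⟩
    rw [map_smul, ← smul_sub]
    exact Submodule.smul_mem _ _ h

/-- The cycles of the inflation subcomplex are boundaries. -/
theorem exists_boundary_eq [NumberField E] (hφ : IsDiscreteEmbedding φ) {x : c.Chains n}
    (hx : x ∈ c.inflation n) (hcyc : ∀ m, ∀ h : n = m + 1, c.boundary m (h ▸ x) = 0) :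
    ∃ y ∈ c.inflation (n + 1), c.boundary n y = x := by
  rw [inflation_eq_supported, Finsupp.supported_union] at hx
  obtain ⟨d, hd, u, hu, rfl⟩ := Submodule.mem_sup.1 hx
  obtain ⟨y, hy, hyu⟩ := c.exists_boundary_sub_mem hφ hu
  refine ⟨y, ?_, ?_⟩
  · rw [inflation_eq_supported]
    exact Finsupp.supported_mono Set.subset_union_left hy
  -- The boundary of `y` removes the coloop-free part `u`, leaving a cycle supported on coloop
  -- cones.
  have hz : d + u - c.boundary n y ∈ Finsupp.supported ℚ ℚ (c.coloopReps n) := by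
    rw [add_sub_assoc]
    exact add_mem hd hyu
  refine (sub_eq_zero.1 ?_).symm
  -- In degree `0` the cycle condition is void, but no cone of dimension `0` has a coloop; in higher
  -- degrees injectivity of the boundary applies.
  cases n with
  | zero =>
    refine Finsupp.ext fun σ => ?_
    exact (Finsupp.mem_supported' ℚ _).1 hz σ (c.not_mem_coloopReps_zero hφ σ)
  | succ m =>
    refine c.eq_zero_of_boundary_eq_zero hφ hz ?_
    have h1 : c.boundary m (c.boundary (m + 1) y) = 0 :=
      LinearMap.congr_fun (c.boundary_comp_boundary hφ m) y
    rw [map_sub, h1, sub_zero]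
    exact hcyc m rfl

theorem inflationComplex_acyclic [NumberField E] (hφ : IsDiscreteEmbedding φ)
    (hd : ∀ n, c.boundary n ∘ₗ c.boundary (n + 1) = 0)
    (hI : ∀ n, ∀ x ∈ c.inflation (n + 1), c.boundary n x ∈ c.inflation n) :
    (c.inflationComplex hd hI).Acyclic := by
  have hdiff : ∀ n, (c.inflationComplex hd hI).d (n + 1) n =
      ModuleCat.ofHom ((c.boundary n).restrict (hI n)) := fun n =>
    ChainComplex.of_d (fun n => ModuleCat.of ℚ (c.inflation n))
      (fun n => ModuleCat.ofHom ((c.boundary n).restrict (hI n))) n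
  intro n
  rw [HomologicalComplex.exactAt_iff' _ (n + 1) n _ (ChainComplex.prev ℕ n) rfl,
    CategoryTheory.ShortComplex.moduleCat_exact_iff]
  intro x hx
  obtain ⟨y, hy, hyx⟩ := c.exists_boundary_eq hφ (x := (x : c.inflation n).1) x.2 (by
    rintro m rfl
    change (ModuleCat.Hom.hom ((c.inflationComplex hd hI).d (m + 1) _)) x = 0 at hx
    rw [ChainComplex.next_nat_succ, hdiff] at hx
    exact congrArg Subtype.val hx)
  refine ⟨(⟨y, hy⟩ : c.inflation (n + 1)), ?_⟩
  change (ModuleCat.Hom.hom ((c.inflationComplex hd hI).d (n + 1) n)) _ = x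
  rw [hdiff]
  exact Subtype.ext hyx

end ConeChoices

end Acyclicity

end HermitianPerfectCone

open HermitianPerfectCone in
theorem mainTheorem9 (E : Type*) [Field E] [NumberField E] (hdeg : Module.finrank ℚ E = 2)
    [NumberField.IsTotallyComplex E] [IsPrincipalIdealRing (𝓞 E)] (φ : E →+* ℂ) (r : ℕ)
    (c : ConeChoices φ r) :
    ∃ (hd : ∀ n, c.boundary n ∘ₗ c.boundary (n + 1) = 0)
      (hI : ∀ n, ∀ x ∈ c.inflation (n + 1), c.boundary n x ∈ c.inflation n),
      (c.inflationComplex hd hI).Acyclic :=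
  have hφ := isDiscreteEmbedding hdeg φ
  ⟨c.boundary_comp_boundary hφ, c.boundary_mem_inflation hφ,
    c.inflationComplex_acyclic hφ _ _⟩
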